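/- Let $\Sigma=\{0,1,\sharp\}$ and let $A\subseteq\Sigma^*\times\Sigma^*$; write $A(x)=\{y : (x,y)\in A\}$. The machine model is the random access machine (RAM) with integer registers, read-only input registers, additional output registers whose content (a word) is produced by an OUTPUT instruction, indirect addressing, conditional jumps, and addition, subtraction and multiplication; a randomized RAM can moreover draw a fresh uniformly random integer of $\{0,\dots,N\}$, where $N\ge 0$ is the content of a register. Arithmetic instructions and random draws cost linear time in the number of bits of their operands, all other instructions cost $O(1)$; the space used at a step is the total number of bits of the integers stored in the (non-input) registers. Suppose that $A$ is in EnumP: $A(x,y)$ is decidable in polynomial time by a deterministic RAM, and $|y|\le p(|x|)$ for all $x$ and all $y\in A(x)$, for some polynomial $p$. Suppose that $A$ has a polytime uniform generator: a randomized RAM which, on every input $x\in\Sigma^*$, stops in time polynomial in $|x|$ on every run and which, for each $y\in A(x)$, produces $y$ (and nothing else) with probability exactly $1/|A(x)|$ (its output is not constrained when $A(x)=\emptyset$). Then the enumeration problem of $A$ is in randomized $\mathrm{IncP}_1$ with repetitions and polynomial space: there are a randomized RAM $M$, constants $a,b,c\in\mathbb N$ and polynomials $q,s$ such that, for every $x\in\Sigma^*$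 and every rational $\epsilon>0$, with $n=|x|$ and $|\epsilon|$ the number of bits of the numerator and denominator of $\epsilon$ in lowest terms, and with $$B(m)=q(n+|\epsilon|)+c\,m\,(n+1)^a\,\epsilon^{-b},$$ on input $(x,\epsilon)$: 1. with probability greater than $1-\epsilon$, $M$ stops within time $B(|A(x)|)$, the set of words that it produces (each possibly several times) is exactly $A(x)$, and for every $m\le|A(x)|$ at least $m$ distinct elements of $A(x)$ are produced within time $B(m)$; 2. on every run and at every step, $M$ uses space at most $s(n+|\epsilon|)$. -/

import Mathlib

open scoped ENNReal

namespace EnumRAM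

/-- The alphabet `{0, 1, ♯}`. -/
abbrev Symbol := Fin 3

/-- Finite words over the alphabet; the size of a word is its length. -/
abbrev Word := List Symbol

/-- Number of bits of (the absolute value of) an integer. -/
def bits (z : ℤ) : ℕ := Nat.size z.natAbs

/-- Instructions of a randomized random access machine with integer registers `R 0, R 1, ...`,
read-only input registers `I 0, I 1, ...` and additional output registers `O 0, O 1, ...`.
An address computed at run time that is negative is read as `0`. -/
inductive Instr where
  /-- `R i := z` -/
  | const (i : ℕ) (z : ℤ)
  /-- `R i := R j` -/
  | copy (i j : ℕ)
  /-- `R i := R (R j)` -/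
  | load (i j : ℕ)
  /-- `R (R i) := R j` -/
  | store (i j : ℕ)
  /-- `R i := I (R j)` -/
  | read (i j : ℕ)
  /-- `O (R i) := R j` -/
  | write (i j : ℕ)
  /-- `R i := R j + R k` -/
  | add (i j k : ℕ)
  /-- `R i := R j - R k` -/
  | sub (i j k : ℕ)
  /-- `R i := R j * R k` -/
  | mul (i j k : ℕ)
  /-- `R i :=` a fresh uniformly random integer of `{0, ..., max (R j) 0}` -/
  | rand (i j : ℕ)
  /-- go to instruction number `l` -/
  | jump (l : ℕ)
  /-- go to instruction number `l` if `R i = 0` -/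
  | jumpZero (i l : ℕ)
  /-- go to instruction number `l` if `R i < 0` -/
  | jumpNeg (i l : ℕ)
  /-- produce the word which is in the output registers -/
  | output

/-- A program is a list of instructions; it stops when the program counter leaves the list. -/
abbrev Program := List Instr

/-- A program without random draws. -/
def Deterministic (P : Program) : Prop := ∀ i j : ℕ, Instr.rand i j ∉ P

/-- A configuration, together with the total cost `time` of the instructions executed so far and
the list `outputs` of the words produced so far, in order of production. Each word comes with the
total cost of the instructions executed before the instruction that produced it. -/
structure Config where
  pc : ℕ
  reg : ℕ →₀ ℤ
  out : ℕ →₀ ℤ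
  time : ℕ
  outputs : List (ℕ × Word)

/-- The symbols `0, 1, ♯` are stored in a register as `1, 2, 3`. -/
def symbolOf (z : ℤ) : Option Symbol :=
  if z = 1 then some 0 else if z = 2 then some 1 else if z = 3 then some 2 else none

/-- The word in the output registers: the symbols in `O 0, O 1, ...` up to the first register which
does not hold a symbol. (Registers before that one are nonzero, so looking at as many registers as
there are nonzero ones is enough.) -/
def outWord (o : ℕ →₀ ℤ) : Word :=
  (((List.range o.support.card).map fun i => symbolOf (o i)).takeWhile Option.isSome).reduceOption

/-- Arithmetic instructions and random draws have a cost linear in the number of bits of their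
operands, every other instruction has unit cost. -/
def cost (r : ℕ →₀ ℤ) : Instr → ℕ
  | .add _ j k => 1 + bits (r j) + bits (r k)
  | .sub _ j k => 1 + bits (r j) + bits (r k)
  | .mul _ j k => 1 + bits (r j) + bits (r k)
  | .rand _ j => 1 + bits (r j)
  | _ => 1

/-- The configuration after an instruction that writes `v` in `R i`. -/
noncomputable def setReg (c : Config) (t : ℕ) (i : ℕ) (v : ℤ) : Config :=
  { c with pc := c.pc + 1, reg := c.reg.update i v, time := t }

/-- Effect of one instruction: the distribution of the next configuration. -/
noncomputable def exec (I : List ℤ) (c : Config) (ins : Instr) : PMF Config :=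
  let r := c.reg
  let t := c.time + cost r ins
  match ins with
  | .const i z => PMF.pure (setReg c t i z)
  | .copy i j => PMF.pure (setReg c t i (r j))
  | .load i j => PMF.pure (setReg c t i (r (r j).toNat))
  | .store i j => PMF.pure (setReg c t (r i).toNat (r j))
  | .read i j => PMF.pure (setReg c t i (I.getD (r j).toNat 0))
  | .write i j =>
      PMF.pure { c with pc := c.pc + 1, out := c.out.update (r i).toNat (r j), time := t }
  | .add i j k => PMF.pure (setReg c t i (r j + r k))
  | .sub i j k => PMF.pure (setReg c t i (r j - r k))
  | .mul i j k => PMF.pure (setReg c t i (r j * r k))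
  | .rand i j =>
      (PMF.uniformOfFintype (Fin ((r j).toNat + 1))).map
        fun v : Fin ((r j).toNat + 1) => setReg c t i (v.val : ℤ)
  | .jump l => PMF.pure { c with pc := l, time := t }
  | .jumpZero i l => PMF.pure { c with pc := if r i = 0 then l else c.pc + 1, time := t }
  | .jumpNeg i l => PMF.pure { c with pc := if r i < 0 then l else c.pc + 1, time := t }
  | .output =>
      PMF.pure
        { c with pc := c.pc + 1, time := t, outputs := c.outputs ++ [(c.time, outWord c.out)] }

/-- One step of the program `P` on input registers `I`; a stopped configuration does not change. -/
noncomputable def step (P : Program) (I : List ℤ) (c : Config) : PMF Config :=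
  match P[c.pc]? with
  | none => PMF.pure c
  | some ins => exec I c ins

/-- The initial configuration: all registers are zero, nothing has been produced. -/
def init : Config := { pc := 0, reg := 0, out := 0, time := 0, outputs := [] }

/-- The distribution of the configuration after `N` steps. -/
noncomputable def run (P : Program) (I : List ℤ) : ℕ → PMF Config
  | 0 => PMF.pure init
  | N + 1 => (run P I N).bind (step P I)

/-- The program has stopped. -/
def Halted (P : Program) (c : Config) : Prop := P.length ≤ c.pc

/-- Every run of `P` on `I` stops, the total cost being at most `T`. -/
def HaltsInTime (P : Program) (I : List ℤ) (T : ℕ) : Prop :=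
  ∃ N, ∀ c ∈ (run P I N).support, Halted P c ∧ c.time ≤ T

/-- The probability that `P` stops on `I` in a final configuration that satisfies `E`. -/
noncomputable def haltProb (P : Program) (I : List ℤ) (E : Config → Prop) : ℝ≥0∞ :=
  ⨆ N, (run P I N).toOuterMeasure {c | Halted P c ∧ E c}

/-- The space used in a configuration: the total number of bits in the registers. -/
def space (c : Config) : ℕ := (c.reg.sum fun _ v => bits v) + (c.out.sum fun _ v => bits v)

/-- In every run of `P` on `I`, the space used is at most `S` at every step. -/
def UsesSpace (P : Program) (I : List ℤ) (S : ℕ) : Prop :=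
  ∀ N, ∀ c ∈ (run P I N).support, space c ≤ S

/-- Contents of the input registers for a word: one symbol per register, as `1, 2, 3`. The
registers after the word hold `0`. -/
def encWord (x : Word) : List ℤ := x.map fun s => ((s : ℕ) : ℤ) + 1

/-- Contents of the input registers for a pair of words. -/
def encPair (x y : Word) : List ℤ := encWord x ++ 0 :: encWord y

/-- Contents of the input registers for a word and a rational number. -/
def encWordRat (x : Word) (ε : ℚ) : List ℤ := encWord x ++ [0, ε.num, (ε.den : ℤ)]

/-- The size of the binary encoding of a rational number. -/
def ratSize (ε : ℚ) : ℕ := bits ε.num + bits (ε.den : ℤ)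

/-- The problem of enumerating `A x` on input `x` is in EnumP: the predicate `y ∈ A x` is decidable
in polynomial time (the answer is whether `R 0` is nonzero at the end), and it is polynomially
balanced. -/
def EnumP (A : Word → Set Word) : Prop :=
  (∃ (D : Program) (p : Polynomial ℕ), Deterministic D ∧ ∀ x y : Word,
    HaltsInTime D (encPair x y) (p.eval (x.length + y.length)) ∧
    (y ∈ A x ↔ haltProb D (encPair x y) (fun c => c.reg 0 ≠ 0) = 1)) ∧
  ∃ p : Polynomial ℕ, ∀ x : Word, ∀ y ∈ A x, y.length ≤ p.eval x.length

/-- `G` is a polytime uniform generator for `A`: it is a randomized machine which stops in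
polynomial time on every input word `x`, and it produces each element of `A x` (and then nothing
else) with probability `1 / |A x|`. -/
def IsPolytimeUniformGenerator (A : Word → Set Word) (G : Program) : Prop :=
  (∃ p : Polynomial ℕ, ∀ x : Word, HaltsInTime G (encWord x) (p.eval x.length)) ∧
  ∀ x : Word, ∀ y ∈ A x,
    haltProb G (encWord x) (fun c => c.outputs.map Prod.snd = [y]) = ((A x).ncard : ℝ≥0∞)⁻¹

/-- The run that led to `c` has enumerated `S`, possibly with repetitions, in incremental time `B`:
the set of words produced is `S`, for every `m ≤ |S|` at least `m` distinct elements of `S` are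
produced in time `B m`, and the total time is at most `B |S|`. -/
def EnumeratesInIncTime (S : Set Word) (B : ℕ → ℝ) (c : Config) : Prop :=
  {w | ∃ t, (t, w) ∈ c.outputs} = S ∧
  (∀ m ≤ S.ncard, m ≤ {w | ∃ t : ℕ, (t, w) ∈ c.outputs ∧ (t : ℝ) ≤ B m}.ncard) ∧
  (c.time : ℝ) ≤ B S.ncard

/-- `A` is in randomized `IncP_k` with repetitions and polynomial space. On input `x` and `ε`, after
a precomputation in time polynomial in the size of the input, the incremental time is
`c * m ^ k * (|x| + 1) ^ a * ε ^ (-b)`, with probability greater than `1 - ε`; the space is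
polynomial in the size of the input in every run. -/
def RandIncPRepetitionsPolySpace (k : ℕ) (A : Word → Set Word) : Prop :=
  EnumP A ∧
  ∃ (M : Program) (a b c : ℕ) (q s : Polynomial ℕ), ∀ (x : Word) (ε : ℚ), 0 < ε →
    1 - (ε : ℝ) <
      (haltProb M (encWordRat x ε) (EnumeratesInIncTime (A x) fun m =>
        ((q.eval (x.length + ratSize ε) : ℕ) : ℝ) +
          c * (m : ℝ) ^ k * ((x.length : ℝ) + 1) ^ a * ((ε : ℝ)⁻¹) ^ b)).toReal ∧
    UsesSpace M (encWordRat x ε) (s.eval (x.length + ratSize ε))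

end EnumRAM

open scoped ENNReal

namespace EnumRAM

/-! ### Runs from an arbitrary configuration -/

/-! Repeated uniform draws enumerate `A x` as in the coupon collector problem. The difficulty is to
stop in polynomial space: the words already seen cannot be stored, and `|A x|` is unknown. The
machine therefore draws one reference word `y`, has it checked by the decision program, and then
draws and produces words until `y` has come back `k` times, where `k = 48 * l * k₁ ^ 2`, `|A x| ≤ 2
^ l` and `k₁ = 2 ^ precision ε` is at least `1 / ε`. Only `y` and a counter are kept. If `y` is
rejected, nothing is produced; this is what happens when `A x` is empty.

Let `N = |A x| > 0`, `y ∈ A x` and `D = 12 * l * k₁`. Three events can spoil the enumeration. For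
some `m ≤ N`, the first `D * m` draws contain fewer than `m` distinct words: by a union bound over
the sets of `m - 1` words this has probability at most `1 / (8 * k₁)` (`choose_mul_pow_le`). The
word `y` occurs `k` times within the first `D * N` draws: the mean number of occurrences there is
`D`, whatever `N` is, and Markov's inequality gives `D / k = 1 / (4 * k₁)`. The word `y` occurs
fewer than `k` times in `4 * k * N` draws: an exponential moment gives at most `1 / k`
(`two_pow_mul_pow_le`). The sum is less than `1 / k₁ ≤ ε` (`lt_drawMean_goodDraws`). Otherwise the
machine stops after all of `A x` has appeared and before `4 * k * N` draws, and `m` words have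
appeared by draw `D * m ≤ 4 * k * m`.

The rest is a construction on the RAM. Given programs are run by a simulator that logs each address
written, so that the memory can be erased afterwards at a cost proportional to the length of the
log. Hence every round starts from the same small memory and has the same time bound, and the space
is bounded even on runs that never stop (`space_le_of_checkpoints`, `Layout.usesSpace`).
Probabilities are bounded below by the predicate `Leads`, which carries an expected weight along the
execution: `Sim.leads` transports expectations through the simulator, `Layout.leads_prep` and
`Layout.leads_round` describe the stages, and `Layout.drawMean_le_haltFrom` compares the main loop
with independent uniform draws. -/

/-- The distribution of the configuration after `N` steps from `c`. -/
noncomputable def runFrom (P : Program) (I : List ℤ) : ℕ → Config → PMF Config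
  | 0, c => PMF.pure c
  | N + 1, c => (step P I c).bind (runFrom P I N)

/-- Bridges the two recursions: `runFrom` splits off the first step, `run` the last one. -/
theorem runFrom_succ' (P : Program) (I : List ℤ) (N : ℕ) (c : Config) :
    runFrom P I (N + 1) c = (runFrom P I N c).bind (step P I) := by
  induction N generalizing c with
  | zero => simp only [runFrom, PMF.pure_bind]; exact PMF.bind_pure _
  | succ N ih =>
    rw [runFrom]
    conv_lhs => enter [2]; ext c'; rw [ih c']
    rw [runFrom, PMF.bind_bind]

theorem run_eq_runFrom (P : Program) (I : List ℤ) (N : ℕ) : run P I N = runFrom P I N init := by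
  induction N with
  | zero => rfl
  | succ N ih => rw [runFrom_succ', ← ih]; rfl

theorem step_of_halted {P : Program} {I : List ℤ} {c : Config} (h : Halted P c) :
    step P I c = PMF.pure c := by
  unfold step
  rw [List.getElem?_eq_none h]

theorem step_eq_exec {P : Program} {I : List ℤ} {c : Config} {ins : Instr}
    (h : P[c.pc]? = some ins) : step P I c = exec I c ins := by
  unfold step
  rw [h]

theorem runFrom_of_halted {P : Program} {I : List ℤ} {c : Config} (h : Halted P c) (N : ℕ) :
    runFrom P I N c = PMF.pure c := by
  induction N with
  | zero => rfl
  | succ N ih => rw [runFrom, step_of_halted h, PMF.pure_bind, ih]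

/-- The probability to once from `c` in a configuration satisfying `E`. -/
noncomputable def haltFrom (P : Program) (I : List ℤ) (E : Config → Prop) (c : Config) : ℝ≥0∞ :=
  ⨆ N, (runFrom P I N c).toOuterMeasure {c | Halted P c ∧ E c}

theorem haltProb_eq_haltFrom (P : Program) (I : List ℤ) (E : Config → Prop) :
    haltProb P I E = haltFrom P I E init := by
  simp only [haltProb, haltFrom, run_eq_runFrom]

theorem haltFrom_of_halted {P : Program} {I : List ℤ} {E : Config → Prop} {c : Config}
    (h : Halted P c) (hE : E c) : haltFrom P I E c = 1 := by
  simp only [haltFrom, runFrom_of_halted h]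
  rw [ciSup_const, PMF.toOuterMeasure_pure_apply, if_pos ⟨h, hE⟩]

theorem toOuterMeasure_runFrom_succ (P : Program) (I : List ℤ) (s : Set Config) (N : ℕ)
    (c : Config) : (runFrom P I (N + 1) c).toOuterMeasure s =
      ∑' c', step P I c c' * (runFrom P I N c').toOuterMeasure s := by
  rw [runFrom, PMF.toOuterMeasure_bind_apply]

/-- A halted configuration no longer changes, so the event of having halted in `E` can only gain
mass. The supremum in `haltFrom` is thus a monotone limit. -/
theorem toOuterMeasure_runFrom_mono (P : Program) (I : List ℤ) (E : Config → Prop) (c : Config) :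
    Monotone fun N => (runFrom P I N c).toOuterMeasure {c | Halted P c ∧ E c} := by
  refine monotone_nat_of_le_succ fun N => ?_
  induction N generalizing c with
  | zero =>
    rw [runFrom, PMF.toOuterMeasure_pure_apply]
    split_ifs with h
    · rw [runFrom_of_halted h.1, PMF.toOuterMeasure_pure_apply, if_pos h]
    · exact zero_le
  | succ N ih =>
    rw [toOuterMeasure_runFrom_succ, toOuterMeasure_runFrom_succ]
    exact ENNReal.tsum_le_tsum fun c' => mul_le_mul_right (ih c') _

/-- Half of the first-step equation, enough because only lower bounds on success are wanted.
Monotone suprema commute with finite sums, and the infinite sum is the supremum of the finite ones.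
-/
theorem tsum_step_mul_haltFrom_le (P : Program) (I : List ℤ) (E : Config → Prop) (c : Config) :
    ∑' c', step P I c c' * haltFrom P I E c' ≤ haltFrom P I E c := by
  rw [ENNReal.tsum_eq_iSup_sum]
  refine iSup_le fun s => ?_
  simp only [haltFrom, ENNReal.mul_iSup]
  rw [ENNReal.finsetSum_iSup_of_monotone]
  · refine iSup_le fun N => ?_
    refine le_trans ?_ (le_iSup _ (N + 1))
    rw [toOuterMeasure_runFrom_succ]
    exact ENNReal.sum_le_tsum s
  · intro c' N N' h
    exact mul_le_mul_right (toOuterMeasure_runFrom_mono P I E c' h) _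

/-! ### Inevitability with expected weight -/

/-- Every run from `c` reaches `Q`, the time being at most `B` before that, and the expected weight
at that moment is at least `w`. -/
inductive Leads (P : Program) (I : List ℤ) (Q : Config → ℝ≥0∞ → Prop) (B : ℕ) :
    Config → ℝ≥0∞ → Prop
  | done {c : Config} {w : ℝ≥0∞} : Q c w → Leads P I Q B c w
  | step {c : Config} {w : ℝ≥0∞} (f : Config → ℝ≥0∞) : c.time ≤ B →
      (∀ c' ∈ (step P I c).support, Leads P I Q B c' (f c')) →
      w ≤ ∑' c', EnumRAM.step P I c c' * f c' → Leads P I Q B c w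

/-- Soundness of `Leads`: a derivation is a well-founded tree, the weights at its leaves are bounded
by hypothesis, and at a node the first-step inequality averages the bounds of the children. -/
theorem Leads.le_haltFrom {P : Program} {I : List ℤ} {Q : Config → ℝ≥0∞ → Prop} {B : ℕ}
    {E : Config → Prop} {c : Config} {w : ℝ≥0∞} (h : Leads P I Q B c w)
    (hQ : ∀ c w, Q c w → w ≤ haltFrom P I E c) : w ≤ haltFrom P I E c := by
  induction h with
  | done h => exact hQ _ _ h
  | @step c w f _ _ hw ih =>
    refine hw.trans (le_trans (ENNReal.tsum_le_tsum fun c' => ?_)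
      (tsum_step_mul_haltFrom_le P I E c))
    by_cases hc : EnumRAM.step P I c c' = 0
    · simp [hc]
    · exact mul_le_mul_right (ih c' ((PMF.mem_support_iff _ _).2 hc)) _

/-- Time bounds refer to the absolute clock, so successive stages compare their bounds instead of
adding them. -/
theorem Leads.trans {P : Program} {I : List ℤ} {Q Q' : Config → ℝ≥0∞ → Prop} {B B' : ℕ}
    {c : Config} {w : ℝ≥0∞} (h : Leads P I Q B c w) (hB : B ≤ B')
    (hQ : ∀ c w, Q c w → Leads P I Q' B' c w) : Leads P I Q' B' c w := by
  induction h with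
  | done h => exact hQ _ _ h
  | step f ht _ hw ih => exact .step f (ht.trans hB) ih hw

theorem Leads.of_step_eq_pure {P : Program} {I : List ℤ} {Q : Config → ℝ≥0∞ → Prop} {B : ℕ}
    {c c' : Config} {w : ℝ≥0∞} (h : EnumRAM.step P I c = PMF.pure c') (ht : c.time ≤ B)
    (hl : Leads P I Q B c' w) : Leads P I Q B c w := by
  refine .step (fun _ => w) ht (fun d hd => ?_) ?_
  · rw [h, PMF.support_pure, Set.mem_singleton_iff] at hd
    rwa [hd]
  · rw [ENNReal.tsum_mul_right, PMF.tsum_coe, one_mul]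

/-! ### Sizes of integers -/

theorem bits_le_iff {z : ℤ} {b : ℕ} : bits z ≤ b ↔ z.natAbs < 2 ^ b := Nat.size_le

@[simp] theorem bits_zero : bits 0 = 0 := rfl

theorem bits_natCast_le_self (n : ℕ) : bits (n : ℤ) ≤ n := by
  rw [bits_le_iff]; simpa using Nat.lt_two_pow_self

theorem bits_add_le (x y : ℤ) : bits (x + y) ≤ max (bits x) (bits y) + 1 := by
  rw [bits_le_iff, pow_succ, mul_two]
  refine (Int.natAbs_add_le x y).trans_lt (add_lt_add ?_ ?_)
  · exact bits_le_iff.1 (le_max_left _ _)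
  · exact bits_le_iff.1 (le_max_right _ _)

theorem bits_neg (x : ℤ) : bits (-x) = bits x := by simp [bits]

theorem bits_sub_le (x y : ℤ) : bits (x - y) ≤ max (bits x) (bits y) + 1 := by
  rw [sub_eq_add_neg, ← bits_neg y]; exact bits_add_le _ _

theorem bits_mul_le (x y : ℤ) : bits (x * y) ≤ bits x + bits y := by
  rw [bits_le_iff, pow_add, Int.natAbs_mul]
  exact Nat.mul_lt_mul'' (bits_le_iff.1 le_rfl) (bits_le_iff.1 le_rfl)

theorem bits_mono {x y : ℤ} (h : x.natAbs ≤ y.natAbs) : bits x ≤ bits y := Nat.size_le_size h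

/-! ### Growth of the memory -/

/-- The number of bits of the constant that an instruction can write. -/
def immBits : Instr → ℕ
  | .const _ z => bits z
  | _ => 0

/-- The contents of the memory are bounded, up to the time elapsed since `t₀`. -/
structure Grow (b s t₀ : ℕ) (c : Config) : Prop where
  time : t₀ ≤ c.time
  reg : ∀ a, bits (c.reg a) + t₀ ≤ b + c.time
  out : ∀ a, bits (c.out a) + t₀ ≤ b + c.time
  cardReg : c.reg.support.card + t₀ ≤ s + c.time
  cardOut : c.out.support.card + t₀ ≤ s + c.time

theorem card_support_update_le (f : ℕ →₀ ℤ) (i : ℕ) (v : ℤ) :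
    (f.update i v).support.card ≤ f.support.card + 1 := by
  refine (Finset.card_le_card (Finsupp.support_update_subset (f := f) (a := i) (b := v))).trans ?_
  exact Finset.card_insert_le _ _

theorem bits_getD_le {I : List ℤ} {b : ℕ} (hI : ∀ v ∈ I, bits v ≤ b) (i : ℕ) :
    bits (I.getD i 0) ≤ b := by
  by_cases h : i < I.length
  · rw [List.getD_eq_getElem _ _ h]; exact hI _ (List.getElem_mem h)
  · rw [List.getD_eq_default _ _ (not_lt.1 h)]; simp

theorem Grow.setReg {b s t₀ : ℕ} {c : Config} (h : Grow b s t₀ c) {t i : ℕ} {v : ℤ}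
    (ht : c.time + 1 ≤ t) (hv : bits v + t₀ ≤ b + t) : Grow b s t₀ (setReg c t i v) where
  time := by have := h.time; simp only [EnumRAM.setReg]; omega
  reg a := by
    have := h.reg a
    simp only [EnumRAM.setReg, Finsupp.coe_update, Function.update_apply]
    split_ifs <;> omega
  out a := by have := h.out a; simp only [EnumRAM.setReg]; omega
  cardReg := by
    have := h.cardReg
    have := card_support_update_le c.reg i v
    simp only [EnumRAM.setReg]; omega
  cardOut := by have := h.cardOut; simp only [EnumRAM.setReg]; omega

theorem Grow.mono_time {b s t₀ : ℕ} {c c' : Config} (h : Grow b s t₀ c) (hr : c'.reg = c.reg)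
    (ho : c'.out = c.out) (ht : c.time ≤ c'.time) : Grow b s t₀ c' where
  time := h.time.trans ht
  reg a := by have := h.reg a; rw [hr]; omega
  out a := by have := h.out a; rw [ho]; omega
  cardReg := by have := h.cardReg; rw [hr]; omega
  cardOut := by have := h.cardOut; rw [ho]; omega

/-- Memory is paid for by time. A sum has at most one bit more than its longer operand and a product
at most the bits of both, which the cost covers; a random draw does not exceed its operand; all
other values are copies, constants or inputs. Each instruction makes at most one more register
nonzero and costs at least `1`. -/
theorem Grow.exec {b s t₀ : ℕ} {I : List ℤ} {c c' : Config} {ins : Instr} (h : Grow b s t₀ c)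
    (hins : immBits ins ≤ b) (hI : ∀ v ∈ I, bits v ≤ b)
    (hc : c' ∈ (exec I c ins).support) : Grow b s t₀ c' := by
  have ht := h.time
  cases ins <;> simp only [EnumRAM.exec, cost, PMF.support_pure, PMF.support_map,
    Set.mem_singleton_iff, Set.mem_image] at hc
  case const i z => subst hc; exact h.setReg le_rfl (by simp only [immBits] at hins; omega)
  case copy i j => subst hc; exact h.setReg le_rfl (by have := h.reg j; omega)
  case load i j => subst hc; exact h.setReg le_rfl (by have := h.reg (c.reg j).toNat; omega)
  case store i j => subst hc; exact h.setReg le_rfl (by have := h.reg j; omega)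
  case read i j =>
    subst hc; exact h.setReg le_rfl (by have := bits_getD_le hI (c.reg j).toNat; omega)
  case write i j =>
    subst hc
    refine ⟨by simp only; omega, fun a => by have := h.reg a; simp only; omega, fun a => ?_,
      by have := h.cardReg; simp only; omega, ?_⟩
    · have := h.out a
      have := h.reg j
      simp only [Finsupp.coe_update, Function.update_apply]
      split_ifs <;> omega
    · have := h.cardOut
      have := card_support_update_le c.out (c.reg i).toNat (c.reg j)
      simp only; omega
  case add i j k =>
    subst hc; exact h.setReg (by omega) (by have := bits_add_le (c.reg j) (c.reg k); omega)
  case sub i j k =>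
    subst hc; exact h.setReg (by omega) (by have := bits_sub_le (c.reg j) (c.reg k); omega)
  case mul i j k =>
    subst hc; exact h.setReg (by omega) (by have := bits_mul_le (c.reg j) (c.reg k); omega)
  case rand i j =>
    obtain ⟨v, -, rfl⟩ := hc
    refine h.setReg (by omega) ?_
    have : bits ((v : ℕ) : ℤ) ≤ bits (c.reg j) := bits_mono (by have := v.2; omega)
    omega
  case jump l => subst hc; exact h.mono_time rfl rfl (by simp)
  case jumpZero i l => subst hc; exact h.mono_time rfl rfl (by simp)
  case jumpNeg i l => subst hc; exact h.mono_time rfl rfl (by simp)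
  case output => subst hc; exact h.mono_time rfl rfl (by simp)

theorem Grow.step {b s t₀ : ℕ} {P : Program} {I : List ℤ} {c c' : Config} (h : Grow b s t₀ c)
    (hP : ∀ ins ∈ P, immBits ins ≤ b) (hI : ∀ v ∈ I, bits v ≤ b)
    (hc : c' ∈ (step P I c).support) : Grow b s t₀ c' := by
  unfold EnumRAM.step at hc
  split at hc
  · rw [PMF.support_pure, Set.mem_singleton_iff] at hc; rwa [hc]
  · next ins hi => exact h.exec (hP _ (List.mem_of_getElem? hi)) hI hc

theorem Grow.space_le {b s t₀ Δ : ℕ} {c : Config} (h : Grow b s t₀ c) (ht : c.time ≤ t₀ + Δ) :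
    space c ≤ 2 * ((s + Δ) * (b + Δ)) := by
  have key : ∀ f : ℕ →₀ ℤ, (∀ a, bits (f a) + t₀ ≤ b + c.time) →
      f.support.card + t₀ ≤ s + c.time → (f.sum fun _ v => bits v) ≤ (s + Δ) * (b + Δ) := by
    intro f hf hs
    refine (Finset.sum_le_card_nsmul _ _ (b + Δ) fun a _ => ?_).trans ?_
    · have := hf a; change bits (f a) ≤ _; omega
    · rw [smul_eq_mul]; exact Nat.mul_le_mul_right _ (by omega)
  have h1 := key c.reg h.reg h.cardReg
  have h2 := key c.out h.out h.cardOut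
  unfold space
  omega

theorem time_le_of_mem_support_exec {I : List ℤ} {c c' : Config} {ins : Instr}
    (hc : c' ∈ (exec I c ins).support) : c'.time = c.time + cost c.reg ins := by
  cases ins <;> simp only [exec, PMF.support_pure, PMF.support_map,
    Set.mem_singleton_iff, Set.mem_image, setReg] at hc
  case rand i j => obtain ⟨v, -, rfl⟩ := hc; rfl
  all_goals subst hc; rfl

theorem time_le_of_mem_support_step {P : Program} {I : List ℤ} {c c' : Config}
    (hc : c' ∈ (step P I c).support) : c.time ≤ c'.time := by
  unfold step at hc
  split at hc
  · rw [PMF.support_pure, Set.mem_singleton_iff] at hc; rw [hc]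
  · have := time_le_of_mem_support_exec hc; omega

theorem time_le_of_mem_support_runFrom {P : Program} {I : List ℤ} {N : ℕ} {c c' : Config}
    (hc : c' ∈ (runFrom P I N c).support) : c.time ≤ c'.time := by
  induction N generalizing c with
  | zero => rw [runFrom, PMF.support_pure, Set.mem_singleton_iff] at hc; rw [hc]
  | succ N ih =>
    rw [runFrom, PMF.mem_support_bind_iff] at hc
    obtain ⟨d, hd, hc⟩ := hc
    exact (time_le_of_mem_support_step hd).trans (ih hc)

/-- If every run from a checkpoint comes to another checkpoint within a bounded time, or stops, then
the space used is bounded. -/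
theorem space_le_of_checkpoints {P : Program} {I : List ℤ} {b s Δ : ℕ}
    (hP : ∀ ins ∈ P, immBits ins ≤ b) (hI : ∀ v ∈ I, bits v ≤ b) {Q : Config → Prop}
    (hg : ∀ c, Q c → Grow b s c.time c)
    (hQ : ∀ c, Q c → Halted P c ∨ ∃ c₁ w, step P I c = PMF.pure c₁ ∧
      Leads P I (fun c _ => Q c) (c.time + Δ) c₁ w)
    {c c' : Config} (hc : Q c) (N : ℕ) (hc' : c' ∈ (runFrom P I N c).support) :
    space c' ≤ 2 * ((s + Δ) * (b + Δ)) := by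
  induction N using Nat.strong_induction_on generalizing c with
  | _ N ih =>
    have h0 : space c ≤ 2 * ((s + Δ) * (b + Δ)) := (hg c hc).space_le (by omega)
    rcases hQ c hc with hh | ⟨c₁, w, h1, hl⟩
    · rw [runFrom_of_halted hh, PMF.support_pure, Set.mem_singleton_iff] at hc'
      rwa [hc']
    · cases N with
      | zero => rw [runFrom, PMF.support_pure, Set.mem_singleton_iff] at hc'; rwa [hc']
      | succ N =>
        rw [runFrom, h1, PMF.pure_bind] at hc'
        have hgr : Grow b s c.time c₁ := (hg c hc).step hP hI (by rw [h1]; simp)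
        -- Inner induction along the derivation of `Leads`, with at most `N` steps left. When a
        -- checkpoint is met the outer hypothesis applies, because the step from `c` to `c₁` has
        -- already used up one of the `N + 1` steps.
        suffices H : ∀ d w, Leads P I (fun c _ => Q c) (c.time + Δ) d w → Grow b s c.time d →
            ∀ M ≤ N, c' ∈ (runFrom P I M d).support → space c' ≤ 2 * ((s + Δ) * (b + Δ)) from
          H _ _ hl hgr N le_rfl hc'
        intro d w hd
        induction hd with
        | done h => intro _ M hM hm; exact ih M (by omega) h hm
        | @step d w f ht _ _ ih2 =>
          intro hgd M hM hm
          cases M with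
          | zero =>
            rw [runFrom, PMF.support_pure, Set.mem_singleton_iff] at hm
            rw [hm]; exact hgd.space_le ht
          | succ M =>
            rw [runFrom, PMF.mem_support_bind_iff] at hm
            obtain ⟨e, he, hm⟩ := hm
            exact ih2 e he (hgd.step hP hI he) M (by omega) hm

/-! ### Deterministic execution -/

/-- Deterministic reachability. -/
def Reach (P : Program) (I : List ℤ) : Config → Config → Prop :=
  Relation.ReflTransGen fun c c' => step P I c = PMF.pure c'

theorem Reach.time_le {P : Program} {I : List ℤ} {c c' : Config} (h : Reach P I c c') :
    c.time ≤ c'.time := by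
  induction h with
  | refl => exact le_rfl
  | tail _ h ih => exact ih.trans (time_le_of_mem_support_step (by rw [h]; simp))

theorem Reach.trans {P : Program} {I : List ℤ} {c c' c'' : Config} (h : Reach P I c c')
    (h' : Reach P I c' c'') : Reach P I c c'' := Relation.ReflTransGen.trans h h'

theorem Reach.leads {P : Program} {I : List ℤ} {Q : Config → ℝ≥0∞ → Prop} {B : ℕ}
    {c c' : Config} {w : ℝ≥0∞} (h : Reach P I c c') (ht : c'.time ≤ B)
    (hl : Leads P I Q B c' w) : Leads P I Q B c w := by
  induction h using Relation.ReflTransGen.head_induction_on with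
  | refl => exact hl
  | head h1 h2 ih =>
    exact .of_step_eq_pure h1 ((Reach.time_le (.head h1 h2)).trans ht) ih

/-- The configuration `c` moved to the instruction number `b`. -/
def Config.goto (c : Config) (b : ℕ) : Config := { c with pc := b }

/-- The configuration `c` with time `t`. -/
def Config.withTime (c : Config) (t : ℕ) : Config := { c with time := t }

@[simp] theorem Config.goto_pc (c : Config) (b : ℕ) : (c.goto b).pc = b := rfl
@[simp] theorem Config.goto_reg (c : Config) (b : ℕ) : (c.goto b).reg = c.reg := rfl
@[simp] theorem Config.goto_out (c : Config) (b : ℕ) : (c.goto b).out = c.out := rfl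
@[simp] theorem Config.goto_time (c : Config) (b : ℕ) : (c.goto b).time = c.time := rfl
@[simp] theorem Config.goto_outputs (c : Config) (b : ℕ) : (c.goto b).outputs = c.outputs := rfl
@[simp] theorem Config.goto_self (c : Config) : c.goto c.pc = c := rfl
@[simp] theorem Config.withTime_reg (c : Config) (t : ℕ) : (c.withTime t).reg = c.reg := rfl
@[simp] theorem Config.withTime_out (c : Config) (t : ℕ) : (c.withTime t).out = c.out := rfl
@[simp] theorem Config.withTime_time (c : Config) (t : ℕ) : (c.withTime t).time = t := rfl
@[simp] theorem Config.withTime_outputs (c : Config) (t : ℕ) :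
    (c.withTime t).outputs = c.outputs := rfl

/-! ### Code fragments at an arbitrary address, and straight-line code -/

/-- The code `l` is in the program `P` from the instruction number `b` on. -/
def CodeAt (P : Program) (b : ℕ) (l : List Instr) : Prop :=
  ∀ i, (h : i < l.length) → P[b + i]? = some l[i]

theorem CodeAt.left {P : Program} {b : ℕ} {l l' : List Instr} (h : CodeAt P b (l ++ l')) :
    CodeAt P b l := fun i hi => by
  have := h i (by simp; omega)
  rwa [List.getElem_append_left hi] at this

theorem CodeAt.right {P : Program} {b : ℕ} {l l' : List Instr} (h : CodeAt P b (l ++ l')) :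
    CodeAt P (b + l.length) l' := fun i hi => by
  have := h (l.length + i) (by simp; omega)
  rw [List.getElem_append_right (by omega)] at this
  simpa [add_assoc] using this

theorem CodeAt.head {P : Program} {b : ℕ} {a : Instr} {l : List Instr} (h : CodeAt P b (a :: l)) :
    P[b]? = some a := h 0 (by simp)

theorem CodeAt.tail {P : Program} {b : ℕ} {a : Instr} {l : List Instr} (h : CodeAt P b (a :: l)) :
    CodeAt P (b + 1) l := CodeAt.right (l := [a]) h

/-- A line of straight code: an instruction, or `R i := max (R i) 0`. -/
inductive Line where
  | prim (ins : Instr)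
  | clamp (i : ℕ)

/-- The instructions that are neither jumps nor random draws. -/
def Instr.straight : Instr → Bool
  | .rand _ _ | .jump _ | .jumpZero _ _ | .jumpNeg _ _ => false
  | _ => true

/-- The instructions that change nothing but a register. -/
def Instr.silent : Instr → Bool
  | .rand _ _ | .jump _ | .jumpZero _ _ | .jumpNeg _ _ | .write _ _ | .output => false
  | _ => true

/-- Effect of a straight instruction on the registers. -/
def Instr.evReg (I : List ℤ) : Instr → (ℕ → ℤ) → ℕ → ℤ
  | .const i z, r => Function.update r i z
  | .copy i j, r => Function.update r i (r j)
  | .load i j, r => Function.update r i (r (r j).toNat)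
  | .store i j, r => Function.update r (r i).toNat (r j)
  | .read i j, r => Function.update r i (I.getD (r j).toNat 0)
  | .add i j k, r => Function.update r i (r j + r k)
  | .sub i j k, r => Function.update r i (r j - r k)
  | .mul i j k, r => Function.update r i (r j * r k)
  | _, r => r

/-- Effect of a straight instruction. -/
noncomputable def Instr.eff (I : List ℤ) (ins : Instr) (c : Config) : Config :=
  let t := c.time + cost c.reg ins
  match ins with
  | .const i z => { c with reg := c.reg.update i z, time := t }
  | .copy i j => { c with reg := c.reg.update i (c.reg j), time := t }
  | .load i j => { c with reg := c.reg.update i (c.reg (c.reg j).toNat), time := t }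
  | .store i j => { c with reg := c.reg.update (c.reg i).toNat (c.reg j), time := t }
  | .read i j => { c with reg := c.reg.update i (I.getD (c.reg j).toNat 0), time := t }
  | .add i j k => { c with reg := c.reg.update i (c.reg j + c.reg k), time := t }
  | .sub i j k => { c with reg := c.reg.update i (c.reg j - c.reg k), time := t }
  | .mul i j k => { c with reg := c.reg.update i (c.reg j * c.reg k), time := t }
  | .write i j => { c with out := c.out.update (c.reg i).toNat (c.reg j), time := t }
  | .output => { c with time := t, outputs := c.outputs ++ [(c.time, outWord c.out)] }
  | _ => { c with time := t }

theorem Instr.eff_reg (I : List ℤ) (ins : Instr) (c : Config) :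
    ⇑(ins.eff I c).reg = ins.evReg I c.reg := by
  cases ins <;> simp [Instr.eff, Instr.evReg]

theorem Instr.eff_time (I : List ℤ) (ins : Instr) (c : Config) :
    (ins.eff I c).time = c.time + cost c.reg ins := by
  cases ins <;> rfl

theorem Instr.eff_out (I : List ℤ) {ins : Instr} (h : ins.silent) (c : Config) :
    (ins.eff I c).out = c.out := by
  cases ins <;> first | rfl | cases h

theorem Instr.eff_outputs (I : List ℤ) {ins : Instr} (h : ins.silent) (c : Config) :
    (ins.eff I c).outputs = c.outputs := by
  cases ins <;> first | rfl | cases h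

theorem Instr.exec_eq (I : List ℤ) {ins : Instr} (h : ins.straight) (c : Config) (b : ℕ) :
    exec I (c.goto b) ins = PMF.pure ((ins.eff I c).goto (b + 1)) := by
  cases ins <;> first | rfl | cases h

/-- Effect of a line on the registers. -/
def Line.evReg (I : List ℤ) : Line → (ℕ → ℤ) → ℕ → ℤ
  | .prim ins, r => ins.evReg I r
  | .clamp i, r => Function.update r i (max (r i) 0)

/-- Effect of a line. -/
noncomputable def Line.eff (I : List ℤ) : Line → Config → Config
  | .prim ins, c => ins.eff I c
  -- For either sign of `R i` exactly two instructions of unit cost are executed.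
  | .clamp i, c => { c with reg := c.reg.update i (max (c.reg i) 0), time := c.time + 2 }

def Line.straight : Line → Bool
  | .prim ins => ins.straight
  | .clamp _ => true

def Line.silent : Line → Bool
  | .prim ins => ins.silent
  | .clamp _ => true

/-- The machine code of a line. -/
def Line.code (b : ℕ) : Line → List Instr
  | .prim ins => [ins]
  | .clamp i => [.jumpNeg i (b + 2), .jump (b + 3), .const i 0]

def Line.size : Line → ℕ
  | .prim _ => 1
  | .clamp _ => 3

theorem Line.length_code (l : Line) (b : ℕ) : (l.code b).length = l.size := by cases l <;> rfl

theorem Line.eff_reg (I : List ℤ) (l : Line) (c : Config) :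
    ⇑(l.eff I c).reg = l.evReg I c.reg := by
  cases l with
  | prim ins => exact ins.eff_reg I c
  | clamp i => simp [Line.eff, Line.evReg]

theorem Line.eff_out (I : List ℤ) {l : Line} (h : l.silent) (c : Config) :
    (l.eff I c).out = c.out := by
  cases l with
  | prim ins => exact ins.eff_out I h c
  | clamp i => rfl

theorem Line.eff_outputs (I : List ℤ) {l : Line} (h : l.silent) (c : Config) :
    (l.eff I c).outputs = c.outputs := by
  cases l with
  | prim ins => exact ins.eff_outputs I h c
  | clamp i => rfl

theorem Line.reach {P : Program} {I : List ℤ} {l : Line} {b : ℕ} (h : l.straight)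
    (hP : CodeAt P b (l.code b)) (c : Config) :
    Reach P I (c.goto b) ((l.eff I c).goto (b + l.size)) := by
  cases l with
  | prim ins =>
    refine .single ?_
    rw [step_eq_exec (ins := ins) (by exact hP.head)]
    exact ins.exec_eq I h c b
  | clamp i =>
    have h0 := hP.head
    have h1 := hP.tail.head
    have h2 := hP.tail.tail.head
    by_cases hn : c.reg i < 0
    · refine .head (b := { c.goto (b + 2) with time := c.time + 1 }) ?_ (.single ?_)
      · rw [step_eq_exec (ins := .jumpNeg i (b + 2)) (by exact h0)]
        simp [exec, cost, Config.goto, hn]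
      · rw [step_eq_exec (ins := .const i 0) (by exact h2)]
        simp [exec, setReg, cost, Config.goto, Line.eff, Line.size, max_eq_right hn.le]
    · refine .head (b := { c.goto (b + 1) with time := c.time + 1 }) ?_ (.single ?_)
      · rw [step_eq_exec (ins := .jumpNeg i (b + 2)) (by exact h0)]
        simp [exec, cost, Config.goto, hn]
      · rw [step_eq_exec (ins := .jump (b + 3)) (by exact h1)]
        have : max (c.reg i) 0 = c.reg i := max_eq_left (not_lt.1 hn)
        simp [exec, cost, Config.goto, Line.eff, Line.size, this, Finsupp.update_self]

/-- The machine code of a sequence of lines. -/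
def codeLines : ℕ → List Line → List Instr
  | _, [] => []
  | b, l :: ls => l.code b ++ codeLines (b + l.size) ls

def sizeLines (ls : List Line) : ℕ := (ls.map Line.size).sum

@[simp] theorem length_codeLines (b : ℕ) (ls : List Line) :
    (codeLines b ls).length = sizeLines ls := by
  induction ls generalizing b with
  | nil => rfl
  | cons l ls ih => simp [codeLines, sizeLines, Line.length_code, ih] 

/-- Effect of a sequence of lines. -/
noncomputable def effLines (I : List ℤ) : List Line → Config → Config
  | [], c => c
  | l :: ls, c => effLines I ls (l.eff I c)

/-- Effect of a sequence of lines on the registers. -/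
def evRegs (I : List ℤ) : List Line → (ℕ → ℤ) → ℕ → ℤ
  | [], r => r
  | l :: ls, r => evRegs I ls (l.evReg I r)

theorem effLines_reg (I : List ℤ) (ls : List Line) (c : Config) :
    ⇑(effLines I ls c).reg = evRegs I ls c.reg := by
  induction ls generalizing c with
  | nil => rfl
  | cons l ls ih => rw [effLines, ih, Line.eff_reg]; rfl

theorem effLines_append (I : List ℤ) (ls ls' : List Line) (c : Config) :
    effLines I (ls ++ ls') c = effLines I ls' (effLines I ls c) := by
  induction ls generalizing c with
  | nil => rfl
  | cons l ls ih => exact ih _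

theorem evRegs_append (I : List ℤ) (ls ls' : List Line) (r : ℕ → ℤ) :
    evRegs I (ls ++ ls') r = evRegs I ls' (evRegs I ls r) := by
  induction ls generalizing r with
  | nil => rfl
  | cons l ls ih => exact ih _

theorem effLines_out (I : List ℤ) {ls : List Line} (h : ls.all Line.silent) (c : Config) :
    (effLines I ls c).out = c.out := by
  induction ls generalizing c with
  | nil => rfl
  | cons l ls ih =>
    simp only [List.all_cons, Bool.and_eq_true] at h
    rw [effLines, ih h.2, Line.eff_out I h.1]

theorem effLines_outputs (I : List ℤ) {ls : List Line} (h : ls.all Line.silent) (c : Config) :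
    (effLines I ls c).outputs = c.outputs := by
  induction ls generalizing c with
  | nil => rfl
  | cons l ls ih =>
    simp only [List.all_cons, Bool.and_eq_true] at h
    rw [effLines, ih h.2, Line.eff_outputs I h.1]

theorem reach_lines {P : Program} {I : List ℤ} {ls : List Line} {b : ℕ}
    (h : ls.all Line.straight) (hP : CodeAt P b (codeLines b ls)) (c : Config) :
    Reach P I (c.goto b) ((effLines I ls c).goto (b + sizeLines ls)) := by
  induction ls generalizing c b with
  | nil => exact .refl
  | cons l ls ih =>
    simp only [List.all_cons, Bool.and_eq_true] at h
    refine (Line.reach h.1 hP.left c).trans ?_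
    have := hP.right
    rw [Line.length_code] at this
    have := ih h.2 this (l.eff I c)
    simpa [effLines, sizeLines, add_assoc] using this

/-! ### Bits and time along straight-line code -/

/-- All registers have at most `b` bits. -/
def MaxBits (b : ℕ) (r : ℕ → ℤ) : Prop := ∀ a, bits (r a) ≤ b

/-- Bits of the integer that a line brings in, where `β` is a bound for the input. -/
def Line.imm (β : ℕ) : Line → ℕ
  | .prim (.const _ z) => bits z
  | .prim (.read _ _) => β
  | _ => 0

theorem MaxBits.update {b : ℕ} {r : ℕ → ℤ} (h : MaxBits b r) {i : ℕ} {v : ℤ} (hv : bits v ≤ b) :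
    MaxBits b (Function.update r i v) := by
  intro a
  rw [Function.update_apply]
  split_ifs
  · exact hv
  · exact h a

theorem MaxBits.mono {b b' : ℕ} {r : ℕ → ℤ} (h : MaxBits b r) (hb : b ≤ b') : MaxBits b' r :=
  fun a => (h a).trans hb

/-- Multiplication is the worst case: it doubles the number of bits and costs `1 + 2 * b ≤ 3 * b`.
-/
theorem MaxBits.eff {β b : ℕ} {I : List ℤ} {l : Line} {c : Config} (hI : ∀ v ∈ I, bits v ≤ β)
    (hl : l.straight) (h : MaxBits b c.reg) (hb : 1 ≤ b) (hi : l.imm β ≤ b) :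
    MaxBits (2 * b) (l.eff I c).reg ∧ (l.eff I c).time ≤ c.time + 3 * b := by
  have h2 : MaxBits (2 * b) c.reg := h.mono (by omega)
  cases l with
  | clamp i =>
    rw [Line.eff_reg]
    refine ⟨h2.update ?_, by simp only [Line.eff]; omega⟩
    have := h i
    rcases max_choice (c.reg i) 0 with h | h <;> rw [h]
    · omega
    · simp
  | prim ins =>
    rw [Line.eff_reg]
    constructor
    · cases ins <;> simp only [Line.evReg, Instr.evReg, Line.imm] at hi ⊢ <;> try exact h2
      case const i z => exact h2.update (by omega)
      case copy i j => exact h2.update (h2 _)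
      case load i j => exact h2.update (h2 _)
      case store i j => exact h2.update (h2 _)
      case read i j => exact h2.update (by have := bits_getD_le hI (c.reg j).toNat; omega)
      case add i j k =>
        exact h2.update (by have := bits_add_le (c.reg j) (c.reg k); have := h j; have := h k; omega)
      case sub i j k =>
        exact h2.update (by have := bits_sub_le (c.reg j) (c.reg k); have := h j; have := h k; omega)
      case mul i j k =>
        exact h2.update (by have := bits_mul_le (c.reg j) (c.reg k); have := h j; have := h k; omega)
    · simp only [Line.eff, Instr.eff_time]
      cases ins <;> simp only [cost] <;> try omega
      case add i j k => have := h j; have := h k; omega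
      case sub i j k => have := h j; have := h k; omega
      case mul i j k => have := h j; have := h k; omega
      case rand => cases hl

/-- A line costs at most `3 * b` and doubles `b`, and `3 + 8 ^ k * 2 ≤ 8 ^ (k + 1)`. The bound is
exponential in the length of the code, which is harmless since each piece of code has a length
independent of the input. -/
theorem time_effLines_le {β b : ℕ} {I : List ℤ} {ls : List Line} {c : Config}
    (hI : ∀ v ∈ I, bits v ≤ β) (hl : ls.all Line.straight) (h : MaxBits b c.reg) (hb : 1 ≤ b)
    (hi : ∀ l ∈ ls, l.imm β ≤ b) : (effLines I ls c).time ≤ c.time + 8 ^ ls.length * b := by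
  induction ls generalizing c b with
  | nil => simp [effLines]
  | cons l ls ih =>
    simp only [List.all_cons, Bool.and_eq_true] at hl
    obtain ⟨h1, h2⟩ := h.eff hI hl.1 hb (hi l (by simp))
    have h3 := ih hl.2 h1 (by omega) fun l' hl' =>
      (hi l' (by simp [hl'])).trans (by omega)
    rw [effLines, List.length_cons, pow_succ]
    have : 1 ≤ 8 ^ ls.length := Nat.one_le_pow _ _ (by norm_num)
    nlinarith

/-! ### Sequences of lines and loops -/

/-- A straight sequence of lines, or the loop which executes `pre`, leaves if `R i` is not negative,
executes `body` and starts again. -/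
inductive Cmd where
  | lines (ls : List Line)
  | loop (pre : List Line) (i : ℕ) (body : List Line)

def Cmd.size : Cmd → ℕ
  | .lines ls => sizeLines ls
  | .loop pre _ body => sizeLines pre + 2 + sizeLines body + 1

/-- The machine code of a command. -/
def Cmd.code (b : ℕ) : Cmd → List Instr
  | .lines ls => codeLines b ls
  | .loop pre i body => codeLines b pre ++
      [.jumpNeg i (b + sizeLines pre + 2), .jump (b + sizeLines pre + 2 + sizeLines body + 1)] ++
      codeLines (b + sizeLines pre + 2) body ++ [.jump b]

theorem Cmd.length_code (b : ℕ) (s : Cmd) : (s.code b).length = s.size := by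
  cases s <;> simp [Cmd.code, Cmd.size] <;> omega

def codeCmds : ℕ → List Cmd → List Instr
  | _, [] => []
  | b, s :: ss => s.code b ++ codeCmds (b + s.size) ss

def sizeCmds (ss : List Cmd) : ℕ := (ss.map Cmd.size).sum

@[simp] theorem length_codeCmds (b : ℕ) (ss : List Cmd) :
    (codeCmds b ss).length = sizeCmds ss := by
  induction ss generalizing b with
  | nil => rfl
  | cons s ss ih => simp [codeCmds, sizeCmds, Cmd.length_code, ih]

/-- The commands `ss` lead from `c` to `c'`, wherever their code is. -/
def Runs (I : List ℤ) (ss : List Cmd) (c c' : Config) : Prop :=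
  ∀ P b, CodeAt P b (codeCmds b ss) → Reach P I (c.goto b) (c'.goto (b + sizeCmds ss))

theorem Runs.cons {I : List ℤ} {s : Cmd} {ss : List Cmd} {c c' c'' : Config}
    (h : Runs I [s] c c') (h' : Runs I ss c' c'') : Runs I (s :: ss) c c'' := by
  intro P b hP
  have h1 := h P b (by simpa [codeCmds] using hP.left)
  have h2 := hP.right
  rw [Cmd.length_code] at h2
  have h3 := h' P _ h2
  simp only [sizeCmds, List.map_cons, List.map_nil, List.sum_cons, List.sum_nil, add_zero] at h1 h3 ⊢
  rw [← add_assoc]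
  exact h1.trans h3

theorem Runs.append {I : List ℤ} {ss ss' : List Cmd} {c c' c'' : Config}
    (h : Runs I ss c c') (h' : Runs I ss' c' c'') : Runs I (ss ++ ss') c c'' := by
  have key : ∀ (ss : List Cmd) (b : ℕ), codeCmds b (ss ++ ss') =
      codeCmds b ss ++ codeCmds (b + sizeCmds ss) ss' := by
    intro ss
    induction ss with
    | nil => intro b; simp [codeCmds, sizeCmds]
    | cons s ss ih => intro b; simp [codeCmds, sizeCmds, ih, add_assoc]
  intro P b hP
  rw [key] at hP
  have h2 := hP.right
  rw [length_codeCmds] at h2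
  have := (h P b hP.left).trans (h' P _ h2)
  simpa [sizeCmds, add_assoc] using this

theorem Runs.lines {I : List ℤ} {ls : List Line} (h : ls.all Line.straight) (c : Config) :
    Runs I [.lines ls] c (effLines I ls c) := by
  intro P b hP
  have := reach_lines (I := I) h (by simpa [codeCmds, Cmd.code] using hP) c
  simpa [sizeCmds, Cmd.size] using this

/-- The index `r` of `Inv` is the number of iterations still to be made, and the test fails exactly
at `0`. The invariant must ignore the clock (`hcongr`), since the jumps shift it. The body must not
contain `OUTPUT`, whose effect depends on the clock. -/
theorem Runs.loop {β b : ℕ} {I : List ℤ} {pre body : List Line} {i : ℕ}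
    (hI : ∀ v ∈ I, bits v ≤ β) (hpre : pre.all Line.straight) (hbody : body.all Line.straight)
    (hout : Line.prim .output ∉ body) (hb : 1 ≤ b) (hi : ∀ l ∈ pre ++ body, l.imm β ≤ b) (Inv : ℕ → Config → Prop)
    (hcongr : ∀ r c t, Inv r c → Inv r (c.withTime t))
    (hbits : ∀ r c, Inv r c → MaxBits b c.reg)
    (hstep : ∀ r c, Inv (r + 1) c → evRegs I pre c.reg i < 0 ∧ Inv r (effLines I (pre ++ body) c))
    (hexit : ∀ c, Inv 0 c → 0 ≤ evRegs I pre c.reg i) {r : ℕ} {c : Config} (hc : Inv r c) :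
    ∃ c₀ t, Inv 0 c₀ ∧ Runs I [.loop pre i body] c ((effLines I pre c₀).withTime t) ∧
      t ≤ c.time + (r + 1) * (8 ^ (pre ++ body).length * b + 2) := by
  have hall : (pre ++ body).all Line.straight := by simp [List.all_append, hpre, hbody]
  induction r generalizing c with
  | zero =>
    refine ⟨c, (effLines I pre c).time + 2, hc, fun P a hP => ?_, ?_⟩
    · simp only [codeCmds, Cmd.code, List.append_nil, List.append_assoc] at hP
      refine (reach_lines hpre hP.left c).trans ?_
      have h2 := hP.right
      rw [length_codeLines] at h2
      refine .head (b := ((effLines I pre c).withTime ((effLines I pre c).time + 1)).goto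
        (a + sizeLines pre + 1)) ?_ (.single ?_)
      · rw [step_eq_exec (by exact h2.left.head)]
        have h0 := hexit c hc
        rw [← effLines_reg] at h0
        simp [exec, cost, Config.goto, Config.withTime, not_lt.2 h0]
      · rw [step_eq_exec (by exact h2.left.tail.head)]
        simp [exec, cost, Config.goto, Config.withTime, sizeCmds, Cmd.size, add_assoc]
    · have h1 := time_effLines_le (I := I) (ls := pre) hI hpre (hbits _ _ hc) hb
        fun l hl => hi l (by simp [hl])
      have h2 : 8 ^ pre.length * b ≤ 8 ^ (pre ++ body).length * b := by
        gcongr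
        · norm_num
        · simp
      omega
  | succ r ih =>
    obtain ⟨hneg, hnext⟩ := hstep r c hc
    set d := effLines I (pre ++ body) c with hd
    -- The `2` accounts for the conditional jump into the body and the jump back.
    obtain ⟨c₀, t, h0, hr, ht⟩ := ih (c := d.withTime (d.time + 2)) (hcongr _ _ _ hnext)
    refine ⟨c₀, t, h0, fun P a hP => ?_, ?_⟩
    · have hr := hr P a hP
      refine Reach.trans ?_ hr
      simp only [codeCmds, Cmd.code, List.append_nil, List.append_assoc] at hP
      refine (reach_lines hpre hP.left c).trans ?_
      have h2 := hP.right
      rw [length_codeLines] at h2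
      refine .head (b := ((effLines I pre c).withTime ((effLines I pre c).time + 1)).goto
        (a + sizeLines pre + 2)) ?_ ?_
      · rw [step_eq_exec (by exact h2.left.head)]
        rw [← effLines_reg] at hneg
        simp [exec, cost, Config.goto, Config.withTime, hneg]
      · have h3 := h2.right
        refine (reach_lines hbody h3.left _).trans (.single ?_)
        have h4 := h3.right
        rw [length_codeLines] at h4
        rw [step_eq_exec (by exact h4.head)]
        -- Code without `OUTPUT` commutes with a shift of the clock; `OUTPUT` would record the
        -- shifted time.
        have key : ∀ (ls : List Line) (c : Config) (t : ℕ), .prim .output ∉ ls → effLines I ls (c.withTime (c.time + t)) =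
            (effLines I ls c).withTime ((effLines I ls c).time + t) := by
          intro ls
          induction ls with
          | nil => intro c t _; rfl
          | cons l ls ih =>
            intro c t hls
            simp only [List.mem_cons, not_or] at hls
            have : l.eff I (c.withTime (c.time + t)) =
                (l.eff I c).withTime ((l.eff I c).time + t) := by
              cases l with
              | clamp i => simp [Line.eff, Config.withTime]; omega
              | prim ins =>
                cases ins <;> simp [Line.eff, Instr.eff, Config.withTime, cost] <;> try omega
                exact absurd rfl hls.1
            rw [effLines, this, ih _ _ hls.2]; rfl
        rw [key _ _ _ hout, hd, effLines_append]
        simp [exec, cost, Config.goto, Config.withTime]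
    · have h1 := time_effLines_le (I := I) hI hall (hbits _ _ hc) hb hi
      rw [← hd] at h1
      simp only [Config.withTime_time] at ht
      nlinarith

/-! ### Expectations under a probability mass function -/

theorem tsum_pure_mul {α : Type*} (a : α) (f : α → ℝ≥0∞) :
    ∑' x, PMF.pure a x * f x = f a := by
  rw [tsum_eq_single a]
  · simp
  · intro x hx; simp [PMF.pure_apply, hx]

theorem tsum_bind_mul {α β : Type*} (p : PMF α) (k : α → PMF β) (f : β → ℝ≥0∞) :
    ∑' y, p.bind k y * f y = ∑' x, p x * ∑' y, k x y * f y := by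
  simp_rw [PMF.bind_apply, ← ENNReal.tsum_mul_right, ← ENNReal.tsum_mul_left]
  rw [ENNReal.tsum_comm]
  simp_rw [mul_assoc]

theorem tsum_map_mul {α β : Type*} (p : PMF α) (h : α → β) (f : β → ℝ≥0∞) :
    ∑' y, p.map h y * f y = ∑' x, p x * f (h x) := by
  rw [← PMF.bind_pure_comp, tsum_bind_mul]
  simp only [Function.comp, tsum_pure_mul]

/-! ### Simulation of a program

The simulating machine uses the registers `8 * i + k` as an array, for every `k < 8`. The array `0`
is made of scratch registers; the arrays `1` and `2` hold the registers and the output registers of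
the simulated machine, the array `q` its input. The array `4` holds the log, a list of the addresses
that have been written in the arrays `1` and `2`. The register `0` holds a value to be written, `8`
the address where it is written, `16` is for constants, and `24` holds the address of the end of the
log. -/

/-- `R 8 := 8 * max (R (8 * j + 1)) 0 + q` -/
def addrLines (j q : ℕ) : List Line :=
  [.prim (.copy 8 (8 * j + 1)), .clamp 8, .prim (.const 16 8), .prim (.mul 8 8 16),
    .prim (.const 16 q), .prim (.add 8 8 16)]

/-- Computes the value written by an instruction and the address where it is written. -/
def calcLines (q : ℕ) : Instr → List Line
  | .const i z => [.prim (.const 0 z), .prim (.const 8 (8 * i + 1))]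
  | .copy i j => [.prim (.copy 0 (8 * j + 1)), .prim (.const 8 (8 * i + 1))]
  | .load i j => addrLines j 1 ++ [.prim (.load 0 8), .prim (.const 8 (8 * i + 1))]
  | .store i j => addrLines i 1 ++ [.prim (.copy 0 (8 * j + 1))]
  | .read i j => addrLines j q ++ [.prim (.load 0 8), .prim (.const 8 (8 * i + 1))]
  | .write i j => addrLines i 2 ++ [.prim (.copy 0 (8 * j + 1))]
  | .add i j k => [.prim (.add 0 (8 * j + 1) (8 * k + 1)), .prim (.const 8 (8 * i + 1))]
  | .sub i j k => [.prim (.sub 0 (8 * j + 1) (8 * k + 1)), .prim (.const 8 (8 * i + 1))]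
  | .mul i j k => [.prim (.mul 0 (8 * j + 1) (8 * k + 1)), .prim (.const 8 (8 * i + 1))]
  | .rand i _ => [.prim (.const 8 (8 * i + 1))]
  | _ => []

/-- Writes the value and logs the address. -/
def commitLines : List Line :=
  [.prim (.store 8 0), .prim (.store 24 8), .prim (.const 16 8), .prim (.add 24 24 16)]

/-- The code that simulates instruction number `l`; it is put at `b`, and `lab` gives the address of
the code of every instruction. -/
def simBlock (q : ℕ) (once : Bool) (lab : ℕ → ℕ) (len l b : ℕ) : Instr → List Instr
  | .rand i j => .rand 0 (8 * j + 1) ::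
      (codeLines (b + 1) (calcLines q (.rand i j) ++ commitLines) ++ [.jump (lab (l + 1))])
  | .jump k => [.jump (lab k)]
  | .jumpZero i k => [.jumpZero (8 * i + 1) (lab k), .jump (lab (l + 1))]
  | .jumpNeg i k => [.jumpNeg (8 * i + 1) (lab k), .jump (lab (l + 1))]
  | .output => [.jump (lab (if once then len else l + 1))]
  | ins => codeLines b (calcLines q ins ++ commitLines) ++ [.jump (lab (l + 1))]

/-- Address of the code of instruction number `l`. -/
def simLabel (base len l : ℕ) : ℕ := base + 20 * min l len

def simFrom (base q : ℕ) (once : Bool) (len : ℕ) : ℕ → Program → List Instr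
  | _, [] => []
  | l, ins :: P =>
    let blk := simBlock q once (simLabel base len) len l (base + 20 * l) ins
    blk ++ List.replicate (20 - blk.length) (.jump 0) ++ simFrom base q once len (l + 1) P

/-- The code that simulates the program `P`. If `once`, the simulation ends with the first `OUTPUT`
instruction; otherwise, these instructions have no effect. -/
def simCode (base q : ℕ) (once : Bool) (P : Program) : List Instr :=
  simFrom base q once P.length 0 P

/-- With twenty slots for every instruction, the address of a block is an affine function of its
number, so jump targets are known before any code is laid out. The `min` in `simLabel` sends every
jump out of the program to the exit. -/
theorem length_simBlock_le (q : ℕ) (once : Bool) (lab : ℕ → ℕ) (len l b : ℕ) (ins : Instr) :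
    (simBlock q once lab len l b ins).length ≤ 20 := by
  cases ins <;> simp [simBlock, calcLines, addrLines, commitLines, sizeLines, Line.size]

theorem length_simFrom (base q : ℕ) (once : Bool) (len l : ℕ) (P : Program) :
    (simFrom base q once len l P).length = 20 * P.length := by
  induction P generalizing l with
  | nil => rfl
  | cons ins P ih =>
    have := length_simBlock_le q once (simLabel base len) len l (base + 20 * l) ins
    simp only [simFrom, List.length_append, List.length_replicate, ih, List.length_cons]
    omega

theorem length_simCode (base q : ℕ) (once : Bool) (P : Program) :
    (simCode base q once P).length = 20 * P.length := length_simFrom _ _ _ _ _ _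

theorem codeAt_simFrom {M : Program} {base q : ℕ} {once : Bool} {len l : ℕ} {P : Program}
    (h : CodeAt M (base + 20 * l) (simFrom base q once len l P)) {k : ℕ} {ins : Instr}
    (hk : P[k]? = some ins) : CodeAt M (base + 20 * (l + k))
      (simBlock q once (simLabel base len) len (l + k) (base + 20 * (l + k)) ins) := by
  induction P generalizing l k with
  | nil => simp at hk
  | cons a P ih =>
    rw [simFrom] at h
    cases k with
    | zero =>
      simp only [List.getElem?_cons_zero, Option.some.injEq] at hk
      subst hk
      exact h.left.left
    | succ k =>
      have h2 := h.right
      have := length_simBlock_le q once (simLabel base len) len l (base + 20 * l) a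
      rw [List.length_append, List.length_replicate,
        show base + 20 * l + ((simBlock q once (simLabel base len) len l (base + 20 * l) a).length +
          (20 - (simBlock q once (simLabel base len) len l (base + 20 * l) a).length)) =
          base + 20 * (l + 1) by omega] at h2
      have := ih h2 (k := k) (by simpa using hk)
      rwa [show l + 1 + k = l + (k + 1) by omega] at this

/-! ### The log and the invariant of the simulation -/

/-- `lg` is the log in the registers `r`. -/
structure IsLog (lg : List ℕ) (r : ℕ → ℤ) : Prop where
  ptr : r 24 = 8 * lg.length + 4
  -- By the default value `0`, the array `4` vanishes beyond the end of the log.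
  entry : ∀ i, r (8 * i + 4) = (lg.getD i 0 : ℕ)
  mod : ∀ a ∈ lg, a % 8 = 1 ∨ a % 8 = 2
  -- Everything nonzero in the simulated memory has been logged, so erasing the logged addresses
  -- erases all of it. Repetitions in the log are allowed.
  mem : ∀ a, a % 8 = 1 ∨ a % 8 = 2 → r a ≠ 0 → a ∈ lg

theorem evRegs_commitLines {lg : List ℕ} {r : ℕ → ℤ} {I : List ℤ} (h : IsLog lg r) {A : ℕ}
    (hA : r 8 = A) (hm : A % 8 = 1 ∨ A % 8 = 2) :
    evRegs I commitLines r = Function.update (Function.update (Function.update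
      (Function.update r A (r 0)) (8 * lg.length + 4) A) 16 8) 24 (8 * lg.length + 12) := by
  have h1 : (24 : ℕ) ≠ A := by omega
  have h2 : (8 : ℕ) ≠ A := by omega
  have h3 : (24 : ℕ) ≠ 8 * lg.length + 4 := by omega
  have h4 : (8 * (lg.length : ℤ) + 4).toNat = 8 * lg.length + 4 := by omega
  simp only [commitLines, evRegs, Line.evReg, Instr.evReg, hA, Int.toNat_natCast,
    Function.update_of_ne h1, h.ptr, h4, Function.update_of_ne h2, Function.update_self,
    Function.update_of_ne h3, Function.update_of_ne (show (24 : ℕ) ≠ 16 by omega)]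
  congr 1

theorem IsLog.commit {lg : List ℕ} {r : ℕ → ℤ} (h : IsLog lg r) {A : ℕ} {v : ℤ}
    (hm : A % 8 = 1 ∨ A % 8 = 2) :
    IsLog (lg ++ [A]) (Function.update (Function.update (Function.update
      (Function.update r A v) (8 * lg.length + 4) A) 16 8) 24 (8 * lg.length + 12)) where
  ptr := by simp; ring
  entry i := by
    rw [Function.update_of_ne (by omega), Function.update_of_ne (by omega)]
    rcases lt_trichotomy i lg.length with hi | hi | hi
    · rw [Function.update_of_ne (by omega), Function.update_of_ne (by omega), h.entry,
        List.getD_append _ _ _ _ hi]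
    · subst hi; simp
    · rw [Function.update_of_ne (by omega), Function.update_of_ne (by omega), h.entry,
        List.getD_eq_default _ _ (by omega), List.getD_eq_default _ _ (by simp; omega)]
  mod a ha := by
    rcases List.mem_append.1 ha with ha | ha
    · exact h.mod a ha
    · rw [List.mem_singleton] at ha; rwa [ha]
  mem a ha hr := by
    rw [Function.update_of_ne (by omega), Function.update_of_ne (by omega),
      Function.update_of_ne (by omega), Function.update_apply] at hr
    split_ifs at hr with h1
    · simp [h1]
    · exact List.mem_append_left _ (h.mem a ha hr)

/-- The configuration `m` of the simulating machine, which started from `m₀`, represents the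
configuration `g` of the simulated machine. -/
structure Sim (β Q : ℕ) (m₀ g m : Config) : Prop where
  reg : ∀ i, m.reg (8 * i + 1) = g.reg i
  reg_out : ∀ i, m.reg (8 * i + 2) = g.out i
  frame : ∀ a, a % 8 ≠ 1 → a % 8 ≠ 2 → a % 8 ≠ 4 → a ≠ 0 → a ≠ 8 → a ≠ 16 → a ≠ 24 →
    m.reg a = m₀.reg a
  out : m.out = m₀.out
  outputs : m.outputs = m₀.outputs
  grow : Grow β 0 0 g
  maxBits : MaxBits (β + 4 + g.time) m.reg
  time : m.time ≤ m₀.time + Q * g.time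
  log : ∃ lg, IsLog lg m.reg ∧ lg.length ≤ g.time

/-- The target address and the value of an instruction that writes in the memory of the simulated
machine. -/
def writeTarget (Ig : List ℤ) (g : Config) : Instr → ℕ × ℤ
  | .const i z => (8 * i + 1, z)
  | .copy i j => (8 * i + 1, g.reg j)
  | .load i j => (8 * i + 1, g.reg (g.reg j).toNat)
  | .store i j => (8 * (g.reg i).toNat + 1, g.reg j)
  | .read i j => (8 * i + 1, Ig.getD (g.reg j).toNat 0)
  | .write i j => (8 * (g.reg i).toNat + 2, g.reg j)
  | .add i j k => (8 * i + 1, g.reg j + g.reg k)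
  | .sub i j k => (8 * i + 1, g.reg j - g.reg k)
  | .mul i j k => (8 * i + 1, g.reg j * g.reg k)
  | _ => (0, 0)

/-- The instructions that write a definite value in the memory. -/
def Instr.writes : Instr → Bool
  | .rand _ _ | .jump _ | .jumpZero _ _ | .jumpNeg _ _ | .output => false
  | _ => true

theorem evRegs_addrLines (I : List ℤ) (j q : ℕ) (r : ℕ → ℤ) :
    evRegs I (addrLines j q) r = Function.update (Function.update r 16 q) 8
      ((8 * (r (8 * j + 1)).toNat + q : ℕ) : ℤ) := by
  ext a
  simp only [addrLines, evRegs, Line.evReg, Instr.evReg, Function.update_apply]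
  by_cases h8 : a = 8
  · simp [h8, mul_comm]
  · by_cases h16 : a = 16 <;> simp [h8, h16]

theorem bits_address_le {x : ℤ} {b k : ℕ} (hk : k < 8) (h : bits x ≤ b) :
    bits ((8 * x.toNat + k : ℕ) : ℤ) ≤ b + 3 := by
  rw [bits_le_iff] at h ⊢
  rw [pow_add, Int.natAbs_natCast]
  omega

/-- What has to hold of the registers before the value `v` is written at the address `A`. -/
structure Ready (r r₁ : ℕ → ℤ) (A : ℕ) (v : ℤ) : Prop where
  val : r₁ 0 = v
  addr : r₁ 8 = A
  const : r₁ 16 = r 16 ∨ bits (r₁ 16) ≤ 4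
  other : ∀ a, a ≠ 0 → a ≠ 8 → a ≠ 16 → r₁ a = r a

set_option linter.unusedSimpArgs false in
theorem ready_calcLines {I Ig : List ℤ} {q : ℕ} {r : ℕ → ℤ} {g : Config}
    (hr : ∀ i, r (8 * i + 1) = g.reg i) (hq : q = 3 ∨ q = 5)
    (hin : ∀ i, r (8 * i + q) = Ig.getD i 0) {ins : Instr} (hw : ins.writes) :
    Ready r (evRegs I (calcLines q ins) r) (writeTarget Ig g ins).1 (writeTarget Ig g ins).2 := by
  have e : ∀ i, (8 * i + 1 = 0) = False := by intro i; simp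
  have e8 : ∀ i, (8 * i + 1 = 8) = False := by intro i; simp; omega
  have e16 : ∀ i, (8 * i + 1 = 16) = False := by intro i; simp; omega
  have eq : ∀ i, (8 * i + q = 0) = False := by intro i; simp; omega
  have eq8 : ∀ i, (8 * i + q = 8) = False := by intro i; simp; omega
  have eq16 : ∀ i, (8 * i + q = 16) = False := by intro i; simp; omega
  have b1 : bits 1 ≤ 4 := by decide
  have b2 : bits 2 ≤ 4 := by decide
  have bq : bits (q : ℤ) ≤ 4 := by rcases hq with rfl | rfl <;> decide
  cases ins <;> try exact absurd hw Bool.false_ne_true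
  all_goals
    constructor <;> simp only [calcLines, writeTarget, evRegs_append, evRegs_addrLines]
    all_goals
      simp +contextual [evRegs, Line.evReg, Instr.evReg, Function.update_apply, hr, hin, e, e8, e16,
        eq, eq8, eq16, b1, b2, bq, -Int.natCast_add, -Int.natCast_mul,
        -Nat.cast_add, -Nat.cast_mul]
      try (push_cast; ring)

theorem silent_calcLines (q : ℕ) (ins : Instr) :
    (calcLines q ins ++ commitLines).all Line.silent := by
  cases ins <;> rfl

theorem straight_calcLines (q : ℕ) (ins : Instr) :
    (calcLines q ins ++ commitLines).all Line.straight := by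
  cases ins <;> rfl

theorem length_calcLines (q : ℕ) (ins : Instr) :
    (calcLines q ins ++ commitLines).length ≤ 12 := by
  cases ins <;> simp [calcLines, addrLines, commitLines]

/-- The input of the simulated program lies in an array of registers and the simulating code never
reads the input registers, so the bound `β'` for the latter plays no role. The additional `4` is the
size of the constant `8`. -/
theorem imm_calcLines {q β : ℕ} (β' : ℕ) {ins : Instr}
    (h : ∀ l ∈ calcLines q ins, l.imm 0 ≤ β) :
    ∀ l ∈ calcLines q ins ++ commitLines, l.imm β' ≤ β + 4 := by
  intro l hl
  rcases List.mem_append.1 hl with hl | hl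
  · have : l.imm β' = l.imm 0 := by
      cases l with
      | clamp => rfl
      | prim i =>
        cases i <;> try rfl
        cases ins <;> simp [calcLines, addrLines] at hl
    rw [this]
    exact (h l hl).trans (by omega)
  · simp only [commitLines, List.mem_cons, List.not_mem_nil, or_false] at hl
    rcases hl with rfl | rfl | rfl | rfl <;> simp only [Line.imm] <;> try omega
    exact le_trans (by decide : bits 8 ≤ 4) (by omega)

/-- Writing and logging a value preserves the simulation. -/
theorem Sim.commit {β Q : ℕ} {I : List ℤ} {m₀ g m g' : Config} (h : Sim β Q m₀ g m) {r : ℕ → ℤ}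
    {A : ℕ} {v : ℤ} (hr : Ready m.reg r A v) (hA : A % 8 = 1 ∨ A % 8 = 2)
    (hAb : bits (A : ℤ) ≤ β + 4 + g.time)
    (hreg : ∀ i, g'.reg i = if 8 * i + 1 = A then v else g.reg i)
    (hout : ∀ i, g'.out i = if 8 * i + 2 = A then v else g.out i)
    (hg : Grow β 0 0 g') (ht : g.time < g'.time) {m' : Config}
    (hm : ⇑m'.reg = evRegs I commitLines r) (ho : m'.out = m.out) (hos : m'.outputs = m.outputs)
    (htime : m'.time ≤ m.time + Q) : Sim β Q m₀ g' m' := by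
  obtain ⟨lg, hlg, hlen⟩ := h.log
  have hlg' : IsLog lg r := by
    refine ⟨?_, fun i => ?_, hlg.mod, fun a ha hne => ?_⟩
    · rw [hr.other _ (by omega) (by omega) (by omega), hlg.ptr]
    · rw [hr.other _ (by omega) (by omega) (by omega), hlg.entry]
    · rw [hr.other _ (by omega) (by omega) (by omega)] at hne
      exact hlg.mem a ha hne
  rw [evRegs_commitLines hlg' hr.addr hA, hr.val] at hm
  -- The value `v` now sits in a simulated register, so the growth bound for `g'` applies to it.
  have hv : bits v ≤ β + 4 + g'.time := by
    by_cases hi : A % 8 = 1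
    · have h1 := hreg (A / 8)
      rw [if_pos (by omega)] at h1
      have := hg.reg (A / 8)
      rw [h1] at this
      omega
    · have h1 := hout (A / 8)
      rw [if_pos (by omega)] at h1
      have := hg.out (A / 8)
      rw [h1] at this
      omega
  refine ⟨fun i => ?_, fun i => ?_, fun a h1 h2 h4 h0 h8 h16 h24 => ?_, ho.trans h.out,
    hos.trans h.outputs, hg, ?_, ?_, lg ++ [A], ?_, ?_⟩
  · rw [hm, Function.update_of_ne (by omega), Function.update_of_ne (by omega),
      Function.update_of_ne (by omega), Function.update_apply, hreg,
      hr.other _ (by omega) (by omega) (by omega), h.reg]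
  · rw [hm, Function.update_of_ne (by omega), Function.update_of_ne (by omega),
      Function.update_of_ne (by omega), Function.update_apply, hout,
      hr.other _ (by omega) (by omega) (by omega), h.reg_out]
  · rw [hm, Function.update_of_ne h24, Function.update_of_ne h16,
      Function.update_of_ne (by omega), Function.update_of_ne (by omega), hr.other a h0 h8 h16,
      h.frame a h1 h2 h4 h0 h8 h16 h24]
  · rw [hm]
    have b8 : bits 8 ≤ 4 := by decide
    have hr' : MaxBits (β + 4 + g'.time) r := by
      intro a
      have := h.maxBits a
      by_cases h0 : a = 0
      · rw [h0, hr.val]; exact hv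
      by_cases h8 : a = 8
      · rw [h8, hr.addr]; omega
      by_cases h16 : a = 16
      · subst h16
        rcases hr.const with h | h
        · rw [h]; omega
        · omega
      · rw [hr.other a h0 h8 h16]; omega
    refine (((hr'.update hv).update (by omega)).update (by omega)).update ?_
    -- The new end of the log is `8 * (lg.length + 1) + 4`, which has at most `lg.length + 4` bits.
    have := bits_address_le (x := ((lg.length + 1 : ℕ) : ℤ)) (k := 4) (by omega)
      (bits_natCast_le_self _)
    rw [Int.toNat_natCast] at this
    have e : ((8 * (lg.length + 1) + 4 : ℕ) : ℤ) = 8 * (lg.length : ℤ) + 12 := by push_cast; ring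
    rw [e] at this
    omega
  · have := h.time
    have : Q * (g.time + 1) ≤ Q * g'.time := Nat.mul_le_mul_left _ ht
    nlinarith
  · rw [hm]; exact hlg'.commit hA
  · simp; omega

/-- The hypotheses of the simulation. -/
structure SimSetup (M : Program) (I : List ℤ) (base q : ℕ) (once : Bool) (P : Program)
    (Ig : List ℤ) (m₀ : Config) (β T : ℕ) : Prop where
  code : CodeAt M base (simCode base q once P)
  hq : q = 3 ∨ q = 5
  input : ∀ i, m₀.reg (8 * i + q) = Ig.getD i 0
  imm : ∀ ins ∈ P, immBits ins ≤ β ∧ ∀ l ∈ calcLines q ins, l.imm 0 ≤ β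
  inBits : ∀ v ∈ Ig, bits v ≤ β

theorem exec_rand {I : List ℤ} {c : Config} {i j : ℕ} {x : ℤ} (h : c.reg j = x) :
    exec I c (.rand i j) = (PMF.uniformOfFintype (Fin (x.toNat + 1))).map
      fun v : Fin (x.toNat + 1) => setReg c (c.time + (1 + bits x)) i (v.val : ℤ) := by
  subst h; rfl

theorem exec_of_writes (Ig : List ℤ) (g : Config) {ins : Instr} (hw : ins.writes) :
    ∃ g', exec Ig g ins = PMF.pure g' ∧ g'.pc = g.pc + 1 ∧
      (∀ i, g'.reg i = if 8 * i + 1 = (writeTarget Ig g ins).1 then (writeTarget Ig g ins).2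
        else g.reg i) ∧
      (∀ i, g'.out i = if 8 * i + 2 = (writeTarget Ig g ins).1 then (writeTarget Ig g ins).2
        else g.out i) ∧
      g'.outputs = g.outputs ∧ g.time < g'.time := by
  cases ins <;> first | exact absurd hw Bool.false_ne_true | refine ⟨_, rfl, rfl, fun i => ?_, fun i => ?_, rfl, ?_⟩
  all_goals simp only [setReg, cost, writeTarget, Finsupp.coe_update, Function.update_apply]
  all_goals omega

theorem writeTarget_mod (Ig : List ℤ) (g : Config) {ins : Instr} (hw : ins.writes) :
    (writeTarget Ig g ins).1 % 8 = 1 ∨ (writeTarget Ig g ins).1 % 8 = 2 := by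
  cases ins <;> first | exact absurd hw Bool.false_ne_true | (simp only [writeTarget]; omega)

theorem bits_writeTarget_le {q β : ℕ} {Ig : List ℤ} {g : Config} {ins : Instr}
    (hw : ins.writes) (hi : ∀ l ∈ calcLines q ins, l.imm 0 ≤ β)
    (hg : ∀ i, bits (g.reg i) ≤ β + g.time) :
    bits ((writeTarget Ig g ins).1 : ℤ) ≤ β + 4 + g.time := by
  have key : ∀ i : ℕ, Line.prim (.const 8 (8 * (i : ℕ) + 1)) ∈ calcLines q ins →
      bits ((8 * i + 1 : ℕ) : ℤ) ≤ β + 4 + g.time := by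
    intro i h
    have := hi _ h
    simp only [Line.imm] at this
    push_cast
    omega
  have key2 : ∀ i k, k < 8 → bits ((8 * (g.reg i).toNat + k : ℕ) : ℤ) ≤ β + 4 + g.time := by
    intro i k hk
    exact (bits_address_le hk (hg i)).trans (by omega)
  cases ins <;> first
    | exact absurd hw Bool.false_ne_true
    | exact key2 _ _ (by omega)
    | exact key _ (by simp [calcLines])

theorem runFrom_support_nonempty_time {P : Program} {I : List ℤ} {n T : ℕ} {g : Config}
    (h : ∀ g' ∈ (runFrom P I n g).support, Halted P g' ∧ g'.time ≤ T) : g.time ≤ T := by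
  obtain ⟨g', hg'⟩ := (runFrom P I n g).support_nonempty
  exact (time_le_of_mem_support_runFrom hg').trans (h g' hg').2

/-! ### Transport of expectations through the simulation -/

section
variable {M : Program} {I : List ℤ} {base q : ℕ} {once : Bool} {P : Program} {Ig : List ℤ}
  {m₀ : Config} {β T Q : ℕ}

/-- Simulation of an instruction after the random draw, if there is one. -/
theorem Sim.reach_lines {g m g' : Config}
    (h : Sim β Q m₀ g m) (hQ : 8 ^ 13 * (β + 4 + T) ≤ Q) {ins : Instr} {b l : ℕ}
    (hcode : CodeAt M b (codeLines b (calcLines q ins ++ commitLines) ++ [.jump l]))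
    (hi : ∀ l ∈ calcLines q ins, l.imm 0 ≤ β) {m₁ : Config}
    {A : ℕ} {v : ℤ} (hr : Ready m.reg (evRegs I (calcLines q ins) m₁.reg) A v)
    (hm₁ : MaxBits (β + 4 + T) m₁.reg) (ho : m₁.out = m.out)
    (hos : m₁.outputs = m.outputs) (ht₁ : m₁.time ≤ m.time + 1 + (β + 4 + T))
    (hA : A % 8 = 1 ∨ A % 8 = 2) (hAb : bits (A : ℤ) ≤ β + 4 + g.time)
    (hreg : ∀ i, g'.reg i = if 8 * i + 1 = A then v else g.reg i)
    (hout : ∀ i, g'.out i = if 8 * i + 2 = A then v else g.out i)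
    (hg : Grow β 0 0 g') (ht : g.time < g'.time) :
    ∃ m', Reach M I (m₁.goto b) m' ∧ m'.pc = l ∧ Sim β Q m₀ g' m' := by
  set ls := calcLines q ins ++ commitLines with hls
  have htime : (effLines [] ls m₁).time ≤ m₁.time + 8 ^ ls.length * (β + 4 + T) :=
    time_effLines_le (I := []) (β := 0) (by simp) (straight_calcLines q ins) hm₁ (by omega)
      fun l hl => (imm_calcLines 0 hi l hl).trans (by omega)
  -- As nothing is read, the lines may be run on the empty input, which frees the time bound from
  -- the input of the simulating machine.
  have hnoread : ∀ l ∈ ls, ∀ c, l.eff I c = l.eff [] c := by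
    intro l hl c
    cases l with
    | clamp => rfl
    | prim i =>
      cases i <;> try rfl
      cases ins <;> simp [hls, calcLines, addrLines, commitLines] at hl
  have heff : ∀ (ls' : List Line) (c : Config), (∀ l ∈ ls', l ∈ ls) →
      effLines I ls' c = effLines [] ls' c := by
    intro ls'
    induction ls' with
    | nil => intro c _; rfl
    | cons l ls' ih =>
      intro c hsub
      rw [effLines, effLines, hnoread l (hsub l (by simp)), ih _ fun l' hl' => hsub l' (by simp [hl'])]
  rw [← heff ls m₁ fun _ h => h] at htime
  set m₂ := effLines I ls m₁ with hm₂
  refine ⟨{ m₂ with pc := l, time := m₂.time + 1 }, ?_, rfl, ?_⟩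
  · refine (EnumRAM.reach_lines (straight_calcLines q ins) hcode.left m₁).trans (.single ?_)
    have h2 := hcode.right
    rw [length_codeLines] at h2
    rw [step_eq_exec (by exact h2.head)]
    rfl
  · refine h.commit (I := I) hr hA hAb hreg hout hg ht ?_ ?_ ?_ ?_
    · change ⇑m₂.reg = _
      rw [hm₂, effLines_reg, hls, evRegs_append]
    · change m₂.out = _
      rw [hm₂, effLines_out I (silent_calcLines q ins), ho]
    · change m₂.outputs = _
      rw [hm₂, effLines_outputs I (silent_calcLines q ins), hos]
    · change m₂.time + 1 ≤ _
      have h1 : 8 ^ ls.length ≤ 8 ^ 12 := Nat.pow_le_pow_right (by norm_num) (length_calcLines q ins)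
      have h2 : 8 ^ ls.length * (β + 4 + T) ≤ 8 ^ 12 * (β + 4 + T) := Nat.mul_le_mul_right _ h1
      omega

theorem Sim.leave {g m : Config} (h : Sim β Q m₀ g m) {g' m' : Config} (hr : g'.reg = g.reg) (ho : g'.out = g.out)
    (ht : g.time < g'.time) (hmr : m'.reg = m.reg) (hmo : m'.out = m.out)
    (hmos : m'.outputs = m.outputs) (hmt : m'.time ≤ m.time + Q) : Sim β Q m₀ g' m' := by
  obtain ⟨lg, hlg, hlen⟩ := h.log
  refine ⟨fun i => ?_, fun i => ?_, ?_, hmo.trans h.out, hmos.trans h.outputs,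
    h.grow.mono_time hr ho ht.le, ?_, ?_, lg, ?_, by omega⟩
  · rw [hmr, hr, h.reg]
  · rw [hmr, ho, h.reg_out]
  · rw [hmr]; exact h.frame
  · rw [hmr]; exact h.maxBits.mono (by omega)
  · have := h.time
    have : Q * (g.time + 1) ≤ Q * g'.time := Nat.mul_le_mul_left _ ht
    nlinarith
  · rw [hmr]; exact hlg

/-- `Φ` weighs the final configurations of the simulated program and `ψ` the configuration at which
the simulation stops. The two moments differ only if `once` holds and the simulation is cut at the
first `OUTPUT`; `honce` then says that the mean of `Φ` over the rest of the simulated run is covered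
by `ψ`. Every random draw is made with the same range on both sides, so expectations are transported
step by step. -/
theorem Sim.leads (S : SimSetup M I base q once P Ig m₀ β T) (hQ : 8 ^ 13 * (β + 4 + T) ≤ Q)
    {Φ ψ : Config → ℝ≥0∞}
    (hψ : ∀ g, Halted P g → (once → g.outputs = []) → Φ g ≤ ψ g)
    (honce : once → ∀ g g' n, P[g.pc]? = some .output → g.outputs = [] →
      exec Ig g .output = PMF.pure g' → ∑' d, runFrom P Ig n g' d * Φ d ≤ ψ g')
    (n : ℕ) {g m : Config} (h : Sim β Q m₀ g m) (hpc : m.pc = simLabel base P.length g.pc)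
    (hn : ∀ g' ∈ (runFrom P Ig n g).support, Halted P g' ∧ g'.time ≤ T)
    (hout : once → g.outputs = []) :
    Leads M I (fun m' w => ∃ g', Sim β Q m₀ g' m' ∧ m'.pc = base + 20 * P.length ∧ g'.time ≤ T ∧
      w ≤ ψ g') (m₀.time + Q * T) m (∑' d, runFrom P Ig n g d * Φ d) := by
  induction n generalizing g m with
  | zero =>
    have hg := hn g (by simp [runFrom])
    refine .done ⟨g, h, ?_, hg.2, ?_⟩
    · rw [hpc, simLabel, min_eq_right hg.1]
    · rw [runFrom, tsum_pure_mul]; exact hψ g hg.1 hout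
  | succ n ih =>
    by_cases hh : Halted P g
    · rw [runFrom_of_halted hh] at hn ⊢
      refine .done ⟨g, h, ?_, (hn g (by simp)).2, ?_⟩
      · rw [hpc, simLabel, min_eq_right hh]
      · rw [tsum_pure_mul]; exact hψ g hh hout
    have hlt : g.pc < P.length := not_le.1 hh
    obtain ⟨ins, hins⟩ : ∃ ins, P[g.pc]? = some ins := ⟨_, List.getElem?_eq_getElem hlt⟩
    have hcode := codeAt_simFrom (l := 0) S.code hins
    rw [zero_add] at hcode
    have hm : m = m.goto (base + 20 * g.pc) := by
      rw [← min_eq_left hlt.le, ← simLabel, ← hpc, Config.goto_self]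
    have himm := S.imm ins (List.mem_of_getElem? hins)
    have hgT := runFrom_support_nonempty_time hn
    have hmB : m.time ≤ m₀.time + Q * T :=
      h.time.trans (by have := Nat.mul_le_mul_left Q hgT; omega)
    have hstep : step P Ig g = exec Ig g ins := step_eq_exec hins
    have hsucc : ∀ g' ∈ (exec Ig g ins).support,
        (∀ d ∈ (runFrom P Ig n g').support, Halted P d ∧ d.time ≤ T) ∧ Grow β 0 0 g' := by
      intro g' hg'
      refine ⟨fun d hd => hn d ?_, h.grow.exec himm.1 S.inBits hg'⟩
      rw [runFrom, PMF.mem_support_bind_iff]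
      exact ⟨g', by rwa [hstep], hd⟩
    have hdet : ∀ g' m', exec Ig g ins = PMF.pure g' → Reach M I m m' → Sim β Q m₀ g' m' →
        m'.pc = simLabel base P.length g'.pc → g'.outputs = g.outputs ∨ once = false →
        Leads M I (fun m' w => ∃ g', Sim β Q m₀ g' m' ∧ m'.pc = base + 20 * P.length ∧
          g'.time ≤ T ∧ w ≤ ψ g') (m₀.time + Q * T) m
          (∑' d, runFrom P Ig (n + 1) g d * Φ d) := by
      intro g' m' hg' hr hs hpc' ho
      obtain ⟨h1, -⟩ := hsucc g' (by simp [hg'])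
      have h2 := runFrom_support_nonempty_time h1
      rw [runFrom, hstep, hg', PMF.pure_bind]
      refine hr.leads (hs.time.trans (by have := Nat.mul_le_mul_left Q h2; omega))
        (ih hs hpc' h1 fun hst => ?_)
      rcases ho with ho | ho
      · rw [ho]; exact hout hst
      · rw [ho] at hst; cases hst
    by_cases hw : ins.writes
    · obtain ⟨g', hg', hpc', hreg', hout', hos', ht'⟩ := exec_of_writes Ig g hw
      have hin : ∀ i, m.reg (8 * i + q) = Ig.getD i 0 := by
        intro i
        have := S.hq
        rw [h.frame _ (by omega) (by omega) (by omega) (by omega) (by omega) (by omega) (by omega)]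
        exact S.input i
      obtain ⟨m', hr, hmpc, hs⟩ := h.reach_lines (T := T) hQ
        (by cases ins <;> first | exact absurd hw Bool.false_ne_true | exact hcode) himm.2
        (ready_calcLines (I := I) (g := g) h.reg S.hq hin hw) (h.maxBits.mono (by omega)) rfl rfl
        (by omega) (writeTarget_mod Ig g hw)
        (bits_writeTarget_le hw himm.2 fun i => by simpa using h.grow.reg i) hreg' hout'
        (hsucc g' (by simp [hg'])).2 ht'
      rw [← hm] at hr
      exact hdet g' m' hg' hr hs (by rw [hmpc, hpc']) (.inl hos')
    have hjump : ∀ l, M[m.pc]? = some (.jump l) →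
        Reach M I m { m with pc := l, time := m.time + 1 } := by
      intro l hl
      refine .single ?_
      rw [step_eq_exec hl]; rfl
    have hmpc : m.pc = base + 20 * g.pc := by rw [hm]; rfl
    have hQ1 : 2 ≤ Q := by
      have : 1 * (β + 4 + T) ≤ 8 ^ 13 * (β + 4 + T) := Nat.mul_le_mul_right _ (by norm_num)
      omega
    cases ins with
    | const | copy | load | store | read | write | add | sub | mul => exact absurd rfl hw
    | rand i j =>
      have hrj := h.reg j
      have hMstep : step M I m = (PMF.uniformOfFintype (Fin ((g.reg j).toNat + 1))).map
          fun v : Fin ((g.reg j).toNat + 1) =>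
            setReg m (m.time + (1 + bits (g.reg j))) 0 (v.val : ℤ) := by
        rw [step_eq_exec (ins := .rand 0 (8 * j + 1)) (by rw [hmpc]; exact hcode.head)]
        exact exec_rand hrj
      -- The drawn value is in register `0` of the simulating machine, so the simulated successor,
      -- and with it the weight, can be recovered from the configuration alone.
      set f : Config → ℝ≥0∞ := fun c => ∑' d, runFrom P Ig n
        (setReg g (g.time + (1 + bits (g.reg j))) i (c.reg 0)) d * Φ d with hf
      refine .step f hmB (fun c hc => ?_) ?_
      · rw [hMstep, PMF.support_map] at hc
        obtain ⟨v, -, rfl⟩ := hc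
        set g' := setReg g (g.time + (1 + bits (g.reg j))) i (v.val : ℤ) with hg'
        have hg's : g' ∈ (exec Ig g (.rand i j)).support := by
          simp only [exec, PMF.support_map, Set.mem_image]
          exact ⟨v, by simp, rfl⟩
        obtain ⟨h1, hgrow⟩ := hsucc g' hg's
        have hbj : bits (g.reg j) ≤ β + g.time := by simpa using h.grow.reg j
        have hvb : bits ((v : ℕ) : ℤ) ≤ bits (g.reg j) := bits_mono (by have := v.2; omega)
        obtain ⟨m', hr, hmpc', hs⟩ := h.reach_lines (g' := g') (A := 8 * i + 1) (v := (v.val : ℤ))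
          (T := T) hQ (ins := .rand i j) hcode.tail himm.2
          (m₁ := setReg m (m.time + (1 + bits (g.reg j))) 0 (v.val : ℤ))
          (by
            refine ⟨?_, ?_, .inl ?_, fun a h0 h8 _ => ?_⟩
            · simp [calcLines, evRegs, Line.evReg, Instr.evReg, setReg]
            · simp [calcLines, evRegs, Line.evReg, Instr.evReg, setReg]
            · simp [calcLines, evRegs, Line.evReg, Instr.evReg, setReg]
            · simp [calcLines, evRegs, Line.evReg, Instr.evReg, setReg, h0, h8])
          (by
            simp only [setReg, Finsupp.coe_update]
            exact (h.maxBits.mono (by omega)).update (by omega)) rfl rfl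
          (by simp only [setReg]; omega) (by omega)
          (by
            have := himm.2 (.prim (.const 8 (8 * i + 1))) (by simp [calcLines])
            simp only [Line.imm] at this
            push_cast; omega)
          (fun a => by simp [hg', setReg, Function.update_apply])
          (fun a => by rw [if_neg (by omega)]; rfl) hgrow (by simp only [hg', setReg]; omega)
        have h2 := runFrom_support_nonempty_time h1
        have hfv : f (setReg m (m.time + (1 + bits (g.reg j))) 0 (v.val : ℤ)) =
            ∑' d, runFrom P Ig n g' d * Φ d := by
          simp [hf, hg', setReg]
        rw [hfv]
        have hmm : (setReg m (m.time + (1 + bits (g.reg j))) 0 (v.val : ℤ)).goto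
            (base + 20 * g.pc + 1) = setReg m (m.time + (1 + bits (g.reg j))) 0 (v.val : ℤ) := by
          rw [← hmpc]; rfl
        rw [hmm] at hr
        exact hr.leads (hs.time.trans (by have := Nat.mul_le_mul_left Q h2; omega))
          (ih hs (by rw [hmpc']; rfl) h1 fun hst => hout hst)
      · rw [hMstep, tsum_map_mul, runFrom, hstep, exec, PMF.bind_map, tsum_bind_mul]
        refine (ENNReal.tsum_le_tsum fun v => mul_le_mul_right (le_of_eq ?_) _)
        simp [hf, setReg, cost]
    | jump l =>
      refine hdet _ _ rfl (hjump _ (by rw [hmpc]; exact hcode.head)) ?_ rfl (.inl rfl)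
      exact h.leave rfl rfl (by simp [cost]) rfl rfl rfl (by simp; omega)
    | output =>
      have hj := hjump _ (by rw [hmpc]; exact hcode.head)
      cases hst : once with
      | false =>
        rw [hst, if_neg (by simp)] at hj
        refine hdet _ _ rfl hj ?_ rfl (.inr hst)
        exact h.leave rfl rfl (by simp [cost]) rfl rfl rfl (by simp; omega)
      | true =>
        rw [hst, if_pos rfl] at hj
        obtain ⟨h1, -⟩ := hsucc _ (by rw [exec, PMF.support_pure]; rfl)
        have h2 := runFrom_support_nonempty_time h1
        have hs := h.leave (g' := { g with
            pc := g.pc + 1, time := g.time + cost g.reg .output,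
            outputs := g.outputs ++ [(g.time, outWord g.out)] })
          (m' := { m with pc := simLabel base P.length P.length, time := m.time + 1 })
          rfl rfl (by simp [cost]) rfl rfl rfl (by simp; omega)
        refine hj.leads (hs.time.trans (by have := Nat.mul_le_mul_left Q h2; omega))
          (.done ⟨_, hs, by simp [simLabel], h2, ?_⟩)
        rw [runFrom, hstep, exec, PMF.pure_bind]
        exact honce hst g _ n hins (hout hst) rfl
    | jumpZero i l =>
      by_cases hz : g.reg i = 0
      · refine hdet _ { m with pc := simLabel base P.length l, time := m.time + 1 } rfl
          (.single ?_) ?_ (by simp [hz]) (.inl rfl)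
        · rw [step_eq_exec (by rw [hmpc]; exact hcode.head)]
          simp [exec, cost, h.reg, hz]
        · exact h.leave rfl rfl (by simp [cost]) rfl rfl rfl (by simp; omega)
      · refine hdet _ { m with pc := simLabel base P.length (g.pc + 1), time := m.time + 2 } rfl
          (.head (b := { m with pc := m.pc + 1, time := m.time + 1 }) ?_ (.single ?_)) ?_
          (by simp [hz]) (.inl rfl)
        · rw [step_eq_exec (by rw [hmpc]; exact hcode.head)]
          simp [exec, cost, h.reg, hz]
        · rw [step_eq_exec (by simp only [hmpc]; exact hcode.tail.head)]
          simp [exec, cost]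
        · exact h.leave rfl rfl (by simp [cost]) rfl rfl rfl (by simp; omega)
    | jumpNeg i l =>
      by_cases hz : g.reg i < 0
      · refine hdet _ { m with pc := simLabel base P.length l, time := m.time + 1 } rfl
          (.single ?_) ?_ (by simp [hz]) (.inl rfl)
        · rw [step_eq_exec (by rw [hmpc]; exact hcode.head)]
          simp [exec, cost, h.reg, hz]
        · exact h.leave rfl rfl (by simp [cost]) rfl rfl rfl (by simp; omega)
      · refine hdet _ { m with pc := simLabel base P.length (g.pc + 1), time := m.time + 2 } rfl
          (.head (b := { m with pc := m.pc + 1, time := m.time + 1 }) ?_ (.single ?_)) ?_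
          (by simp [hz]) (.inl rfl)
        · rw [step_eq_exec (by rw [hmpc]; exact hcode.head)]
          simp [exec, cost, h.reg, hz]
        · rw [step_eq_exec (by simp only [hmpc]; exact hcode.tail.head)]
          simp [exec, cost]
        · exact h.leave rfl rfl (by simp [cost]) rfl rfl rfl (by simp; omega)

end

theorem exists_bits_le (I : List ℤ) : ∃ β, ∀ v ∈ I, bits v ≤ β := by
  induction I with
  | nil => exact ⟨0, by simp⟩
  | cons v I ih =>
    obtain ⟨β, h⟩ := ih
    refine ⟨max (bits v) β, fun u hu => ?_⟩
    rcases List.mem_cons.1 hu with rfl | hu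
    · exact le_max_left _ _
    · exact (h u hu).trans (le_max_right _ _)

theorem maxBits_effLines {β b : ℕ} {I : List ℤ} {ls : List Line} {c : Config}
    (hI : ∀ v ∈ I, bits v ≤ β) (hl : ls.all Line.straight) (h : MaxBits b c.reg) (hb : 1 ≤ b)
    (hi : ∀ l ∈ ls, l.imm β ≤ b) : MaxBits (2 ^ ls.length * b) (effLines I ls c).reg := by
  induction ls generalizing c b with
  | nil => simpa [effLines] using h
  | cons l ls ih =>
    simp only [List.all_cons, Bool.and_eq_true] at hl
    obtain ⟨h1, h2⟩ := h.eff hI hl.1 hb (hi l (by simp))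
    have h3 := ih hl.2 h1 (by omega) fun l' hl' => (hi l' (by simp [hl'])).trans (by omega)
    rw [effLines, List.length_cons, pow_succ, mul_assoc]
    exact h3

/-! ### Cleaning the memory -/

/-- The condition of the loop `cleanLoop`. -/
def cleanPre : List Line := [.prim (.const 16 4), .prim (.sub 16 16 24)]

/-- Takes an address out of the log and erases what is stored there. -/
def cleanBody : List Line := [.prim (.const 16 8), .prim (.sub 24 24 16), .prim (.load 8 24),
  .prim (.const 0 0), .prim (.store 8 0), .prim (.store 24 0)]

/-- The scratch registers that are erased together with the simulated memory. -/
def scratch : List ℕ := [0, 8, 16, 48, 56, 64, 72, 80, 88]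

def zeroLines : List Line := scratch.map fun i => .prim (.const i 0)

def cleanCmds : List Cmd := [.loop cleanPre 16 cleanBody, .lines zeroLines]

/-- The registers after the memory of the simulated machine has been erased. -/
def cleaned (r : ℕ → ℤ) (a : ℕ) : ℤ :=
  if a % 8 = 1 ∨ a % 8 = 2 ∨ a % 8 = 4 ∨ a ∈ scratch then 0 else if a = 24 then 4 else r a

theorem evRegs_zeroLines (I : List ℤ) (r : ℕ → ℤ) (a : ℕ) :
    evRegs I zeroLines r a = if a ∈ scratch then 0 else r a := by
  have : ∀ (l : List ℕ) (r : ℕ → ℤ),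
      evRegs I (l.map fun i => .prim (.const i 0)) r a = if a ∈ l then 0 else r a := by
    intro l
    induction l with
    | nil => intro r; rfl
    | cons i l ih =>
      intro r
      simp only [List.map_cons, evRegs, ih, Line.evReg, Instr.evReg, List.mem_cons,
        Function.update_apply]
      by_cases h1 : a ∈ l <;> by_cases h2 : a = i <;> simp [h1, h2]
  exact this _ _

theorem evRegs_cleanBody {I : List ℤ} {lg : List ℕ} {A : ℕ} {r : ℕ → ℤ}
    (h : IsLog (lg ++ [A]) r) : evRegs I (cleanPre ++ cleanBody) r =
      Function.update (Function.update (Function.update (Function.update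
        (Function.update (Function.update r 16 8) 24 (8 * lg.length + 4)) 8 A) 0 0) A 0)
        (8 * lg.length + 4) 0 := by
  have hp := h.ptr
  have he := h.entry lg.length
  have hm := h.mod A (by simp)
  simp only [List.length_append, List.length_singleton] at hp
  rw [List.getD_append_right _ _ _ _ le_rfl, Nat.sub_self, List.getD_cons_zero] at he
  have e1 : (8 * (lg.length : ℤ) + 4).toNat = 8 * lg.length + 4 := by omega
  have e2 : 8 * (((lg.length + 1 : ℕ) : ℤ)) + 4 - 8 = 8 * (lg.length : ℤ) + 4 := by push_cast; ring
  have e3 : ∀ k, k % 8 = 0 → (8 * lg.length + 4 = k) = False := by intro k hk; simp; omega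
  have e4 : (A = 24) = False := by simp; omega
  have e5 : (24 = A) = False := by simp; omega
  have e6 : (0 = A) = False := by simp; omega
  ext a
  simp [cleanPre, cleanBody, evRegs, Line.evReg, Instr.evReg, Function.update_apply, hp, he, e2,
    e1, e3, e5, e6, -Nat.cast_add, -Int.natCast_add]

/-- The erased address may occur earlier in the log as well, in which case it will simply be erased
again; any other nonzero simulated register is still logged. -/
theorem IsLog.pop {lg : List ℕ} {A : ℕ} {r : ℕ → ℤ} (h : IsLog (lg ++ [A]) r) (I : List ℤ) :
    IsLog lg (evRegs I (cleanPre ++ cleanBody) r) := by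
  have hm := h.mod A (by simp)
  rw [evRegs_cleanBody h]
  refine ⟨?_, fun i => ?_, fun a ha => h.mod a (by simp [ha]), fun a ha hr => ?_⟩
  · rw [Function.update_of_ne (by omega), Function.update_of_ne (by omega),
      Function.update_of_ne (by omega), Function.update_of_ne (by omega), Function.update_self]
  · have he := h.entry i
    rw [Function.update_apply]
    split_ifs with hi
    · rw [List.getD_eq_default _ _ (by omega)]; rfl
    · rw [Function.update_of_ne (by omega), Function.update_of_ne (by omega),
        Function.update_of_ne (by omega), Function.update_of_ne (by omega),
        Function.update_of_ne (by omega), he]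
      rcases lt_or_ge i lg.length with h' | h'
      · rw [List.getD_append _ _ _ _ h']
      · rw [List.getD_eq_default _ _ h', List.getD_eq_default _ _ (by simp; omega)]
  · rw [Function.update_of_ne (by omega), Function.update_apply] at hr
    split_ifs at hr with h1
    · exact absurd rfl hr
    · rw [Function.update_of_ne (by omega), Function.update_of_ne (by omega),
        Function.update_of_ne (by omega), Function.update_of_ne (by omega)] at hr
      have := h.mem a ha hr
      simpa [h1] using this

/-- The time is proportional to the length of the log. Sweeping the whole range of addresses would
not do, as an address with polynomially many bits can be exponentially large. The loop invariant
counts the entries left. -/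
theorem runs_clean {I : List ℤ} {lg : List ℕ} {b : ℕ} {c : Config} (h : IsLog lg c.reg)
    (hb : MaxBits b c.reg) (h4 : 4 ≤ b) :
    ∃ c', Runs I cleanCmds c c' ∧ ⇑c'.reg = cleaned c.reg ∧ c'.out = c.out ∧
      c'.outputs = c.outputs ∧ c'.time ≤ c.time + (lg.length + 1) * (8 ^ 12 * b) := by
  have e4 : bits 4 ≤ 4 := by decide
  have e8 : bits 8 ≤ 4 := by decide
  obtain ⟨β, hI⟩ := exists_bits_le I
  obtain ⟨c₀, t, ⟨l₀, hlen, hlog, hfr, hbits, hout, houts⟩, hruns, ht⟩ :=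
    Runs.loop (b := b) (pre := cleanPre) (body := cleanBody) (i := 16)
      hI rfl rfl (by simp [cleanBody]) (by omega)
      (by
        intro l hl
        simp only [cleanPre, cleanBody, List.cons_append, List.nil_append, List.mem_cons,
          List.not_mem_nil, or_false] at hl
        rcases hl with rfl | rfl | rfl | rfl | rfl | rfl | rfl | rfl <;> simp [Line.imm] <;> omega)
      (fun k c' => ∃ l : List ℕ, l.length = k ∧ IsLog l c'.reg ∧
        (∀ a, a % 8 ≠ 1 → a % 8 ≠ 2 → a % 8 ≠ 4 → a ≠ 0 → a ≠ 8 → a ≠ 16 → a ≠ 24 →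
          c'.reg a = c.reg a) ∧ MaxBits b c'.reg ∧ c'.out = c.out ∧ c'.outputs = c.outputs)
      (fun _ _ _ h => h) (fun _ _ ⟨_, _, _, _, h, _⟩ => h)
      (by
        rintro k c' ⟨l, hlen, hlog, hfr, hbits, hout, houts⟩
        refine ⟨?_, ?_⟩
        · simp [cleanPre, evRegs, Line.evReg, Instr.evReg, hlog.ptr]
          omega
        · obtain ⟨l, A, rfl⟩ : ∃ l' A, l = l' ++ [A] :=
            ⟨l.dropLast, l.getLast (by rintro rfl; simp at hlen), (List.dropLast_append_getLast _).symm⟩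
          have hlen' : l.length = k := by simpa using hlen
          have hA := hlog.mod A (by simp)
          refine ⟨l, hlen', ?_, ?_, ?_, ?_, ?_⟩
          · rw [effLines_reg]; exact hlog.pop _
          · intro a h1 h2 h4 h0 h8 h16 h24
            rw [effLines_reg, evRegs_cleanBody hlog, Function.update_of_ne (by omega),
              Function.update_of_ne (by omega), Function.update_of_ne h0,
              Function.update_of_ne h8, Function.update_of_ne h24, Function.update_of_ne h16]
            exact hfr a h1 h2 h4 h0 h8 h16 h24
          · rw [effLines_reg, evRegs_cleanBody hlog]
            have h1 := hbits 24
            rw [hlog.ptr] at h1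
            have h2 : bits (8 * (l.length : ℤ) + 4) ≤ b := by
              refine le_trans (bits_mono ?_) h1
              simp; omega
            have h3 := hbits (8 * l.length + 4)
            rw [hlog.entry, List.getD_append_right _ _ _ _ le_rfl, Nat.sub_self,
              List.getD_cons_zero] at h3
            exact (((((hbits.update (by omega)).update h2).update h3).update (by simp)).update
              (by simp)).update (by simp)
          · rw [effLines_out _ (by rfl), hout]
          · rw [effLines_outputs _ (by rfl), houts])
      (by
        rintro c' ⟨l, hlen, hlog, -⟩
        simp [cleanPre, evRegs, Line.evReg, Instr.evReg, hlog.ptr, hlen])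
      (r := lg.length) (c := c) ⟨lg, rfl, h, fun _ _ _ _ _ _ _ _ => rfl, hb, rfl, rfl⟩
  have hl₀ : l₀ = [] := List.length_eq_zero_iff.1 hlen
  subst hl₀
  have hb2 : MaxBits (4 * b) (effLines I cleanPre c₀).reg :=
    maxBits_effLines hI rfl hbits (by omega) (by simp [cleanPre, Line.imm]; omega)
  have ht2 := time_effLines_le (I := I) (ls := zeroLines)
    (c := (effLines I cleanPre c₀).withTime t) hI rfl hb2 (by omega)
    (by simp [zeroLines, scratch, Line.imm])
  refine ⟨_, hruns.cons (.lines (ls := zeroLines) rfl _), ?_, ?_, ?_, ?_⟩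
  · ext a
    rw [effLines_reg, evRegs_zeroLines, Config.withTime_reg, effLines_reg, cleaned]
    have hp := hlog.ptr
    have h1 : ∀ a, a % 8 = 1 ∨ a % 8 = 2 → c₀.reg a = 0 := fun a ha => by
      by_contra h; simpa using hlog.mem a ha h
    have h2 : ∀ a, a % 8 = 4 → c₀.reg a = 0 := fun a ha => by
      have := hlog.entry (a / 8)
      rw [show 8 * (a / 8) + 4 = a by omega] at this
      simpa using this
    by_cases hs : a ∈ scratch
    · simp [hs]
    · have h3 : evRegs I cleanPre c₀.reg a = c₀.reg a := by
        have : a ≠ 16 := by rintro rfl; simp [scratch] at hs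
        simp [cleanPre, evRegs, Line.evReg, Instr.evReg, this]
      rw [if_neg hs, h3]
      simp only [hs, or_false]
      simp only [scratch, List.mem_cons, List.not_mem_nil, or_false, not_or] at hs
      split_ifs with h5 h6
      · rcases h5 with h5 | h5 | h5
        · exact h1 a (.inl h5)
        · exact h1 a (.inr h5)
        · exact h2 a h5
      · rw [h6, hp]; simp
      · exact hfr a (by omega) (by omega) (by omega) hs.1 hs.2.1 hs.2.2.1 h6
  · rw [effLines_out _ (by rfl), Config.withTime_out, effLines_out _ (by rfl), hout]
  · rw [effLines_outputs _ (by rfl), Config.withTime_outputs, effLines_outputs _ (by rfl), houts]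
  · simp only [Config.withTime_time] at ht2
    have e1 : zeroLines.length = 9 := rfl
    have e2 : (cleanPre ++ cleanBody).length = 8 := rfl
    rw [e1] at ht2
    rw [e2] at ht
    have : (lg.length + 1) * (8 ^ 8 * b + 2) + 8 ^ 9 * (4 * b) ≤ (lg.length + 1) * (8 ^ 12 * b) := by
      have : 8 ^ 9 * (4 * b) ≤ (lg.length + 1) * (8 ^ 9 * (4 * b)) :=
        Nat.le_mul_of_pos_left _ (by omega)
      rw [show (lg.length + 1) * (8 ^ 12 * b) = (lg.length + 1) * ((8 ^ 12 - 8 ^ 9 * 4) * b) +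
        (lg.length + 1) * (8 ^ 9 * (4 * b)) by ring]
      refine add_le_add (Nat.mul_le_mul_left _ ?_) this
      omega
    omega

/-! ### Words in registers -/

theorem symbolOf_eq_some {z : ℤ} {s : Symbol} : symbolOf z = some s ↔ z = ((s : ℕ) : ℤ) + 1 := by
  unfold symbolOf
  constructor
  · intro h
    split_ifs at h with h1 h2 h3 <;> simp only [Option.some.injEq] at h <;> subst h <;> simp [*]
  · rintro rfl
    fin_cases s <;> simp

theorem symbolOf_eq_none {z : ℤ} : symbolOf z = none ↔ z ≠ 1 ∧ z ≠ 2 ∧ z ≠ 3 := by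
  unfold symbolOf
  split_ifs <;> simp [*]

theorem encWord_eq (w : Word) : encWord w = List.map (fun s : Symbol => ((s : ℕ) : ℤ) + 1) w := by
  induction w with
  | nil => rfl
  | cons a w ih => simpa [encWord] using ih

@[simp] theorem length_encWord (w : Word) : (encWord w).length = w.length := by simp [encWord]

theorem encWord_getD {w : Word} {i : ℕ} (h : i < w.length) :
    (encWord w).getD i 0 = ((w[i] : ℕ) : ℤ) + 1 := by
  rw [List.getD_eq_getElem _ _ (by simpa using h)]
  simp [encWord_eq]

theorem encWord_getD_range {w : Word} (i : ℕ) :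
    0 ≤ (encWord w).getD i 0 ∧ (encWord w).getD i 0 ≤ 3 := by
  by_cases h : i < w.length
  · rw [encWord_getD h]; omega
  · rw [List.getD_eq_default _ _ (by simpa using h)]; simp

theorem symbolOf_encWord_getD {w : Word} {i : ℕ} :
    symbolOf ((encWord w).getD i 0) = w[i]? := by
  by_cases h : i < w.length
  · rw [encWord_getD h, List.getElem?_eq_getElem h]
    exact symbolOf_eq_some.2 rfl
  · rw [List.getD_eq_default _ _ (by simpa using h), List.getElem?_eq_none (by omega)]
    rfl

/-- The word `w` is at the beginning of the array `o`, followed by something which is not a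
symbol. -/
structure WordAt (w : Word) (o : ℕ → ℤ) : Prop where
  eq : ∀ i < w.length, o i = (encWord w).getD i 0
  none : symbolOf (o w.length) = none

theorem WordAt.symbolOf_eq {w : Word} {o : ℕ → ℤ} (h : WordAt w o) {i : ℕ} (hi : i ≤ w.length) :
    symbolOf (o i) = w[i]? := by
  rcases hi.lt_or_eq with hi | rfl
  · rw [h.eq i hi, symbolOf_encWord_getD]
  · rw [h.none, List.getElem?_eq_none le_rfl]

theorem WordAt.unique {w w' : Word} {o : ℕ → ℤ} (h : WordAt w o) (h' : WordAt w' o) : w = w' := by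
  wlog hl : w.length ≤ w'.length
  · exact (this h' h (le_of_not_ge hl)).symm
  have he : w.length = w'.length := by
    have := h'.symbolOf_eq hl
    rw [h.none] at this
    have := List.getElem?_eq_none_iff.1 this.symm
    omega
  apply List.ext_getElem?
  intro i
  by_cases hi : i ≤ w.length
  · rw [← h.symbolOf_eq hi, h'.symbolOf_eq (hi.trans hl)]
  · rw [List.getElem?_eq_none (by omega), List.getElem?_eq_none (by omega)]

theorem wordAt_encWord (w : Word) : WordAt w fun i => (encWord w).getD i 0 :=
  ⟨fun _ _ => rfl, by rw [symbolOf_encWord_getD, List.getElem?_eq_none le_rfl]⟩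

theorem takeWhile_isSome_spec {α : Type*} (N : ℕ) (f : ℕ → Option α) :
    let w := (((List.range N).map f).takeWhile Option.isSome).reduceOption
    w.length ≤ N ∧ (∀ i < w.length, f i = w[i]?) ∧ (w.length < N → f w.length = none) := by
  induction N generalizing f with
  | zero => simp
  | succ N ih =>
    rw [List.range_succ_eq_map, List.map_cons, List.map_map]
    cases h0 : f 0 with
    | none => simp [h0]
    | some a =>
      obtain ⟨h1, h2, h3⟩ := ih (f ∘ Nat.succ)
      simp only [List.takeWhile_cons, Option.isSome_some, if_true, List.reduceOption_cons_of_some,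
        List.length_cons]
      refine ⟨by omega, fun i hi => ?_, fun hi => h3 (by omega)⟩
      cases i with
      | zero => simpa using h0
      | succ i => rw [List.getElem?_cons_succ]; exact h2 i (by omega)

theorem length_outWord_le (o : ℕ →₀ ℤ) : (outWord o).length ≤ o.support.card :=
  (takeWhile_isSome_spec _ _).1

theorem wordAt_outWord (o : ℕ →₀ ℤ) : WordAt (outWord o) o := by
  obtain ⟨h1, h2, h3⟩ := takeWhile_isSome_spec o.support.card fun i => symbolOf (o i)
  change (outWord o).length ≤ _ at h1
  change ∀ i < (outWord o).length, _ = (outWord o)[i]? at h2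
  change (outWord o).length < _ → symbolOf (o (outWord o).length) = none at h3
  have heq : ∀ i < (outWord o).length, o i = (encWord (outWord o)).getD i 0 := by
    intro i hi
    have := h2 i hi
    rw [List.getElem?_eq_getElem hi] at this
    rw [encWord_getD hi, symbolOf_eq_some.1 this]
  refine ⟨heq, ?_⟩
  rcases h1.lt_or_eq with h | h
  · exact h3 h
  · by_contra hne
    have hsub : Finset.range (o.support.card + 1) ⊆ o.support := by
      intro i hi
      rw [Finset.mem_range, ← h] at hi
      rw [Finsupp.mem_support_iff]
      intro h0
      rcases (Nat.lt_succ_iff.1 hi).lt_or_eq with hi | rfl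
      · have := heq i hi
        rw [encWord_getD hi] at this
        omega
      · rw [h0] at hne; exact hne rfl
    have := Finset.card_le_card hsub
    simp at this

theorem WordAt.outWord_eq {w : Word} {o : ℕ →₀ ℤ} (h : WordAt w o) : outWord o = w :=
  (wordAt_outWord o).unique h

/-! ### Copying and comparing words -/

/-- Makes `R 16` negative if `R 0` holds a symbol. -/
def testLines : List Line := [.prim (.const 72 1), .prim (.sub 16 0 72), .prim (.const 72 2),
  .prim (.sub 8 0 72), .prim (.mul 16 16 8), .prim (.const 72 3), .prim (.sub 8 0 72),
  .prim (.mul 16 16 8), .prim (.mul 16 16 16), .prim (.const 72 1), .prim (.sub 16 16 72)]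

/-- Negative if `v` represents a symbol. -/
def symbolTest (v : ℤ) : ℤ := (v - 1) * (v - 2) * (v - 3) * ((v - 1) * (v - 2) * (v - 3)) - 1

/-- The square of a nonzero integer is at least `1`, so the test is negative exactly when the cubic
with roots `1, 2, 3` vanishes. -/
theorem symbolTest_neg {v : ℤ} : symbolTest v < 0 ↔ symbolOf v ≠ none := by
  rw [Ne, symbolOf_eq_none, symbolTest]
  constructor
  · rintro h ⟨h1, h2, h3⟩
    have : (v - 1) * (v - 2) * (v - 3) ≠ 0 :=
      mul_ne_zero (mul_ne_zero (sub_ne_zero.2 h1) (sub_ne_zero.2 h2)) (sub_ne_zero.2 h3)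
    have := mul_self_pos.2 this
    omega
  · intro h
    have : v = 1 ∨ v = 2 ∨ v = 3 := by omega
    rcases this with rfl | rfl | rfl <;> norm_num

theorem evRegs_testLines (I : List ℤ) (r : ℕ → ℤ) : evRegs I testLines r =
    Function.update (Function.update (Function.update r 72 1) 8 (r 0 - 3)) 16
      (symbolTest (r 0)) := by
  ext a
  simp only [testLines, evRegs, Line.evReg, Instr.evReg, Function.update_apply, symbolTest]
  by_cases h16 : a = 16
  · simp [h16]
  · by_cases h8 : a = 8
    · simp [h8]
    · by_cases h72 : a = 72 <;> simp [h16, h8, h72]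

def copyPre : List Line := .prim (.load 0 48) :: testLines

def copyBody : List Line := [.prim (.store 56 0), .prim (.const 16 8), .prim (.add 48 48 16),
  .prim (.add 56 56 16)]

/-- Copies the word in the array `2` to the array `5`, from the address in `R 32` on. -/
def copyCmds : List Cmd :=
  [.lines [.prim (.const 48 2), .prim (.copy 56 32)], .loop copyPre 16 copyBody]

theorem evRegs_copyPre (I : List ℤ) {r : ℕ → ℤ} {i : ℕ} (h : r 48 = (8 * i + 2 : ℕ)) :
    evRegs I copyPre r = Function.update (Function.update (Function.update (Function.update r 0
      (r (8 * i + 2))) 72 1) 8 (r (8 * i + 2) - 3)) 16 (symbolTest (r (8 * i + 2))) := by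
  rw [copyPre, evRegs, evRegs_testLines]
  simp only [Line.evReg, Instr.evReg, h, Int.toNat_natCast, Function.update_self]

theorem evRegs_copyBody (I : List ℤ) {r : ℕ → ℤ} {i j : ℕ} (h : r 48 = (8 * i + 2 : ℕ))
    (h' : r 56 = (8 * j + 5 : ℕ)) : evRegs I copyBody r =
      Function.update (Function.update (Function.update (Function.update r (8 * j + 5) (r 0)) 16 8)
        48 (8 * (i + 1) + 2 : ℕ)) 56 (8 * (j + 1) + 5 : ℕ) := by
  have e : ∀ k, k % 8 = 0 → k ≠ 8 * j + 5 := by intro k hk; omega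
  ext a
  simp only [copyBody, evRegs, Line.evReg, Instr.evReg, h', Int.toNat_natCast]
  rw [show ((8 * (i + 1) + 2 : ℕ) : ℤ) = (8 * i + 2 : ℕ) + 8 by push_cast; ring, ← h,
    show ((8 * (j + 1) + 5 : ℕ) : ℤ) = (8 * j + 5 : ℕ) + 8 by push_cast; ring, ← h']
  simp [Function.update_apply, e]

theorem bits_natCast_mono {m n : ℕ} (h : m ≤ n) : bits (m : ℤ) ≤ bits (n : ℤ) :=
  bits_mono (by simpa using h)

/-- After `i` rounds `R 48` and `R 56` point to position `i` of the source and of the target. The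
loop stops at the first entry that is not a symbol, which is how `WordAt` marks the end of `w`. -/
theorem runs_copy {I : List ℤ} {w : Word} {b p : ℕ} {c : Config}
    (hw : WordAt w fun i => c.reg (8 * i + 2)) (hp : c.reg 32 = (8 * p + 5 : ℕ))
    (hb : MaxBits b c.reg) (h4 : 4 ≤ b) (hpb : bits ((8 * (p + w.length) + 5 : ℕ) : ℤ) ≤ b) :
    ∃ c', Runs I copyCmds c c' ∧ (∀ a, a ∉ scratch → c'.reg a =
      if a % 8 = 5 ∧ p ≤ a / 8 ∧ a / 8 < p + w.length then (encWord w).getD (a / 8 - p) 0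
        else c.reg a) ∧ c'.out = c.out ∧ c'.outputs = c.outputs ∧ MaxBits (2 ^ 12 * b) c'.reg ∧
      c'.time ≤ c.time + (w.length + 1) * (8 ^ 20 * b) := by
  obtain ⟨β, hI⟩ := exists_bits_le I
  have hns : ∀ k, k ∈ scratch → k % 8 = 0 := by decide
  have himm : ∀ l ∈ copyPre ++ copyBody, l.imm β ≤ b := by
    have : ∀ l ∈ copyPre ++ copyBody, l.imm β ≤ 4 := by
      simp only [copyPre, testLines, copyBody, List.cons_append, List.nil_append, List.mem_cons,
        List.not_mem_nil, or_false, forall_eq_or_imp, forall_eq, Line.imm]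
      decide
    exact fun l hl => (this l hl).trans h4
  set ls : List Line := [.prim (.const 48 2), .prim (.copy 56 32)] with hls
  have hreg₁ : ⇑(effLines I ls c).reg = Function.update (Function.update c.reg 48 2) 56
      (8 * p + 5 : ℕ) := by
    rw [effLines_reg, hls]
    simp only [evRegs, Line.evReg, Instr.evReg, ← hp]
    simp
  set Inv : ℕ → Config → Prop := fun k c' => ∃ i, i + k = w.length ∧ c'.reg 48 = (8 * i + 2 : ℕ) ∧
    c'.reg 56 = (8 * (p + i) + 5 : ℕ) ∧ (∀ a, a ∉ scratch → c'.reg a =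
      if a % 8 = 5 ∧ p ≤ a / 8 ∧ a / 8 < p + i then (encWord w).getD (a / 8 - p) 0
        else c.reg a) ∧ MaxBits b c'.reg ∧ c'.out = c.out ∧ c'.outputs = c.outputs with hInv
  have hmir : ∀ {k : ℕ} {c' : Config}, (∀ a, a ∉ scratch → c'.reg a =
      if a % 8 = 5 ∧ p ≤ a / 8 ∧ a / 8 < p + k then (encWord w).getD (a / 8 - p) 0
        else c.reg a) → ∀ i, c'.reg (8 * i + 2) = c.reg (8 * i + 2) := by
    intro k c' h i
    rw [h _ fun hm => by have := hns _ hm; omega, if_neg (by omega)]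
  obtain ⟨c₀, t, ⟨i, hi, h48, h56, hreg, hbits, hout, houts⟩, hruns, ht⟩ :=
    Runs.loop (b := b) (pre := copyPre) (body := copyBody) (i := 16) hI rfl rfl
      (by simp [copyBody]) (by omega) himm Inv (fun _ _ _ h => h)
      (fun _ _ ⟨_, _, _, _, _, h, _⟩ => h)
      (by
        rintro k c' ⟨i, hi, h48, h56, hreg, hbits, hout, houts⟩
        have hv := hmir hreg i
        have hvw := hw.eq i (by omega)
        rw [hvw] at hv
        have hvr := encWord_getD_range (w := w) i
        refine ⟨?_, i + 1, by omega, ?_, ?_, ?_, ?_, ?_, ?_⟩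
        · rw [evRegs_copyPre I h48, Function.update_self, symbolTest_neg, hv,
            symbolOf_encWord_getD, List.getElem?_eq_getElem (by omega)]
          simp
        all_goals
          try rw [effLines_reg, evRegs_append, evRegs_copyPre I h48,
            evRegs_copyBody I (i := i) (j := p + i) (by simpa using h48) (by simpa using h56)]
        · simp
        · simp [add_assoc]
        · intro a ha
          have hne : ∀ k, k ∈ scratch → a ≠ k := fun k hk h => ha (h ▸ hk)
          rw [Function.update_of_ne (hne 56 (by decide)), Function.update_of_ne (hne 48 (by decide)),
            Function.update_of_ne (hne 16 (by decide)), Function.update_apply]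
          split_ifs with h1 h2 h2
          · subst h1
            rw [show (8 * (p + i) + 5) / 8 - p = i by omega]
            simpa using hv
          · omega
          · rw [Function.update_of_ne (hne 16 (by decide)),
              Function.update_of_ne (hne 8 (by decide)), Function.update_of_ne (hne 72 (by decide)),
              Function.update_of_ne (hne 0 (by decide)), hreg a ha, if_pos (by omega)]
          · rw [Function.update_of_ne (hne 16 (by decide)),
              Function.update_of_ne (hne 8 (by decide)), Function.update_of_ne (hne 72 (by decide)),
              Function.update_of_ne (hne 0 (by decide)), hreg a ha, if_neg (by omega)]
        · have hv3 : bits (c'.reg (8 * i + 2)) ≤ b := hbits _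
          have h8 : bits (c'.reg (8 * i + 2) - 3) ≤ b := by
            refine le_trans (bits_mono (y := 3) ?_) ((by decide : bits 3 ≤ 4).trans h4)
            omega
          have hst : bits (symbolTest (c'.reg (8 * i + 2))) ≤ b := by
            have hsy : symbolOf (c'.reg (8 * i + 2)) ≠ none := by
              rw [hv, symbolOf_encWord_getD, List.getElem?_eq_getElem (by omega)]; simp
            rw [Ne, symbolOf_eq_none] at hsy
            have : c'.reg (8 * i + 2) = 1 ∨ c'.reg (8 * i + 2) = 2 ∨ c'.reg (8 * i + 2) = 3 := by
              omega
            refine le_trans ?_ h4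
            rcases this with h | h | h <;> rw [h] <;> decide
          have h1 : bits 1 ≤ b := (by decide : bits 1 ≤ 4).trans h4
          have h8' : bits 8 ≤ b := (by decide : bits 8 ≤ 4).trans h4
          refine ((((((((hbits.update hv3).update h1).update h8).update hst).update ?_).update
            h8').update ?_).update ?_)
          · simpa using hv3
          · exact (bits_natCast_mono (by omega)).trans hpb
          · exact (bits_natCast_mono (by omega)).trans hpb
        · rw [effLines_out _ (by rfl), hout]
        · rw [effLines_outputs _ (by rfl), houts])
      (by
        rintro c' ⟨i, hi, h48, h56, hreg, -⟩
        have hv := hmir hreg i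
        have := hw.none
        rw [show w.length = i by omega, ← hv] at this
        rw [evRegs_copyPre I h48, Function.update_self, ← not_lt, symbolTest_neg, not_not]
        exact this)
      (r := w.length) (c := effLines I ls c)
      ⟨0, by omega, by rw [hreg₁]; simp, by rw [hreg₁]; simp, fun a ha => by
        have hne : ∀ k, k ∈ scratch → a ≠ k := fun k hk h => ha (h ▸ hk)
        rw [hreg₁, Function.update_of_ne (hne 56 (by decide)),
          Function.update_of_ne (hne 48 (by decide)), if_neg (by omega)],
        by
          rw [hreg₁]
          exact (hb.update ((by decide : bits 2 ≤ 4).trans h4)).update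
            ((bits_natCast_mono (by omega)).trans hpb),
        by rw [effLines_out _ (by rfl)], by rw [effLines_outputs _ (by rfl)]⟩
  have hi' : i = w.length := by omega
  subst hi'
  refine ⟨_, (Runs.lines (ls := ls) rfl c).cons hruns, fun a ha => ?_, ?_, ?_, ?_, ?_⟩
  · have hne : ∀ k, k ∈ scratch → a ≠ k := fun k hk h => ha (h ▸ hk)
    rw [Config.withTime_reg, effLines_reg, evRegs_copyPre I h48,
      Function.update_of_ne (hne 16 (by decide)), Function.update_of_ne (hne 8 (by decide)),
      Function.update_of_ne (hne 72 (by decide)), Function.update_of_ne (hne 0 (by decide)),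
      hreg a ha]
  · rw [Config.withTime_out, effLines_out _ (by rfl), hout]
  · rw [Config.withTime_outputs, effLines_outputs _ (by rfl), houts]
  · have h1 := maxBits_effLines (ls := copyPre) hI rfl hbits (by omega)
      fun l hl => himm l (List.mem_append_left _ hl)
    have e1 : copyPre.length = 12 := rfl
    rw [e1] at h1
    exact h1
  · have h1 := time_effLines_le (I := I) (ls := ls) (c := c) hI rfl hb (by omega)
      (by
        simp only [hls, List.mem_cons, List.not_mem_nil, or_false, forall_eq_or_imp, forall_eq,
          Line.imm]
        exact ⟨(by decide : bits 2 ≤ 4).trans h4, by omega⟩)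
    have e1 : ls.length = 2 := rfl
    have e2 : (copyPre ++ copyBody).length = 16 := rfl
    rw [e1] at h1
    rw [e2] at ht
    simp only [Config.withTime_time]
    have : (w.length + 1) * (8 ^ 16 * b + 2) + 8 ^ 2 * b ≤ (w.length + 1) * (8 ^ 20 * b) := by
      have : 8 ^ 2 * b ≤ (w.length + 1) * (8 ^ 2 * b) := Nat.le_mul_of_pos_left _ (by omega)
      have h2 : 8 ^ 16 * b + 2 + 8 ^ 2 * b ≤ 8 ^ 20 * b := by omega
      have h3 := Nat.mul_le_mul_left (w.length + 1) h2
      rw [mul_add (w.length + 1) _ (8 ^ 2 * b)] at h3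
      omega
    omega

theorem le_time_effLines (I : List ℤ) (ls : List Line) (c : Config) :
    c.time ≤ (effLines I ls c).time := by
  induction ls generalizing c with
  | nil => exact le_rfl
  | cons l ls ih =>
    refine le_trans ?_ (ih _)
    cases l with
    | prim ins => simp only [Line.eff, Instr.eff_time]; omega
    | clamp i => simp only [Line.eff]; omega

/-! ### Producing a word and comparing it with the reference word -/

def emitPre : List Line := .prim (.load 0 48) :: .prim (.load 80 56) :: testLines

/-- The lines of `emitBody` after the first one. -/
def emitStep : List Line := [.prim (.sub 80 0 80), .prim (.mul 80 80 80), .prim (.add 64 64 80),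
  .prim (.const 16 8), .prim (.add 48 48 16), .prim (.add 56 56 16), .prim (.const 16 1),
  .prim (.add 88 88 16)]

def emitBody : List Line := .prim (.write 88 0) :: emitStep

def emitStart : List Line := [.prim (.const 48 2), .prim (.copy 56 32), .prim (.const 64 0),
  .prim (.const 88 0)]

/-- The lines after the `OUTPUT` instruction, which decrease the counter `R 40` if `R 64 = 0` and
`R 80 = 0`. -/
def emitEnd : List Line := [.prim (.mul 80 80 80), .prim (.add 64 64 80), .prim (.const 16 1),
  .prim (.sub 64 16 64), .clamp 64, .prim (.sub 40 40 64)]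

/-- Produces the word in the array `2`, and decreases the counter `R 40` if this word is equal to
the one in the array `5` from the address in `R 32` on. -/
def emitCmds : List Cmd :=
  [.lines emitStart, .loop emitPre 16 emitBody,
    .lines (.prim (.const 16 0) :: .prim (.write 88 16) :: .prim .output :: emitEnd)]

theorem evRegs_emitPre (I : List ℤ) {r : ℕ → ℤ} {i j : ℕ} (h : r 48 = (8 * i + 2 : ℕ))
    (h' : r 56 = (8 * j + 5 : ℕ)) :
    evRegs I emitPre r = Function.update (Function.update (Function.update (Function.update
      (Function.update r 0 (r (8 * i + 2))) 80 (r (8 * j + 5))) 72 1) 8 (r (8 * i + 2) - 3)) 16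
      (symbolTest (r (8 * i + 2))) := by
  have e : 8 * j + 5 ≠ 0 := by omega
  rw [emitPre, evRegs, evRegs, evRegs_testLines]
  simp only [Line.evReg, Instr.evReg, h, Int.toNat_natCast, Function.update_self,
    Function.update_of_ne (show (56 : ℕ) ≠ 0 by omega), h', Function.update_of_ne e,
    Function.update_of_ne (show (0 : ℕ) ≠ 80 by omega)]

theorem evRegs_emitStep (I : List ℤ) (r : ℕ → ℤ) : evRegs I emitStep r =
    Function.update (Function.update (Function.update (Function.update (Function.update
      (Function.update r 80 ((r 0 - r 80) * (r 0 - r 80))) 64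
      (r 64 + (r 0 - r 80) * (r 0 - r 80))) 16 1) 48 (r 48 + 8)) 56 (r 56 + 8)) 88 (r 88 + 1) := by
  ext a
  simp [emitStep, evRegs, Line.evReg, Instr.evReg, Function.update_apply]
  by_cases h1 : a = 16
  · simp [h1]
  · simp [h1]

/-- When `s = r 64 + r 80 * r 80` is nonnegative, `max (1 - s) 0` is the indicator of `s = 0`, so
the counter is decreased without a branch. -/
theorem evRegs_emitEnd (I : List ℤ) (r : ℕ → ℤ) : evRegs I emitEnd r =
    Function.update (Function.update (Function.update (Function.update r 80 (r 80 * r 80)) 16 1) 64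
      (max (1 - (r 64 + r 80 * r 80)) 0)) 40 (r 40 - max (1 - (r 64 + r 80 * r 80)) 0) := by
  ext a
  simp [emitEnd, evRegs, Line.evReg, Instr.evReg, Function.update_apply]
  by_cases h1 : a = 64
  · simp [h1]
  · simp [h1]

/-- Symbols are encoded by `1, 2, 3`, so the value `0` at position `w.length` means that `y` is not
longer than `w`; a shorter `y` is excluded by the entrywise equalities. -/
theorem encWord_getD_eq_iff {w y : Word} :
    w = y ↔ (∀ i < w.length, (encWord w).getD i 0 = (encWord y).getD i 0) ∧
      (encWord y).getD w.length 0 = 0 := by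
  constructor
  · rintro rfl
    exact ⟨fun _ _ => rfl, List.getD_eq_default _ _ (by simp)⟩
  · rintro ⟨h1, h2⟩
    refine WordAt.unique (o := fun i => (encWord y).getD i 0) ⟨fun i hi => (h1 i hi).symm, ?_⟩
      (wordAt_encWord y)
    rw [h2]; rfl

/-- `R 64` adds up the squared differences of the entries of `w` and `y`, and at the end `R 80`
holds the entry of `y` at position `w.length`; both vanish exactly if `w = y`. An entry lies in `0,
..., 3`, so a square is at most `9`, and the factor `9` in `hpb` covers both this sum and the
addresses. -/
theorem runs_emit {I : List ℤ} {w y : Word} {b p : ℕ} {c : Config}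
    (hw : WordAt w fun i => c.reg (8 * i + 2)) (hp : c.reg 32 = (8 * p + 5 : ℕ))
    (hy : ∀ i, c.reg (8 * (p + i) + 5) = (encWord y).getD i 0)
    (hb : MaxBits b c.reg) (h4 : 4 ≤ b) (hpb : bits ((9 * (p + w.length) + 5 : ℕ) : ℤ) ≤ b) :
    ∃ c' t, Runs I emitCmds c c' ∧ (∀ a, a ∉ scratch → a ≠ 40 → c'.reg a = c.reg a) ∧
      c'.reg 40 = c.reg 40 - (if w = y then 1 else 0) ∧
      (∀ i, c'.out i = if i < w.length then (encWord w).getD i 0 else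
        if i = w.length then 0 else c.out i) ∧ c'.outputs = c.outputs ++ [(t, w)] ∧ t ≤ c'.time ∧
      MaxBits (2 ^ 30 * b) c'.reg ∧ c'.time ≤ c.time + (w.length + 1) * (8 ^ 30 * b) := by
  obtain ⟨β, hI⟩ := exists_bits_le I
  have hns : ∀ k, k ∈ scratch → k % 8 = 0 := by decide
  have himm : ∀ l ∈ emitPre ++ emitBody, l.imm β ≤ b := by
    have : ∀ l ∈ emitPre ++ emitBody, l.imm β ≤ 4 := by
      simp only [emitPre, testLines, emitBody, emitStep, List.cons_append, List.nil_append,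
        List.mem_cons, List.not_mem_nil, or_false, forall_eq_or_imp, forall_eq, Line.imm]
      decide
    exact fun l hl => (this l hl).trans h4
  have hreg₁ : ⇑(effLines I emitStart c).reg = Function.update (Function.update (Function.update
      (Function.update c.reg 48 2) 56 (8 * p + 5 : ℕ)) 64 0) 88 0 := by
    rw [effLines_reg, emitStart]
    simp only [evRegs, Line.evReg, Instr.evReg, ← hp]
    simp
  set Inv : ℕ → Config → Prop := fun k c' => ∃ i, i + k = w.length ∧ c'.reg 48 = (8 * i + 2 : ℕ) ∧
    c'.reg 56 = (8 * (p + i) + 5 : ℕ) ∧ c'.reg 88 = (i : ℕ) ∧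
    (0 ≤ c'.reg 64 ∧ c'.reg 64 ≤ 9 * i ∧
      (c'.reg 64 = 0 ↔ ∀ j < i, (encWord w).getD j 0 = (encWord y).getD j 0)) ∧
    (∀ a, a ∉ scratch → c'.reg a = c.reg a) ∧ MaxBits b c'.reg ∧
    (∀ j, c'.out j = if j < i then (encWord w).getD j 0 else c.out j) ∧
    c'.outputs = c.outputs with hInv
  have hmir : ∀ {c' : Config}, (∀ a, a ∉ scratch → c'.reg a = c.reg a) →
      (∀ i, c'.reg (8 * i + 2) = c.reg (8 * i + 2)) ∧
      ∀ i, c'.reg (8 * (p + i) + 5) = (encWord y).getD i 0 := by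
    intro c' h
    refine ⟨fun i => h _ fun hm => ?_, fun i => ?_⟩
    · have := hns _ hm; omega
    · rw [h _ fun hm => ?_, hy]
      have := hns _ hm; omega
  obtain ⟨c₀, t, ⟨i, hi, h48, h56, h88, h64, hreg, hbits, hout, houts⟩, hruns, ht⟩ :=
    Runs.loop (b := b) (pre := emitPre) (body := emitBody) (i := 16) hI rfl rfl
      (by simp [emitBody, emitStep]) (by omega) himm Inv (fun _ _ _ h => h)
      (fun _ _ ⟨_, _, _, _, _, _, _, h, _⟩ => h)
      (by
        rintro k c' ⟨i, hi, h48, h56, h88, ⟨h64a, h64b, h64c⟩, hreg, hbits, hout, houts⟩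
        obtain ⟨hv, hd⟩ := hmir hreg
        replace hv := hv i
        replace hd := hd i
        have hvw := hw.eq i (by omega)
        rw [hvw] at hv
        have hvr := encWord_getD_range (w := w) i
        have hdr := encWord_getD_range (w := y) i
        set v := (encWord w).getD i 0 with hvdef
        set d := (encWord y).getD i 0 with hddef
        have hsq : 0 ≤ (v - d) * (v - d) ∧ (v - d) * (v - d) ≤ 9 := by
          constructor
          · exact mul_self_nonneg _
          · nlinarith
        have hpre := evRegs_emitPre I (r := c'.reg) (i := i) (j := p + i) h48 h56
        rw [hv, hd] at hpre
        have hstep : evRegs I (emitPre ++ emitBody) c'.reg = Function.update (Function.update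
            (Function.update (Function.update (Function.update (Function.update (Function.update
            (Function.update (Function.update c'.reg 0 v) 72 1) 8 (v - 3)) 80 ((v - d) * (v - d)))
            64 (c'.reg 64 + (v - d) * (v - d))) 16 1) 48 (8 * (i + 1) + 2 : ℕ)) 56
            (8 * (p + i + 1) + 5 : ℕ)) 88 (i + 1 : ℕ) := by
          rw [evRegs_append, hpre, emitBody, evRegs, evRegs_emitStep]
          have e1 : ((8 * (i + 1) + 2 : ℕ) : ℤ) = c'.reg 48 + 8 := by rw [h48]; push_cast; ring
          have e2 : ((8 * (p + i + 1) + 5 : ℕ) : ℤ) = c'.reg 56 + 8 := by rw [h56]; push_cast; ring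
          have e3 : ((i + 1 : ℕ) : ℤ) = c'.reg 88 + 1 := by rw [h88]; push_cast; ring
          rw [e1, e2, e3]
          ext a
          simp [Line.evReg, Instr.evReg, Function.update_apply]
          by_cases h1 : a = 80
          · simp [h1]
          · by_cases h2 : a = 16
            · simp [h2]
            · simp [h1, h2]
        have hsy : symbolOf v ≠ none := by
          rw [hvdef, symbolOf_encWord_getD, List.getElem?_eq_getElem (by omega)]; simp
        refine ⟨?_, i + 1, by omega, ?_, ?_, ?_, ⟨?_, ?_, ?_⟩, ?_, ?_, ?_, ?_⟩
        · rw [hpre, Function.update_self, symbolTest_neg]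
          exact hsy
        · rw [effLines_reg, hstep]; simp
        · rw [effLines_reg, hstep]; simp [add_assoc]
        · rw [effLines_reg, hstep]; simp
        · rw [effLines_reg, hstep]; simp; omega
        · rw [effLines_reg, hstep]; simp; omega
        · have : (effLines I (emitPre ++ emitBody) c').reg 64 = c'.reg 64 + (v - d) * (v - d) := by
            rw [effLines_reg, hstep]; simp
          rw [this]
          have h0 : (v - d) * (v - d) = 0 ↔ v = d := by rw [mul_self_eq_zero, sub_eq_zero]
          constructor
          · intro h j hj
            rcases (Nat.lt_succ_iff.1 hj).lt_or_eq with hj | rfl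
            · exact h64c.1 (by omega) j hj
            · exact h0.1 (by omega)
          · intro h
            have h1 := h64c.2 fun j hj => h j (by omega)
            have h2 := h0.2 (h i (by omega))
            omega
        · intro a ha
          have hne : ∀ k, k ∈ scratch → a ≠ k := fun k hk h => ha (h ▸ hk)
          rw [effLines_reg, hstep, Function.update_of_ne (hne 88 (by decide)),
            Function.update_of_ne (hne 56 (by decide)), Function.update_of_ne (hne 48 (by decide)),
            Function.update_of_ne (hne 16 (by decide)), Function.update_of_ne (hne 64 (by decide)),
            Function.update_of_ne (hne 80 (by decide)), Function.update_of_ne (hne 8 (by decide)),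
            Function.update_of_ne (hne 72 (by decide)), Function.update_of_ne (hne 0 (by decide)),
            hreg a ha]
        · rw [effLines_reg, hstep]
          have hsmall : ∀ x : ℤ, x.natAbs ≤ 9 → bits x ≤ b := fun x hx =>
            ((bits_mono (y := 9) hx).trans (by decide : bits 9 ≤ 4)).trans h4
          refine ((((((((hbits.update (hsmall _ ?_)).update (hsmall _ ?_)).update
            (hsmall _ ?_)).update (hsmall _ ?_)).update ?_).update (hsmall _ ?_)).update ?_).update
            ?_).update ?_
          · omega
          · simp
          · omega
          · omega
          · refine le_trans (bits_mono ?_) hpb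
            rw [Int.natAbs_natCast]
            omega
          · simp
          · exact (bits_natCast_mono (by omega)).trans hpb
          · exact (bits_natCast_mono (by omega)).trans hpb
          · exact (bits_natCast_mono (by omega)).trans hpb
        · intro j
          have : (effLines I (emitPre ++ emitBody) c').out = c'.out.update i v := by
            rw [effLines_append, emitBody, effLines, effLines_out _ (by rfl)]
            simp only [Line.eff, Instr.eff]
            rw [effLines_out _ (by rfl), effLines_reg, hpre]
            simp [h88]
          rw [this, Finsupp.coe_update, Function.update_apply, hout]
          split_ifs with h1 h2 h2 h3 h3 <;> first | omega | (subst h1; rfl)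
        · rw [effLines_append, emitBody, effLines, effLines_outputs _ (by rfl)]
          simp only [Line.eff, Instr.eff]
          rw [effLines_outputs _ (by rfl), houts])
      (by
        rintro c' ⟨i, hi, h48, h56, h88, -, hreg, -⟩
        have hv := (hmir hreg).1 i
        have := hw.none
        rw [show w.length = i by omega, ← hv] at this
        rw [evRegs_emitPre I h48 h56, Function.update_self, ← not_lt, symbolTest_neg, not_not]
        exact this)
      (r := w.length) (c := effLines I emitStart c)
      ⟨0, by omega, by rw [hreg₁]; simp, by rw [hreg₁]; simp, by rw [hreg₁]; simp,
        by rw [hreg₁]; simp, fun a ha => by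
        have hne : ∀ k, k ∈ scratch → a ≠ k := fun k hk h => ha (h ▸ hk)
        rw [hreg₁, Function.update_of_ne (hne 88 (by decide)),
          Function.update_of_ne (hne 64 (by decide)), Function.update_of_ne (hne 56 (by decide)),
          Function.update_of_ne (hne 48 (by decide))],
        by
          rw [hreg₁]
          exact (((hb.update ((by decide : bits 2 ≤ 4).trans h4)).update
            ((bits_natCast_mono (by omega)).trans hpb)).update (by simp)).update (by simp),
        fun j => by rw [effLines_out _ (by rfl)]; simp,
        by rw [effLines_outputs _ (by rfl)]⟩
  have hi' : i = w.length := by omega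
  subst hi'
  have hd := (hmir hreg).2 w.length
  have hpre := evRegs_emitPre I (r := c₀.reg) (i := w.length) (j := p + w.length) h48 h56
  rw [hd] at hpre
  set c₁ := (effLines I emitPre c₀).withTime t with hc₁
  set d := (encWord y).getD w.length 0 with hddef
  have hc₁reg : ⇑c₁.reg = evRegs I emitPre c₀.reg := by
    rw [hc₁, Config.withTime_reg, effLines_reg]
  -- The `0` written behind the word ends it; the output registers after that may still hold symbols
  -- of an earlier, longer word.
  set ls : List Line := .prim (.const 16 0) :: .prim (.write 88 16) :: .prim .output :: emitEnd
    with hls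
  have hc1b : MaxBits (2 ^ 13 * b) c₁.reg := by
    have h1 := maxBits_effLines (ls := emitPre) hI rfl hbits (by omega)
      fun l hl => himm l (List.mem_append_left _ hl)
    have e1 : emitPre.length = 13 := rfl
    rw [e1] at h1
    exact h1
  have himm2 : ∀ l ∈ ls, l.imm β ≤ 2 ^ 13 * b := by
    have : ∀ l ∈ ls, l.imm β ≤ 4 := by
      simp only [hls, emitEnd, List.mem_cons, List.not_mem_nil, or_false, forall_eq_or_imp,
        forall_eq, Line.imm]
      decide
    exact fun l hl => (this l hl).trans (by omega)
  have hreg88 : c₁.reg 88 = (w.length : ℕ) := by rw [hc₁reg, hpre]; simp [h88]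
  have hfin : ⇑(effLines I ls c₁).reg = evRegs I emitEnd (Function.update c₁.reg 16 0) := by
    rw [effLines_reg, hls]; rfl
  rw [evRegs_emitEnd] at hfin
  have h40 : ∀ a, a ∉ scratch → c₁.reg a = c.reg a := by
    intro a ha
    have hne : ∀ k, k ∈ scratch → a ≠ k := fun k hk h => ha (h ▸ hk)
    rw [hc₁reg, hpre, Function.update_of_ne (hne 16 (by decide)),
      Function.update_of_ne (hne 8 (by decide)), Function.update_of_ne (hne 72 (by decide)),
      Function.update_of_ne (hne 80 (by decide)), Function.update_of_ne (hne 0 (by decide)),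
      hreg a ha]
  have h64' : c₁.reg 64 = c₀.reg 64 := by rw [hc₁reg, hpre]; simp
  have h80' : c₁.reg 80 = d := by rw [hc₁reg, hpre]; simp
  set c₂ := Line.eff I (.prim (.write 88 16)) (Line.eff I (.prim (.const 16 0)) c₁) with hc₂
  have hc₂out : ∀ i, c₂.out i = if i < w.length then (encWord w).getD i 0 else
      if i = w.length then 0 else c.out i := by
    intro i
    simp only [hc₂, Line.eff, Instr.eff, Finsupp.coe_update, Function.update_apply, hreg88,
      if_pos, show (88 : ℕ) ≠ 16 by omega, if_false, Int.toNat_natCast]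
    rw [hc₁, Config.withTime_out, effLines_out _ (by rfl), hout]
    split_ifs <;> omega
  have hwat : outWord c₂.out = w := by
    refine WordAt.outWord_eq ⟨fun i hi => ?_, ?_⟩
    · rw [hc₂out, if_pos hi]
    · rw [hc₂out, if_neg (by omega), if_pos rfl]; rfl
  have hlines : effLines I ls c₁ = effLines I emitEnd (Line.eff I (.prim .output) c₂) := rfl
  refine ⟨_, c₂.time, (Runs.lines (ls := emitStart) rfl c).cons (hruns.cons
    (Runs.lines (ls := ls) rfl _)), fun a ha ha40 => ?_, ?_, ?_, ?_, ?_, ?_, ?_⟩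
  · have hne : ∀ k, k ∈ scratch → a ≠ k := fun k hk h => ha (h ▸ hk)
    rw [hfin, Function.update_of_ne ha40, Function.update_of_ne (hne 64 (by decide)),
      Function.update_of_ne (hne 16 (by decide)), Function.update_of_ne (hne 80 (by decide)),
      Function.update_of_ne (hne 16 (by decide)), h40 a ha]
  · rw [hfin, Function.update_self, Function.update_of_ne (by omega),
      Function.update_of_ne (by omega), Function.update_of_ne (by omega), h64', h80',
      h40 40 (by decide)]
    congr 1
    obtain ⟨h64a, h64b, h64c⟩ := h64
    have hdr := encWord_getD_range (w := y) w.length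
    have hdd : 0 ≤ d * d ∧ (d * d = 0 ↔ d = 0) := ⟨mul_self_nonneg _, mul_self_eq_zero⟩
    split_ifs with hwy
    · obtain ⟨h1, h2⟩ := encWord_getD_eq_iff.1 hwy
      have h3 := h64c.2 h1
      have h4 := hdd.2.2 h2
      omega
    · by_contra hne
      refine hwy (encWord_getD_eq_iff.2 ⟨h64c.1 ?_, hdd.2.1 ?_⟩) <;> omega
  · intro i
    rw [hlines, effLines_out _ (by rfl)]
    exact hc₂out i
  · rw [hlines, effLines_outputs _ (by rfl)]
    have ho : c₂.outputs = c.outputs := by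
      simp only [hc₂, Line.eff, Instr.eff]
      rw [hc₁, Config.withTime_outputs, effLines_outputs _ (by rfl), houts]
    simp only [Line.eff, Instr.eff, hwat, ho]
  · rw [hlines]
    refine le_trans ?_ (le_time_effLines I emitEnd _)
    simp [Line.eff, Instr.eff]
  · have h1 := maxBits_effLines (ls := ls) hI rfl hc1b (by omega) himm2
    have e1 : ls.length = 9 := rfl
    rw [e1] at h1
    have h3 : 2 ^ 9 * (2 ^ 13 * b) ≤ 2 ^ 30 * b := by omega
    exact MaxBits.mono h1 h3
  · have h1 := time_effLines_le (I := I) (ls := emitStart) (c := c) hI rfl hb (by omega)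
      (by
        simp only [emitStart, List.mem_cons, List.not_mem_nil, or_false, forall_eq_or_imp,
          forall_eq, Line.imm]
        refine ⟨(by decide : bits 2 ≤ 4).trans h4, ?_, ?_, ?_⟩ <;> simp)
    have h2 := time_effLines_le (I := I) (ls := ls) (c := c₁) hI rfl hc1b (by omega) himm2
    have e1 : emitStart.length = 4 := rfl
    have e2 : (emitPre ++ emitBody).length = 22 := rfl
    have e3 : ls.length = 9 := rfl
    have e4 : c₁.time = t := rfl
    rw [e1] at h1
    rw [e3, e4] at h2
    rw [e2] at ht
    have : (w.length + 1) * (8 ^ 22 * b + 2) + (8 ^ 4 * b + 8 ^ 9 * (2 ^ 13 * b)) ≤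
        (w.length + 1) * (8 ^ 30 * b) := by
      have h3 : 8 ^ 4 * b + 8 ^ 9 * (2 ^ 13 * b) ≤
          (w.length + 1) * (8 ^ 4 * b + 8 ^ 9 * (2 ^ 13 * b)) :=
        Nat.le_mul_of_pos_left _ (by omega)
      have h2 : 8 ^ 22 * b + 2 + (8 ^ 4 * b + 8 ^ 9 * (2 ^ 13 * b)) ≤ 8 ^ 30 * b := by omega
      have h4 := Nat.mul_le_mul_left (w.length + 1) h2
      rw [mul_add (w.length + 1) _ (8 ^ 4 * b + _)] at h4
      omega
    omega

/-! ### The initialisation -/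

theorem encWordRat_getD {x : Word} {ε : ℚ} {i : ℕ} (h : i ≤ x.length) :
    (encWordRat x ε).getD i 0 = (encWord x).getD i 0 := by
  unfold encWordRat
  rcases h.lt_or_eq with h | rfl
  · rw [List.getD_append _ _ _ _ (by simpa using h)]
  · rw [List.getD_append_right _ _ _ _ (by simp), List.getD_eq_default (encWord x) _ (by simp)]
    simp

theorem encWordRat_getD_num (x : Word) (ε : ℚ) :
    (encWordRat x ε).getD (x.length + 1) 0 = ε.num := by
  unfold encWordRat
  rw [List.getD_append_right _ _ _ _ (by simp)]
  simp

theorem encWordRat_getD_den (x : Word) (ε : ℚ) :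
    (encWordRat x ε).getD (x.length + 2) 0 = ε.den := by
  unfold encWordRat
  rw [List.getD_append_right _ _ _ _ (by simp)]
  simp

theorem bits_encWord_le {x : Word} : ∀ v ∈ encWord x, bits v ≤ 2 := by
  intro v hv
  rw [encWord_eq, List.mem_map] at hv
  obtain ⟨s, -, rfl⟩ := hv
  fin_cases s <;> decide

theorem bits_encWordRat_le {x : Word} {ε : ℚ} :
    ∀ v ∈ encWordRat x ε, bits v ≤ ratSize ε + 2 := by
  intro v hv
  simp only [encWordRat, List.mem_append, List.mem_cons, List.not_mem_nil, or_false] at hv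
  rcases hv with hv | rfl | rfl | rfl
  · exact (bits_encWord_le v hv).trans (by omega)
  · simp
  · unfold ratSize; omega
  · unfold ratSize; omega

/-- The registers between two simulations: the input `x` is in the array `3`, the array `5` holds
`l`, the register `40` holds the counter `K`. -/
def baseReg (x : Word) (l : List ℤ) (K : ℤ) (a : ℕ) : ℤ :=
  if a = 24 then 4 else if a = 32 then (8 * (x.length + 1) + 5 : ℕ) else if a = 40 then K else
    if a % 8 = 3 then (encWord x).getD (a / 8) 0 else if a % 8 = 5 then l.getD (a / 8) 0 else 0

def setupStart : List Line := [.prim (.const 24 4), .prim (.const 56 3), .prim (.const 32 5)]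

def scanPre : List Line := .prim (.read 0 48) :: testLines

def scanBody : List Line := [.prim (.store 56 0), .prim (.store 32 0), .prim (.const 16 8),
  .prim (.add 56 56 16), .prim (.add 32 32 16), .prim (.const 16 1), .prim (.add 48 48 16)]

/-- Copies the input word to the arrays `3` and `5`. -/
def scanCmds : List Cmd := [.lines setupStart, .loop scanPre 16 scanBody]

theorem evRegs_scanPre (I : List ℤ) {r : ℕ → ℤ} {i : ℕ} (h : r 48 = i) :
    evRegs I scanPre r = Function.update (Function.update (Function.update (Function.update r 0
      (I.getD i 0)) 72 1) 8 (I.getD i 0 - 3)) 16 (symbolTest (I.getD i 0)) := by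
  rw [scanPre, evRegs, evRegs_testLines]
  simp only [Line.evReg, Instr.evReg, h, Int.toNat_natCast, Function.update_self]

theorem evRegs_scanBody (I : List ℤ) {r : ℕ → ℤ} {i : ℕ} (h : r 48 = i)
    (h' : r 56 = (8 * i + 3 : ℕ)) (h'' : r 32 = (8 * i + 5 : ℕ)) : evRegs I scanBody r =
      Function.update (Function.update (Function.update (Function.update (Function.update
        (Function.update r (8 * i + 3) (r 0)) (8 * i + 5) (r 0)) 16 1) 56 (8 * (i + 1) + 3 : ℕ))
        32 (8 * (i + 1) + 5 : ℕ)) 48 (i + 1 : ℕ) := by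
  have e3 : ∀ k, k % 8 = 0 → k ≠ 8 * i + 3 := by intro k hk; omega
  have e5 : ∀ k, k % 8 = 0 → k ≠ 8 * i + 5 := by intro k hk; omega
  have e1 : ((i + 1 : ℕ) : ℤ) = r 48 + 1 := by rw [h]; push_cast; ring
  have e2 : ((8 * (i + 1) + 3 : ℕ) : ℤ) = r 56 + 8 := by rw [h']; push_cast; ring
  have e4 : ((8 * (i + 1) + 5 : ℕ) : ℤ) = r 32 + 8 := by rw [h'']; push_cast; ring
  rw [e1, e2, e4]
  have h3 : (r 56).toNat = 8 * i + 3 := by rw [h', Int.toNat_natCast]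
  have h5 : (r 32).toNat = 8 * i + 5 := by rw [h'', Int.toNat_natCast]
  ext a
  simp only [scanBody, evRegs, Line.evReg, Instr.evReg, h3]
  rw [Function.update_of_ne (e3 32 (by omega)), h5]
  simp [Function.update_apply, e3, e5]
  by_cases h16 : a = 16
  · simp [h16]
  · simp [h16]

/-- Two copies of `x` are made: the array `3` is the input of the generator, and the array `5` will
become the input pair of the decision program once the reference word is appended. -/
theorem runs_scan {x : Word} {ε : ℚ} {b : ℕ} (hb : 8 * x.length + ratSize ε + 30 ≤ b) :
    ∃ c', Runs (encWordRat x ε) scanCmds init c' ∧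
      (∀ a, a ∉ scratch → a ≠ 24 → a ≠ 32 → c'.reg a =
        if (a % 8 = 3 ∨ a % 8 = 5) then (encWord x).getD (a / 8) 0 else 0) ∧
      c'.reg 24 = 4 ∧ c'.reg 32 = (8 * x.length + 5 : ℕ) ∧ c'.reg 48 = x.length ∧
      c'.out = 0 ∧ c'.outputs = [] ∧ MaxBits (2 ^ 12 * b) c'.reg ∧
      c'.time ≤ (x.length + 1) * (8 ^ 20 * b) := by
  set I := encWordRat x ε with hI'
  have hI : ∀ v ∈ I, bits v ≤ ratSize ε + 2 := bits_encWordRat_le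
  have h4 : 4 ≤ b := by omega
  have himm : ∀ l ∈ scanPre ++ scanBody, l.imm (ratSize ε + 2) ≤ b := by
    have : ∀ l ∈ testLines ++ scanBody, l.imm (ratSize ε + 2) ≤ 4 := by
      simp only [testLines, scanBody, List.cons_append, List.nil_append, List.mem_cons,
        List.not_mem_nil, or_false, forall_eq_or_imp, forall_eq, Line.imm]
      decide
    intro l hl
    simp only [scanPre, List.cons_append, List.mem_cons] at hl
    rcases hl with rfl | hl
    · simp only [Line.imm]; omega
    · exact (this l hl).trans h4
  have hreg₁ : ⇑(effLines I setupStart init).reg = Function.update (Function.update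
      (Function.update (fun _ => 0) 24 4) 56 3) 32 5 := by
    rw [effLines_reg, setupStart]
    rfl
  set Inv : ℕ → Config → Prop := fun k c' => ∃ i, i + k = x.length ∧ c'.reg 48 = (i : ℕ) ∧
    c'.reg 56 = (8 * i + 3 : ℕ) ∧ c'.reg 32 = (8 * i + 5 : ℕ) ∧ c'.reg 24 = 4 ∧
    (∀ a, a ∉ scratch → a ≠ 24 → a ≠ 32 → c'.reg a =
      if (a % 8 = 3 ∨ a % 8 = 5) ∧ a / 8 < i then (encWord x).getD (a / 8) 0 else 0) ∧
    MaxBits b c'.reg ∧ c'.out = 0 ∧ c'.outputs = [] with hInv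
  obtain ⟨c₀, t, ⟨i, hi, h48, h56, h32, h24, hreg, hbits, hout, houts⟩, hruns, ht⟩ :=
    Runs.loop (b := b) (pre := scanPre) (body := scanBody) (i := 16) hI rfl rfl
      (by simp [scanBody]) (by omega) himm Inv (fun _ _ _ h => h)
      (fun _ _ ⟨_, _, _, _, _, _, _, h, _⟩ => h)
      (by
        rintro k c' ⟨i, hi, h48, h56, h32, h24, hreg, hbits, hout, houts⟩
        have hpre := evRegs_scanPre I h48
        rw [hI', encWordRat_getD (by omega), ← hI'] at hpre
        set v := (encWord x).getD i 0 with hvdef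
        have hvr := encWord_getD_range (w := x) i
        rw [← hvdef] at hvr
        have hsy : symbolOf v ≠ none := by
          rw [hvdef, symbolOf_encWord_getD, List.getElem?_eq_getElem (by omega)]; simp
        have hstep : evRegs I (scanPre ++ scanBody) c'.reg = Function.update (Function.update
            (Function.update (Function.update (Function.update (Function.update (Function.update
            (Function.update (Function.update (Function.update c'.reg 0 v) 72 1) 8 (v - 3)) 16
            (symbolTest v)) (8 * i + 3) v) (8 * i + 5) v) 16 1) 56 (8 * (i + 1) + 3 : ℕ))
            32 (8 * (i + 1) + 5 : ℕ)) 48 (i + 1 : ℕ) := by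
          rw [evRegs_append, hpre, evRegs_scanBody I (i := i)]
          · simp
          · simpa using h48
          · simpa using h56
          · simpa using h32
        refine ⟨?_, i + 1, by omega, ?_, ?_, ?_, ?_, ?_, ?_, ?_, ?_⟩
        · rw [hpre, Function.update_self, symbolTest_neg]
          exact hsy
        all_goals try rw [effLines_reg, hstep]
        · simp
        · simp
        · simp
        · rw [← h24]
          rw [Function.update_of_ne (by omega), Function.update_of_ne (by omega),
            Function.update_of_ne (by omega), Function.update_of_ne (by omega),
            Function.update_of_ne (by omega), Function.update_of_ne (by omega),
            Function.update_of_ne (by omega), Function.update_of_ne (by omega),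
            Function.update_of_ne (by omega), Function.update_of_ne (by omega)]
        · intro a ha h24 h32
          have hne : ∀ k, k ∈ scratch → a ≠ k := fun k hk h => ha (h ▸ hk)
          rw [Function.update_of_ne (hne 48 (by decide)), Function.update_of_ne h32,
            Function.update_of_ne (hne 56 (by decide)), Function.update_of_ne (hne 16 (by decide))]
          by_cases h5 : a = 8 * i + 5
          · rw [h5, Function.update_self, if_pos (by omega), hvdef]
            congr 1; omega
          rw [Function.update_of_ne h5]
          by_cases h3 : a = 8 * i + 3
          · rw [h3, Function.update_self, if_pos (by omega), hvdef]
            congr 1; omega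
          rw [Function.update_of_ne h3, Function.update_of_ne (hne 16 (by decide)),
            Function.update_of_ne (hne 8 (by decide)), Function.update_of_ne (hne 72 (by decide)),
            Function.update_of_ne (hne 0 (by decide)), hreg a ha h24 h32]
          by_cases hc : (a % 8 = 3 ∨ a % 8 = 5) ∧ a / 8 < i
          · rw [if_pos hc, if_pos (by omega)]
          · rw [if_neg hc, if_neg (by omega)]
        · have hsmall : ∀ y : ℤ, y.natAbs ≤ 9 → bits y ≤ b := fun y hy =>
            ((bits_mono (y := 9) hy).trans (by decide : bits 9 ≤ 4)).trans h4
          have hst : bits (symbolTest v) ≤ b := by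
            rw [Ne, symbolOf_eq_none] at hsy
            have : v = 1 ∨ v = 2 ∨ v = 3 := by omega
            refine le_trans ?_ h4
            rcases this with h | h | h <;> rw [h] <;> decide
          have hnat : ∀ m : ℕ, m ≤ b → bits (m : ℤ) ≤ b := fun m hm =>
            (bits_natCast_le_self m).trans hm
          refine (((((((((hbits.update (hsmall _ ?_)).update (hsmall _ ?_)).update
            (hsmall _ ?_)).update hst).update (hsmall _ ?_)).update (hsmall _ ?_)).update
            (hsmall _ ?_)).update (hnat _ ?_)).update (hnat _ ?_)).update (hnat _ ?_)
          all_goals omega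
        · rw [effLines_out _ (by rfl), hout]
        · rw [effLines_outputs _ (by rfl), houts])
      (by
        rintro c' ⟨i, hi, h48, -⟩
        rw [evRegs_scanPre I h48, Function.update_self, ← not_lt, symbolTest_neg, not_not, hI',
          encWordRat_getD (by omega), symbolOf_encWord_getD, List.getElem?_eq_none (by omega)])
      (r := x.length) (c := effLines I setupStart init)
      ⟨0, by omega, by rw [hreg₁]; simp, by rw [hreg₁]; simp, by rw [hreg₁]; simp,
        by rw [hreg₁]; simp, fun a ha h24 h32 => by
        have hne : ∀ k, k ∈ scratch → a ≠ k := fun k hk h => ha (h ▸ hk)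
        rw [hreg₁, Function.update_of_ne h32, Function.update_of_ne (hne 56 (by decide)),
          Function.update_of_ne h24, if_neg (by omega)],
        by
          rw [hreg₁]
          have h0 : MaxBits b (fun _ => 0) := fun a => by simp
          exact ((h0.update ((by decide : bits 4 ≤ 4).trans h4)).update
            ((by decide : bits 3 ≤ 4).trans h4)).update ((by decide : bits 5 ≤ 4).trans h4),
        by rw [effLines_out _ (by rfl)]; rfl,
        by rw [effLines_outputs _ (by rfl)]; rfl⟩
  have hi' : i = x.length := by omega
  subst hi'
  have hpre := evRegs_scanPre I h48
  refine ⟨_, (Runs.lines (ls := setupStart) rfl init).cons hruns, fun a ha ha24 ha32 => ?_, ?_, ?_,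
    ?_, ?_, ?_, ?_, ?_⟩
  · have hne : ∀ k, k ∈ scratch → a ≠ k := fun k hk h => ha (h ▸ hk)
    rw [Config.withTime_reg, effLines_reg, hpre, Function.update_of_ne (hne 16 (by decide)),
      Function.update_of_ne (hne 8 (by decide)), Function.update_of_ne (hne 72 (by decide)),
      Function.update_of_ne (hne 0 (by decide)), hreg a ha ha24 ha32]
    by_cases hlt : a / 8 < x.length
    · simp only [hlt, and_true]
    · rw [List.getD_eq_default _ _ (by simpa using hlt)]; simp
  · rw [Config.withTime_reg, effLines_reg, hpre]; simp [h24]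
  · rw [Config.withTime_reg, effLines_reg, hpre]; simp [h32]
  · rw [Config.withTime_reg, effLines_reg, hpre]; simp [h48]
  · rw [Config.withTime_out, effLines_out _ (by rfl), hout]
  · rw [Config.withTime_outputs, effLines_outputs _ (by rfl), houts]
  · have h1 := maxBits_effLines (ls := scanPre) hI rfl hbits (by omega)
      fun l hl => himm l (List.mem_append_left _ hl)
    have e1 : scanPre.length = 12 := rfl
    rw [e1] at h1
    exact h1
  · have h0 : MaxBits b init.reg := fun a => by simp [init]
    have h1 := time_effLines_le (I := I) (ls := setupStart) (c := init) hI rfl h0 (by omega)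
      (by
        simp only [setupStart, List.mem_cons, List.not_mem_nil, or_false, forall_eq_or_imp,
          forall_eq, Line.imm]
        exact ⟨(by decide : bits 4 ≤ 4).trans h4, (by decide : bits 3 ≤ 4).trans h4,
          (by decide : bits 5 ≤ 4).trans h4⟩)
    have e1 : setupStart.length = 3 := rfl
    have e2 : (scanPre ++ scanBody).length = 19 := rfl
    have e3 : init.time = 0 := rfl
    rw [e1, e3] at h1
    rw [e2] at ht
    simp only [Config.withTime_time]
    have h2 : 8 ^ 19 * b + 2 + 8 ^ 3 * b ≤ 8 ^ 20 * b := by omega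
    have h3 := Nat.mul_le_mul_left (x.length + 1) h2
    rw [mul_add (x.length + 1) _ (8 ^ 3 * b)] at h3
    have : 8 ^ 3 * b ≤ (x.length + 1) * (8 ^ 3 * b) := Nat.le_mul_of_pos_left _ (by omega)
    omega

/-! ### The precision and the initial value of the counter -/

/-- The least `i` such that `1 ≤ ε * 2 ^ i`. -/
noncomputable def precision (ε : ℚ) : ℕ := sInf {i | (ε.den : ℤ) ≤ ε.num * 2 ^ i}

theorem den_le_of_ratSize {ε : ℚ} (h : 0 < ε) : (ε.den : ℤ) ≤ ε.num * 2 ^ ratSize ε := by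
  have h1 : 1 ≤ ε.num := Rat.num_pos.2 h
  have h2 : ε.den < 2 ^ ratSize ε := by
    have : bits (ε.den : ℤ) ≤ ratSize ε := by unfold ratSize; omega
    simpa using bits_le_iff.1 this
  have h3 : (ε.den : ℤ) < 2 ^ ratSize ε := by exact_mod_cast h2
  nlinarith

theorem precision_le {ε : ℚ} (h : 0 < ε) : precision ε ≤ ratSize ε :=
  Nat.sInf_le (den_le_of_ratSize h)

theorem den_le_precision {ε : ℚ} (h : 0 < ε) : (ε.den : ℤ) ≤ ε.num * 2 ^ precision ε :=
  Nat.sInf_mem (s := {i | (ε.den : ℤ) ≤ ε.num * 2 ^ i}) ⟨_, den_le_of_ratSize h⟩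

theorem lt_den_of_lt_precision {ε : ℚ} {i : ℕ} (h : i < precision ε) :
    ε.num * 2 ^ i < ε.den := not_le.1 (Nat.notMem_of_lt_sInf h)

/-- `R 32` moves past the separator after `x`. Starting from `R 48 = x.length`, the lines leave
`x.length + 1` in `R 0`, the numerator of `ε` in `R 64`, its denominator in `R 80` and `1` in `R
40`. -/
def setupMid : List Line := [.prim (.const 16 8), .prim (.add 32 32 16), .prim (.const 16 1),
  .prim (.add 48 48 16), .prim (.copy 0 48), .prim (.read 64 48), .prim (.add 48 48 16),
  .prim (.read 80 48), .prim (.const 40 1)]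

/-- With `doubleBody`, this doubles `R 64` and `R 40` as long as the numerator is less than the
denominator, so that `R 40` ends up as `2 ^ precision ε` without any division. -/
def doublePre : List Line := [.prim (.sub 16 64 80)]

def doubleBody : List Line := [.prim (.add 64 64 64), .prim (.add 40 40 40)]

/-- `R 40 := R 40 ^ 2 * C * R 0 ^ d` -/
def setupEnd (C d : ℕ) : List Line := [.prim (.mul 40 40 40), .prim (.const 72 C),
  .prim (.mul 40 40 72)] ++ List.replicate d (.prim (.mul 40 40 0))

/-- Copies the input and computes the initial value of the counter. -/
def setupCmds (C d : ℕ) : List Cmd :=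
  scanCmds ++ [.lines setupMid, .loop doublePre 16 doubleBody, .lines (setupEnd C d ++ zeroLines)]

theorem evRegs_setupEnd (I : List ℤ) (C d : ℕ) (r : ℕ → ℤ) : evRegs I (setupEnd C d) r =
    Function.update (Function.update r 72 C) 40 (r 40 * r 40 * C * r 0 ^ d) := by
  have key : ∀ (d : ℕ) (r : ℕ → ℤ), evRegs I (List.replicate d (.prim (.mul 40 40 0))) r =
      Function.update r 40 (r 40 * r 0 ^ d) := by
    intro d
    induction d with
    | zero => intro r; simp [evRegs]
    | succ d ih =>
      intro r
      rw [List.replicate_succ, evRegs, ih]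
      simp only [Line.evReg, Instr.evReg, Function.update_self, Function.update_idem,
        Function.update_of_ne (show (0 : ℕ) ≠ 40 by omega)]
      rw [pow_succ]; congr 1; ring
  rw [setupEnd, evRegs_append, key]
  ext a
  simp only [evRegs, Line.evReg, Instr.evReg, Function.update_apply]
  by_cases h : a = 40 <;> simp [h]

theorem straight_setupEnd (C d : ℕ) : (setupEnd C d ++ zeroLines).all Line.straight := by
  simp only [setupEnd, List.all_append, List.all_replicate]
  cases d <;> rfl

theorem silent_setupEnd (C d : ℕ) : (setupEnd C d ++ zeroLines).all Line.silent := by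
  simp only [setupEnd, List.all_append, List.all_replicate]
  cases d <;> rfl

/-- The scan and the doubling loop make at most about `b` rounds, each of cost linear in `b`, hence
the factor `b * b`. The exponent `d` and the length of the code do not depend on the input. -/
theorem runs_setup {x : Word} {ε : ℚ} (hε : 0 < ε) (C d : ℕ) {b : ℕ}
    (hb : 8 * x.length + ratSize ε + C + 40 ≤ b) :
    ∃ c', Runs (encWordRat x ε) (setupCmds C d) init c' ∧
      ⇑c'.reg = baseReg x (encWord x)
        (C * (x.length + 1) ^ d * (2 ^ precision ε) ^ 2 : ℕ) ∧
      c'.out = 0 ∧ c'.outputs = [] ∧ c'.time ≤ 8 ^ (d + 50) * (b * b) := by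
  obtain ⟨c₁, hruns₁, hfr, h24, h32, h48, hout₁, houts₁, hbits₁, ht₁⟩ :=
    runs_scan (x := x) (ε := ε) (b := b) (by omega)
  set I := encWordRat x ε with hI'
  have hI : ∀ v ∈ I, bits v ≤ ratSize ε + 2 := bits_encWordRat_le
  set n := x.length with hn
  have hnum : 1 ≤ ε.num := Rat.num_pos.2 hε
  -- after `setupMid`
  set c₂ := effLines I setupMid c₁ with hc₂
  have hreg₂ : ⇑c₂.reg = Function.update (Function.update (Function.update (Function.update
      (Function.update (Function.update (Function.update c₁.reg 16 1) 32 (8 * (n + 1) + 5 : ℕ))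
        0 (n + 1 : ℕ)) 64 ε.num) 48 (n + 2 : ℕ)) 80 ε.den) 40 1 := by
    have e1 : ((n : ℤ) + 1).toNat = n + 1 := by omega
    have e2 : ((n : ℤ) + 1 + 1).toNat = n + 2 := by omega
    have e3 : I[n + 1]?.getD 0 = ε.num := by
      rw [← List.getD_eq_getElem?_getD]; exact encWordRat_getD_num x ε
    have e4 : I[n + 2]?.getD 0 = ε.den := by
      rw [← List.getD_eq_getElem?_getD]; exact encWordRat_getD_den x ε
    rw [hc₂, effLines_reg]
    ext a
    simp [setupMid, evRegs, Line.evReg, Instr.evReg, Function.update_apply, h48, h32, e1, e2, e3,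
      e4]
    by_cases h16 : a = 16
    · simp [h16]
    by_cases h48 : a = 48
    · simp [h48]; ring
    by_cases h32 : a = 32
    · simp [h32]; ring
    simp [h16, h48, h32]
  have himm₂ : ∀ l ∈ setupMid, l.imm (ratSize ε + 2) ≤ 2 ^ 12 * b := by
    have e8 : bits 8 = 4 := by decide
    have e1 : bits 1 = 1 := by decide
    simp only [setupMid, List.mem_cons, List.not_mem_nil, or_false, forall_eq_or_imp, forall_eq,
      Line.imm, e8, e1]
    omega
  have hbits₂ : MaxBits (2 ^ 9 * (2 ^ 12 * b)) c₂.reg := by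
    have h1 := maxBits_effLines (ls := setupMid) hI rfl hbits₁ (by omega) himm₂
    have e1 : setupMid.length = 9 := rfl
    rw [e1] at h1
    exact h1
  have ht₂ : c₂.time ≤ c₁.time + 8 ^ 9 * (2 ^ 12 * b) := by
    have h1 := time_effLines_le (ls := setupMid) hI rfl hbits₁ (by omega) himm₂
    have e1 : setupMid.length = 9 := rfl
    rw [e1] at h1
    exact h1
  have hk := precision_le hε
  have hden : bits (ε.den : ℤ) ≤ ratSize ε := by unfold ratSize; omega
  have hnumb : bits ε.num ≤ ratSize ε := by unfold ratSize; omega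
  -- the loop
  set b' := 2 ^ 9 * (2 ^ 12 * b) with hb'
  obtain ⟨c₃, t, ⟨i, hi, h64, h40, hfr₃, hbits₃, hout₃, houts₃⟩, hruns₃, ht₃⟩ :=
    Runs.loop (b := b') (pre := doublePre) (body := doubleBody) (i := 16) hI rfl rfl
      (by simp [doubleBody]) (by omega) (by simp [doublePre, doubleBody, Line.imm])
      (fun k c' => ∃ i, i + k = precision ε ∧ c'.reg 64 = ε.num * 2 ^ i ∧ c'.reg 40 = 2 ^ i ∧
        (∀ a, a ≠ 16 → a ≠ 64 → a ≠ 40 → c'.reg a = c₂.reg a) ∧ MaxBits b' c'.reg ∧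
        c'.out = c₂.out ∧ c'.outputs = c₂.outputs)
      (fun _ _ _ h => h) (fun _ _ ⟨_, _, _, _, _, h, _⟩ => h)
      (by
        rintro k c' ⟨i, hi, h64, h40, hfr₃, hbits₃, hout₃, houts₃⟩
        have hlt := lt_den_of_lt_precision (ε := ε) (i := i) (by omega)
        have h80 : c'.reg 80 = ε.den := by
          rw [hfr₃ 80 (by omega) (by omega) (by omega), hreg₂]; simp
        have hstep : evRegs I (doublePre ++ doubleBody) c'.reg = Function.update (Function.update
            (Function.update c'.reg 16 (ε.num * 2 ^ i - ε.den)) 64 (ε.num * 2 ^ (i + 1))) 40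
            (2 ^ (i + 1)) := by
          ext a
          simp [doublePre, doubleBody, evRegs, Line.evReg, Instr.evReg, Function.update_apply, h64,
            h40, h80]
          rw [show (2 : ℤ) ^ i + 2 ^ i = 2 ^ (i + 1) by ring,
            show ε.num * (2 : ℤ) ^ i + ε.num * 2 ^ i = ε.num * 2 ^ (i + 1) by ring]
        have hpos : (0 : ℤ) < 2 ^ i := by positivity
        refine ⟨?_, i + 1, by omega, ?_, ?_, ?_, ?_, ?_, ?_⟩
        · simp [doublePre, evRegs, Line.evReg, Instr.evReg, h64, h80]
          exact hlt
        · rw [effLines_reg, hstep]; simp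
        · rw [effLines_reg, hstep]; simp
        · intro a h1 h2 h3
          rw [effLines_reg, hstep, Function.update_of_ne h3, Function.update_of_ne h2,
            Function.update_of_ne h1, hfr₃ a h1 h2 h3]
        · rw [effLines_reg, hstep]
          have hden0 : ε.num * 2 ^ i ≥ 0 := by positivity
          -- While the loop runs, the scaled numerator is less than the denominator, so all these
          -- values fit into the size of `ε` and one more bit.
          have hb1 : bits (ε.num * 2 ^ i - ε.den) ≤ ratSize ε :=
            le_trans (bits_mono (by omega)) hden
          have hb2 : bits (ε.num * 2 ^ (i + 1)) ≤ ratSize ε + 1 := by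
            have : ε.num * 2 ^ (i + 1) = ε.num * 2 ^ i + ε.num * 2 ^ i := by ring
            rw [this]
            have h1 := bits_add_le (ε.num * 2 ^ i) (ε.num * 2 ^ i)
            have h2 : bits (ε.num * 2 ^ i) ≤ ratSize ε := le_trans (bits_mono (by omega)) hden
            omega
          have hb3 : bits (2 ^ (i + 1)) ≤ i + 2 := by
            rw [bits_le_iff, Int.natAbs_pow]
            exact Nat.pow_lt_pow_right (by norm_num) (by omega)
          exact ((hbits₃.update (by omega)).update (by omega)).update (by omega)
        · rw [effLines_out _ (by rfl), hout₃]
        · rw [effLines_outputs _ (by rfl), houts₃])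
      (by
        rintro c' ⟨i, hi, h64, h40, hfr₃, -⟩
        have h80 : c'.reg 80 = ε.den := by
          rw [hfr₃ 80 (by omega) (by omega) (by omega), hreg₂]; simp
        have := den_le_precision hε
        rw [← hi, add_zero] at this
        simp [doublePre, evRegs, Line.evReg, Instr.evReg, h64, h80]
        exact this)
      (r := precision ε) (c := c₂)
      ⟨0, by omega, by rw [hreg₂]; simp, by rw [hreg₂]; simp, fun _ _ _ _ => rfl, hbits₂, rfl, rfl⟩
  have hi' : i = precision ε := by omega
  subst hi'
  set c₄ := (effLines I doublePre c₃).withTime t with hc₄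
  have hreg₄ : ∀ a, a ≠ 16 → c₄.reg a = c₃.reg a := by
    intro a ha
    rw [hc₄, Config.withTime_reg, effLines_reg]
    simp [doublePre, evRegs, Line.evReg, Instr.evReg, ha]
  have hbits₄ : MaxBits (2 * b') c₄.reg :=
    maxBits_effLines (ls := doublePre) hI rfl hbits₃ (by omega) (by simp [doublePre, Line.imm])
  have himm₄ : ∀ l ∈ setupEnd C d ++ zeroLines, l.imm (ratSize ε + 2) ≤ 2 * b' := by
    intro l hl
    simp only [setupEnd, zeroLines, List.mem_append, List.mem_cons, List.not_mem_nil, or_false,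
      List.mem_replicate, List.mem_map] at hl
    have hC := bits_natCast_le_self C
    rcases hl with ((rfl | rfl | rfl) | ⟨-, rfl⟩) | ⟨i, -, rfl⟩ <;> simp only [Line.imm] <;>
      try omega
    simp
  refine ⟨_, hruns₁.append ((Runs.lines (ls := setupMid) rfl c₁).cons (hruns₃.cons
    (Runs.lines (straight_setupEnd C d) c₄))), ?_, ?_, ?_, ?_⟩
  · ext a
    rw [effLines_reg, evRegs_append, evRegs_zeroLines, evRegs_setupEnd]
    have h40' : c₄.reg 40 = 2 ^ precision ε := by rw [hreg₄ _ (by omega), h40]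
    have h0' : c₄.reg 0 = (n + 1 : ℕ) := by
      rw [hreg₄ _ (by omega), hfr₃ _ (by omega) (by omega) (by omega), hreg₂]; simp
    by_cases ha : a ∈ scratch
    · rw [if_pos ha, baseReg]
      have h8 : a % 8 = 0 := by revert a; decide
      have h1 : a ≠ 24 ∧ a ≠ 32 ∧ a ≠ 40 := by
        refine ⟨?_, ?_, ?_⟩ <;> rintro rfl <;> simp [scratch] at ha
      rw [if_neg h1.1, if_neg h1.2.1, if_neg h1.2.2, if_neg (by omega), if_neg (by omega)]
    · rw [if_neg ha]
      have hne : ∀ k, k ∈ scratch → a ≠ k := fun k hk h => ha (h ▸ hk)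
      by_cases ha40 : a = 40
      · rw [ha40, Function.update_self, h40', h0']
        simp only [baseReg]
        rw [if_neg (by omega), if_neg (by omega), if_pos trivial]
        push_cast; ring
      rw [Function.update_of_ne ha40, Function.update_of_ne (hne 72 (by decide)),
        hreg₄ a (hne 16 (by decide)), hfr₃ a (hne 16 (by decide)) (hne 64 (by decide)) ha40, hreg₂,
        Function.update_of_ne ha40, Function.update_of_ne (hne 80 (by decide)),
        Function.update_of_ne (hne 48 (by decide)), Function.update_of_ne (hne 64 (by decide)),
        Function.update_of_ne (hne 0 (by decide))]
      by_cases ha32 : a = 32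
      · rw [ha32, Function.update_self]; simp [baseReg, hn]
      rw [Function.update_of_ne ha32, Function.update_of_ne (hne 16 (by decide))]
      by_cases ha24 : a = 24
      · rw [ha24, h24]; simp [baseReg]
      rw [hfr a ha ha24 ha32, baseReg, if_neg ha24, if_neg ha32, if_neg ha40]
      split_ifs <;> first | rfl | omega
  · rw [effLines_out _ (silent_setupEnd C d), hc₄, Config.withTime_out, effLines_out _ (by rfl),
      hout₃, hc₂, effLines_out _ (by rfl), hout₁]
  · rw [effLines_outputs _ (silent_setupEnd C d), hc₄, Config.withTime_outputs,
      effLines_outputs _ (by rfl), houts₃, hc₂, effLines_outputs _ (by rfl), houts₁]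
  · have h5 := time_effLines_le (c := c₄) hI (straight_setupEnd C d) hbits₄ (by omega) himm₄
    have e1 : (setupEnd C d ++ zeroLines).length = d + 12 := by
      simp [setupEnd, zeroLines, scratch]
    have e2 : (doublePre ++ doubleBody).length = 3 := rfl
    have e3 : c₄.time = t := rfl
    rw [e1, e3] at h5
    rw [e2] at ht₃
    have hbb : b ≤ b * b := Nat.le_mul_self b
    have h6 : (n + 1) * (8 ^ 20 * b) ≤ 8 ^ 20 * (b * b) := by
      rw [show 8 ^ 20 * (b * b) = b * (8 ^ 20 * b) by ring]
      exact Nat.mul_le_mul_right _ (by omega)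
    have h7 : (precision ε + 1) * (8 ^ 3 * b' + 2) ≤ 8 ^ 20 * (b * b) := by
      rw [show 8 ^ 20 * (b * b) = b * (8 ^ 20 * b) by ring]
      exact Nat.mul_le_mul (by omega) (by omega)
    have h8 : 8 ^ (d + 12) * (2 * b') ≤ 8 ^ (d + 12) * (2 ^ 22 * (b * b)) :=
      Nat.mul_le_mul_left _ (by omega)
    have h9 : 8 ^ (d + 50) * (b * b) = 8 ^ (d + 12) * (8 ^ 38 * (b * b)) := by ring
    have h10 : 1 ≤ 8 ^ (d + 12) := Nat.one_le_pow _ _ (by norm_num)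
    have h11 : 8 ^ (d + 12) * (2 ^ 22 * (b * b)) + 1 * (8 ^ 30 * (b * b)) ≤
        8 ^ (d + 12) * (8 ^ 38 * (b * b)) := by
      calc _ ≤ 8 ^ (d + 12) * (2 ^ 22 * (b * b)) + 8 ^ (d + 12) * (8 ^ 30 * (b * b)) :=
            Nat.add_le_add_left (Nat.mul_le_mul_right _ h10) _
        _ = 8 ^ (d + 12) * (2 ^ 22 * (b * b) + 8 ^ 30 * (b * b)) := by ring
        _ ≤ _ := Nat.mul_le_mul_left _ (by omega)
    omega

/-! ### The stages of the enumeration machine -/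

theorem IsLog.congr {lg : List ℕ} {r r' : ℕ → ℤ} (h : IsLog lg r)
    (h' : ∀ a, a = 24 ∨ a % 8 = 1 ∨ a % 8 = 2 ∨ a % 8 = 4 → r' a = r a) : IsLog lg r' where
  ptr := by rw [h' _ (by omega), h.ptr]
  entry i := by rw [h' _ (by omega), h.entry]
  mod := h.mod
  mem a ha hr := h.mem a ha (by rwa [h' _ (by omega)] at hr)

theorem Runs.time_le {I : List ℤ} {ss : List Cmd} {c c' : Config} (h : Runs I ss c c') :
    c.time ≤ c'.time :=
  (h (codeCmds 0 ss) 0 fun i hi => by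
    rw [Nat.zero_add, List.getElem?_eq_getElem hi]).time_le

theorem mod_of_mem_scratch : ∀ k, k ∈ scratch → k % 8 = 0 := by decide

theorem baseReg_of_mod {x : Word} {l : List ℤ} {K : ℤ} {a : ℕ}
    (h : a % 8 = 1 ∨ a % 8 = 2 ∨ a % 8 = 4) : baseReg x l K a = 0 := by
  rw [baseReg, if_neg (by omega), if_neg (by omega), if_neg (by omega), if_neg (by omega),
    if_neg (by omega)]

theorem baseReg_of_mem_scratch {x : Word} {l : List ℤ} {K : ℤ} {a : ℕ} (h : a ∈ scratch) :
    baseReg x l K a = 0 := by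
  have h8 := mod_of_mem_scratch a h
  have h1 : a ≠ 24 ∧ a ≠ 32 ∧ a ≠ 40 := by
    refine ⟨?_, ?_, ?_⟩ <;> rintro rfl <;> simp [scratch] at h
  rw [baseReg, if_neg h1.1, if_neg h1.2.1, if_neg h1.2.2, if_neg (by omega), if_neg (by omega)]

theorem maxBits_baseReg {x : Word} {l : List ℤ} {K : ℤ} {b : ℕ} (hl : ∀ v ∈ l, bits v ≤ 2)
    (hK : bits K ≤ b) (hx : 8 * x.length + 13 ≤ b) : MaxBits b (baseReg x l K) := by
  intro a
  unfold baseReg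
  split_ifs
  · exact (by decide : bits 4 ≤ 3).trans (by omega)
  · exact (bits_natCast_le_self _).trans (by omega)
  · exact hK
  · exact (bits_getD_le bits_encWord_le _).trans (by omega)
  · exact (bits_getD_le hl _).trans (by omega)
  · simp

theorem cleaned_eq_baseReg {x : Word} {l : List ℤ} {K : ℤ} {r : ℕ → ℤ}
    (h : ∀ a, a ∉ scratch → a ≠ 24 → a % 8 ≠ 1 → a % 8 ≠ 2 → a % 8 ≠ 4 → r a = baseReg x l K a) :
    cleaned r = baseReg x l K := by
  ext a
  unfold cleaned
  split_ifs with h1 h2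
  · rcases h1 with h1 | h1 | h1 | h1
    · exact (baseReg_of_mod (.inl h1)).symm
    · exact (baseReg_of_mod (.inr (.inl h1))).symm
    · exact (baseReg_of_mod (.inr (.inr h1))).symm
    · exact (baseReg_of_mem_scratch h1).symm
  · rw [h2]; rfl
  · push Not at h1
    exact h a h1.2.2.2 h2 h1.1 h1.2.1 h1.2.2.1

/-- The registers of `m` are `baseReg x l K`, up to scratch registers. -/
def HasBase (x : Word) (l : List ℤ) (K : ℤ) (m : Config) : Prop :=
  ∀ a, a ∉ scratch → m.reg a = baseReg x l K a

theorem HasBase.of_eq {x : Word} {l : List ℤ} {K : ℤ} {m : Config}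
    (h : ⇑m.reg = baseReg x l K) : HasBase x l K m := fun a _ => by rw [h]

/-- Erased memory represents the initial configuration with an empty log, which is why each stage
ends with `cleanCmds`. -/
theorem HasBase.sim {x : Word} {l : List ℤ} {K : ℤ} {m₀ : Config} (h : HasBase x l K m₀)
    {β : ℕ} (Q : ℕ) (hb : MaxBits β m₀.reg) : Sim β Q m₀ init m₀ where
  reg i := by
    rw [h _ fun h => by have := mod_of_mem_scratch _ h; omega, baseReg_of_mod (by omega)]; rfl
  reg_out i := by
    rw [h _ fun h => by have := mod_of_mem_scratch _ h; omega, baseReg_of_mod (by omega)]; rfl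
  frame _ _ _ _ _ _ _ _ := rfl
  out := rfl
  outputs := rfl
  grow := ⟨le_rfl, fun a => by simp [init], fun a => by simp [init], by simp [init],
    by simp [init]⟩
  maxBits := hb.mono (by omega)
  time := by simp [init]
  log := by
    refine ⟨[], ⟨?_, fun i => ?_, by simp, fun a ha hr => ?_⟩, by simp⟩
    · rw [h _ (by decide)]; rfl
    · rw [h _ fun h => by have := mod_of_mem_scratch _ h; omega, baseReg_of_mod (by omega)]; rfl
    · rw [h _ fun h => by have := mod_of_mem_scratch _ h; omega, baseReg_of_mod (by omega)] at hr
      exact absurd rfl hr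

theorem Sim.frame_base {x : Word} {l : List ℤ} {K : ℤ} {β Q : ℕ} {m₀ g m : Config}
    (hS : Sim β Q m₀ g m) (h : HasBase x l K m₀) {a : ℕ} (ha : a ∉ scratch) (h24 : a ≠ 24)
    (h1 : a % 8 ≠ 1) (h2 : a % 8 ≠ 2) (h4 : a % 8 ≠ 4) : m.reg a = baseReg x l K a := by
  have hne : ∀ k, k ∈ scratch → a ≠ k := fun k hk h => ha (h ▸ hk)
  rw [hS.frame a h1 h2 h4 (hne 0 (by decide)) (hne 8 (by decide)) (hne 16 (by decide)) h24, h a ha]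

theorem Sim.wordAt {β Q : ℕ} {m₀ g m : Config} (hS : Sim β Q m₀ g m) :
    WordAt (outWord g.out) fun i => m.reg (8 * i + 2) := by
  simp only [hS.reg_out]; exact wordAt_outWord g.out

/-- Each nonzero output register was written at a cost of at least `1`. -/
theorem Sim.length_outWord_le {β Q : ℕ} {m₀ g m : Config} (hS : Sim β Q m₀ g m) :
    (outWord g.out).length ≤ g.time := by
  have h1 := EnumRAM.length_outWord_le g.out
  have h2 := hS.grow.cardOut
  omega

/-- The bounds on the resources of a stage. -/
structure StageBound (x : Word) (β T u : ℕ) : Prop where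
  beta : β ≤ u
  time : T ≤ u
  length : x.length + 5 ≤ u

theorem encPair_getD {x y : Word} {i : ℕ} : (encPair x y).getD i 0 =
    if i < x.length then (encWord x).getD i 0 else
      if i = x.length then 0 else (encWord y).getD (i - (x.length + 1)) 0 := by
  unfold encPair
  split_ifs with h1 h2
  · rw [List.getD_append _ _ _ _ (by simpa using h1)]
  · rw [List.getD_append_right _ _ _ _ (by simp [h2]), h2]; simp
  · rw [List.getD_append_right _ _ _ _ (by simp; omega), length_encWord,
      show i - x.length = i - (x.length + 1) + 1 by omega, List.getD_cons_succ]

theorem bits_encPair_le {x y : Word} : ∀ v ∈ encPair x y, bits v ≤ 2 := by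
  intro v hv
  simp only [encPair, List.mem_append, List.mem_cons] at hv
  rcases hv with hv | rfl | hv
  · exact bits_encWord_le v hv
  · simp
  · exact bits_encWord_le v hv

section
variable {x : Word} {K : ℤ} {β T Q u : ℕ} {m₀ g m : Config} (I : List ℤ)

theorem Sim.runs_copy (hS : Sim β Q m₀ g m) (h : HasBase x (encWord x) K m₀) (hT : g.time ≤ T)
    (hu : StageBound x β T u) :
    ∃ c', Runs I (copyCmds ++ cleanCmds) m c' ∧
      ⇑c'.reg = baseReg x (encPair x (outWord g.out)) K ∧
      c'.out = m₀.out ∧ c'.outputs = m₀.outputs ∧ c'.time ≤ m.time + 8 ^ 40 * (u * u) := by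
  obtain ⟨h1, h2, h3⟩ := hu
  have hlen := hS.length_outWord_le
  obtain ⟨c₁, hr₁, hreg₁, ho₁, hos₁, hb₁, ht₁⟩ := EnumRAM.runs_copy (I := I) (b := 32 * u)
    (p := x.length + 1) hS.wordAt
    (by rw [hS.frame_base h (by decide) (by omega) (by omega) (by omega) (by omega)]; rfl)
    (hS.maxBits.mono (by omega)) (by omega) ((bits_natCast_le_self _).trans (by omega))
  obtain ⟨lg, hlog, hlg⟩ := hS.log
  obtain ⟨c₂, hr₂, hreg₂, ho₂, hos₂, ht₂⟩ := runs_clean (I := I) (c := c₁) (lg := lg)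
    (hlog.congr fun a ha => by
      rw [hreg₁ a, if_neg (by omega)]
      rcases ha with rfl | ha
      · decide
      · exact fun h => by have := mod_of_mem_scratch _ h; omega) hb₁ (by omega)
  refine ⟨c₂, hr₁.append hr₂, ?_, by rw [ho₂, ho₁, hS.out], by rw [hos₂, hos₁, hS.outputs], ?_⟩
  · rw [hreg₂]
    refine cleaned_eq_baseReg fun a ha h24 hm1 hm2 hm4 => ?_
    rw [hreg₁ a ha]
    by_cases h5 : a % 8 = 5
    · have hb : ∀ l : List ℤ, baseReg x l K a = l.getD (a / 8) 0 := fun l => by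
        rw [baseReg, if_neg (by omega), if_neg (by omega), if_neg (by omega), if_neg (by omega),
          if_pos h5]
      rw [hS.frame_base h ha h24 hm1 hm2 hm4, hb, hb, encPair_getD]
      split_ifs with h6 h7 h8 h9 h10
      · omega
      · omega
      · rfl
      · rfl
      · rw [List.getD_eq_default _ _ (by simp; omega)]
      · rw [List.getD_eq_default _ _ (by simp; omega), List.getD_eq_default _ _ (by simp; omega)]
    · rw [if_neg (by omega), hS.frame_base h ha h24 hm1 hm2 hm4]
      unfold baseReg
      simp [h5]
  · have e1 : ((outWord g.out).length + 1) * (8 ^ 20 * (32 * u)) ≤ (2 * u) * (8 ^ 20 * (32 * u)) :=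
      Nat.mul_le_mul_right _ (by omega)
    have e2 : (lg.length + 1) * (8 ^ 12 * (2 ^ 12 * (32 * u))) ≤
        (2 * u) * (8 ^ 12 * (2 ^ 12 * (32 * u))) := Nat.mul_le_mul_right _ (by omega)
    nlinarith

theorem Sim.runs_emit (hS : Sim β Q m₀ g m) {y : Word} (h : HasBase x (encPair x y) K m₀)
    (hT : g.time ≤ T) (hu : StageBound x β T u) :
    ∃ c' t, Runs I (emitCmds ++ cleanCmds) m c' ∧
      ⇑c'.reg = baseReg x (encPair x y) (K - if outWord g.out = y then 1 else 0) ∧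
      (∀ i, c'.out i = if i < (outWord g.out).length then (encWord (outWord g.out)).getD i 0 else
        if i = (outWord g.out).length then 0 else m₀.out i) ∧
      c'.outputs = m₀.outputs ++ [(t, outWord g.out)] ∧ t ≤ c'.time ∧
      c'.time ≤ m.time + 8 ^ 40 * (u * u) := by
  obtain ⟨h1, h2, h3⟩ := hu
  have hlen := hS.length_outWord_le
  have hns : ∀ k, k % 8 ≠ 0 → k ∉ scratch := fun k h1 h2 => h1 (mod_of_mem_scratch k h2)
  obtain ⟨c₁, t, hr₁, hreg₁, h40, ho₁, hos₁, htt, hb₁, ht₁⟩ := EnumRAM.runs_emit (I := I)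
    (b := 32 * u) (p := x.length + 1) (y := y) hS.wordAt
    (by rw [hS.frame_base h (by decide) (by omega) (by omega) (by omega) (by omega)]; rfl)
    (fun i => by
      rw [hS.frame_base h (hns _ (by omega)) (by omega) (by omega) (by omega) (by omega), baseReg,
        if_neg (by omega), if_neg (by omega), if_neg (by omega), if_neg (by omega),
        if_pos (by omega), encPair_getD, if_neg (by omega), if_neg (by omega)]
      congr 1; omega)
    (hS.maxBits.mono (by omega)) (by omega) ((bits_natCast_le_self _).trans (by omega))
  obtain ⟨lg, hlog, hlg⟩ := hS.log
  obtain ⟨c₂, hr₂, hreg₂, ho₂, hos₂, ht₂⟩ := runs_clean (I := I) (c := c₁) (lg := lg)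
    (hlog.congr fun a ha => by
      refine hreg₁ a ?_ (by omega)
      rcases ha with rfl | ha
      · decide
      · exact hns a (by omega)) hb₁ (by omega)
  refine ⟨c₂, t, hr₁.append hr₂, ?_, fun i => by rw [ho₂, ho₁, hS.out],
    by rw [hos₂, hos₁, hS.outputs], ?_, ?_⟩
  · rw [hreg₂]
    refine cleaned_eq_baseReg fun a ha h24 hm1 hm2 hm4 => ?_
    by_cases ha40 : a = 40
    · subst ha40
      rw [h40, hS.frame_base h ha h24 hm1 hm2 hm4]
      rfl
    · rw [hreg₁ a ha ha40, hS.frame_base h ha h24 hm1 hm2 hm4]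
      unfold baseReg
      simp [ha40]
  · exact htt.trans hr₂.time_le
  · have e1 : ((outWord g.out).length + 1) * (8 ^ 30 * (32 * u)) ≤ (2 * u) * (8 ^ 30 * (32 * u)) :=
      Nat.mul_le_mul_right _ (by omega)
    have e2 : (lg.length + 1) * (8 ^ 12 * (2 ^ 30 * (32 * u))) ≤
        (2 * u) * (8 ^ 12 * (2 ^ 30 * (32 * u))) := Nat.mul_le_mul_right _ (by omega)
    nlinarith

/-- Replaces the counter by `0` if the register `0` of the simulated machine is `0`. -/
def acceptLines : List Line := [.prim (.copy 0 1), .prim (.mul 0 0 0), .prim (.const 16 1),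
  .prim (.sub 0 16 0), .clamp 0, .prim (.sub 0 16 0), .prim (.mul 40 40 0)]

/-- For an integer `a`, `1 - max (1 - a * a) 0` is the indicator of `a ≠ 0`; the counter is
multiplied by it. -/
theorem evRegs_acceptLines (r : ℕ → ℤ) : evRegs I acceptLines r = Function.update (Function.update
    (Function.update r 16 1) 0 (if r 1 = 0 then 0 else 1)) 40 (if r 1 = 0 then 0 else r 40) := by
  have key : (1 : ℤ) - max (1 - r 1 * r 1) 0 = if r 1 = 0 then 0 else 1 := by
    split_ifs with h
    · simp [h]
    · have := mul_self_pos.2 h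
      rw [max_eq_right (by omega)]; simp
  ext a
  simp only [acceptLines, evRegs, Line.evReg, Instr.evReg, Function.update_apply]
  by_cases h40 : a = 40
  · simp [h40, key]
  by_cases h0 : a = 0
  · simp [h0, key]
  simp [h40, h0]

theorem Sim.runs_accept (hS : Sim β Q m₀ g m) {l : List ℤ} (h : HasBase x l K m₀)
    (hT : g.time ≤ T) (hu : StageBound x β T u) :
    ∃ c', Runs I (.lines acceptLines :: cleanCmds) m c' ∧
      ⇑c'.reg = baseReg x l (if g.reg 0 = 0 then 0 else K) ∧
      c'.out = m₀.out ∧ c'.outputs = m₀.outputs ∧ c'.time ≤ m.time + 8 ^ 40 * (u * u) := by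
  obtain ⟨h1, h2, h3⟩ := hu
  obtain ⟨γ, hI⟩ := exists_bits_le I
  have himm : ∀ l ∈ acceptLines, l.imm γ ≤ 32 * u := by
    have : ∀ l ∈ acceptLines, l.imm γ ≤ 4 := by
      simp only [acceptLines, List.mem_cons, List.not_mem_nil, or_false, forall_eq_or_imp,
        forall_eq, Line.imm]
      decide
    exact fun l hl => (this l hl).trans (by omega)
  have hb₀ : MaxBits (32 * u) m.reg := hS.maxBits.mono (by omega)
  have hb₁ := maxBits_effLines (ls := acceptLines) hI rfl hb₀ (by omega) himm
  have ht₁ := time_effLines_le (ls := acceptLines) hI rfl hb₀ (by omega) himm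
  have e1 : acceptLines.length = 7 := rfl
  rw [e1] at hb₁ ht₁
  have hreg₁ := effLines_reg I acceptLines m
  rw [evRegs_acceptLines] at hreg₁
  obtain ⟨lg, hlog, hlg⟩ := hS.log
  obtain ⟨c₂, hr₂, hreg₂, ho₂, hos₂, ht₂⟩ := runs_clean (I := I) (c := effLines I acceptLines m)
    (lg := lg)
    (hlog.congr fun a ha => by
      rw [hreg₁, Function.update_of_ne (by omega), Function.update_of_ne (by omega),
        Function.update_of_ne (by omega)]) hb₁ (by omega)
  refine ⟨c₂, (Runs.lines rfl m).cons hr₂, ?_, ?_, ?_, ?_⟩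
  · rw [hreg₂]
    refine cleaned_eq_baseReg fun a ha h24 hm1 hm2 hm4 => ?_
    have hne : ∀ k, k ∈ scratch → a ≠ k := fun k hk h => ha (h ▸ hk)
    rw [hreg₁]
    by_cases ha40 : a = 40
    · subst ha40
      rw [Function.update_self, hS.frame_base h ha h24 hm1 hm2 hm4, ← hS.reg 0]
      rfl
    · rw [Function.update_of_ne ha40, Function.update_of_ne (hne 0 (by decide)),
        Function.update_of_ne (hne 16 (by decide)), hS.frame_base h ha h24 hm1 hm2 hm4]
      unfold baseReg
      simp [ha40]
  · rw [ho₂, effLines_out _ (by rfl), hS.out]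
  · rw [hos₂, effLines_outputs _ (by rfl), hS.outputs]
  · have e2 : (lg.length + 1) * (8 ^ 12 * (2 ^ 7 * (32 * u))) ≤
        (2 * u) * (8 ^ 12 * (2 ^ 7 * (32 * u))) := Nat.mul_le_mul_right _ (by omega)
    nlinarith

end

/-! ### The enumeration machine -/

/-- The instructions that leave the main loop if the counter is `0`. -/
def loopHead (b e : ℕ) : List Instr := [.const 16 0, .sub 16 16 40, .jumpNeg 16 (b + 4), .jump e]

/-- `M` is the enumeration machine made of the generator `G` and the decision program `D`. It
computes the initial value of the counter, generates a reference word, sets the counter to `0` if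
this word is rejected by `D`. Then, as long as the counter is positive, it generates a word, produces
it, and decreases the counter if it is the reference word. -/
structure Layout (M : Program) (C d : ℕ) (G D : Program) (b₁ b₂ b₃ b₄ b₅ b₆ b₇ : ℕ) : Prop where
  setup : CodeAt M 0 (codeCmds 0 (setupCmds C d))
  eq₁ : b₁ = sizeCmds (setupCmds C d)
  gen : CodeAt M b₁ (simCode b₁ 3 true G)
  eq₂ : b₂ = b₁ + 20 * G.length
  copy : CodeAt M b₂ (codeCmds b₂ (copyCmds ++ cleanCmds))
  eq₃ : b₃ = b₂ + sizeCmds (copyCmds ++ cleanCmds)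
  dec : CodeAt M b₃ (simCode b₃ 5 false D)
  eq₄ : b₄ = b₃ + 20 * D.length
  accept : CodeAt M b₄ (codeCmds b₄ (.lines acceptLines :: cleanCmds))
  eq₅ : b₅ = b₄ + sizeCmds (.lines acceptLines :: cleanCmds)
  head : CodeAt M b₅ (loopHead b₅ (b₇ + 1))
  regen : CodeAt M (b₅ + 4) (simCode (b₅ + 4) 3 true G)
  eq₆ : b₆ = b₅ + 4 + 20 * G.length
  emit : CodeAt M b₆ (codeCmds b₆ (emitCmds ++ cleanCmds))
  eq₇ : b₇ = b₆ + sizeCmds (emitCmds ++ cleanCmds)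
  back : CodeAt M b₇ [.jump b₅]
  length : M.length = b₇ + 1

/-- The size of a block does not depend on the addresses occurring in it, so all addresses can be
fixed before the code is written, including those of forward jumps. -/
theorem exists_layout (C d : ℕ) (G D : Program) :
    ∃ M b₁ b₂ b₃ b₄ b₅ b₆ b₇, Layout M C d G D b₁ b₂ b₃ b₄ b₅ b₆ b₇ := by
  obtain ⟨b₁, e₁⟩ : ∃ b, b = sizeCmds (setupCmds C d) := ⟨_, rfl⟩
  obtain ⟨b₂, e₂⟩ : ∃ b, b = b₁ + 20 * G.length := ⟨_, rfl⟩
  obtain ⟨b₃, e₃⟩ : ∃ b, b = b₂ + sizeCmds (copyCmds ++ cleanCmds) := ⟨_, rfl⟩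
  obtain ⟨b₄, e₄⟩ : ∃ b, b = b₃ + 20 * D.length := ⟨_, rfl⟩
  obtain ⟨b₅, e₅⟩ : ∃ b, b = b₄ + sizeCmds (.lines acceptLines :: cleanCmds) := ⟨_, rfl⟩
  obtain ⟨b₆, e₆⟩ : ∃ b, b = b₅ + 4 + 20 * G.length := ⟨_, rfl⟩
  obtain ⟨b₇, e₇⟩ : ∃ b, b = b₆ + sizeCmds (emitCmds ++ cleanCmds) := ⟨_, rfl⟩
  obtain ⟨M, hM⟩ : ∃ M : Program, M = codeCmds 0 (setupCmds C d) ++ (simCode b₁ 3 true G ++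
    (codeCmds b₂ (copyCmds ++ cleanCmds) ++ (simCode b₃ 5 false D ++
    (codeCmds b₄ (.lines acceptLines :: cleanCmds) ++ (loopHead b₅ (b₇ + 1) ++
    (simCode (b₅ + 4) 3 true G ++ (codeCmds b₆ (emitCmds ++ cleanCmds) ++ [.jump b₅]))))))) :=
    ⟨_, rfl⟩
  have h : ∀ l, M = l → CodeAt M 0 l := by
    rintro _ rfl i hi
    rw [Nat.zero_add, List.getElem?_eq_getElem hi]
  have h0 := h _ hM
  have h1 := h0.right
  rw [length_codeCmds, zero_add, ← e₁] at h1
  have h2 := h1.right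
  rw [length_simCode, ← e₂] at h2
  have h3 := h2.right
  rw [length_codeCmds, ← e₃] at h3
  have h4 := h3.right
  rw [length_simCode, ← e₄] at h4
  have h5 := h4.right
  rw [length_codeCmds, ← e₅] at h5
  have h6 := h5.right
  rw [show (loopHead b₅ (b₇ + 1)).length = 4 from rfl] at h6
  have h7 := h6.right
  rw [length_simCode, ← e₆] at h7
  have h8 := h7.right
  rw [length_codeCmds, ← e₇] at h8
  refine ⟨M, b₁, b₂, b₃, b₄, b₅, b₆, b₇, h0.left, e₁, h1.left, e₂, h2.left, e₃, h3.left, e₄,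
    h4.left, e₅, h5.left, h6.left, e₆, h7.left, e₇, h8, ?_⟩
  rw [hM]
  simp only [List.length_append, length_codeCmds, length_simCode, loopHead, List.length_cons,
    List.length_nil]
  omega

/-! ### The generator -/

theorem outputs_prefix_of_mem_support_step {P : Program} {I : List ℤ} {c c' : Config}
    (h : c' ∈ (step P I c).support) : c.outputs <+: c'.outputs := by
  unfold step at h
  split at h
  · rw [PMF.support_pure, Set.mem_singleton_iff] at h; rw [h]
  · next ins _ =>
    cases ins <;> simp only [exec, PMF.support_pure, PMF.support_map, Set.mem_singleton_iff,
      Set.mem_image, setReg] at h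
    case rand i j => obtain ⟨v, -, rfl⟩ := h; exact List.prefix_rfl
    case output => subst h; exact List.prefix_append _ _
    all_goals subst h; exact List.prefix_rfl

theorem outputs_prefix_of_mem_support_runFrom {P : Program} {I : List ℤ} {N : ℕ} {c c' : Config}
    (h : c' ∈ (runFrom P I N c).support) : c.outputs <+: c'.outputs := by
  induction N generalizing c with
  | zero => rw [runFrom, PMF.support_pure, Set.mem_singleton_iff] at h; rw [h]
  | succ N ih =>
    rw [runFrom, PMF.mem_support_bind_iff] at h
    obtain ⟨d, hd, h⟩ := h
    exact (outputs_prefix_of_mem_support_step hd).trans (ih h)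

/-- The first word that has been produced, or else the word in the output registers. -/
def firstWord (c : Config) : Word := (c.outputs.map Prod.snd).head?.getD (outWord c.out)

/-- The mean of `f` at the word generated by `G` on `x`. -/
noncomputable def genMean (G : Program) (x : Word) (N : ℕ) (f : Word → ℝ≥0∞) : ℝ≥0∞ :=
  ∑' d, runFrom G (encWord x) N init d * f (firstWord d)

theorem tsum_mul_congr_of_support {α : Type*} {p : PMF α} {f : α → ℝ≥0∞} {r : ℝ≥0∞}
    (h : ∀ a ∈ p.support, f a = r) : ∑' a, p a * f a = r := by
  rw [← one_mul r, ← p.tsum_coe, ← ENNReal.tsum_mul_right]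
  refine tsum_congr fun a => ?_
  by_cases ha : p a = 0
  · simp [ha]
  · rw [h a ((PMF.mem_support_iff _ _).2 ha)]

theorem genMean_const (G : Program) (x : Word) (N : ℕ) (r : ℝ≥0∞) :
    genMean G x N (fun _ => r) = r := tsum_mul_congr_of_support fun _ _ => rfl

/-- The list of outputs only grows, so the word found at the first `OUTPUT` stays the first word of
the whole run. If the generator stops without producing anything, the word left in its output
registers is taken, in agreement with `firstWord`. -/
theorem leads_generate {M G : Program} {I : List ℤ} {base β T Q N : ℕ} {x : Word} {m₀ : Config}
    (S : SimSetup M I base 3 true G (encWord x) m₀ β T) (hQ : 8 ^ 13 * (β + 4 + T) ≤ Q)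
    (hN : ∀ d ∈ (runFrom G (encWord x) N init).support, Halted G d ∧ d.time ≤ T)
    (h : Sim β Q m₀ init m₀) (hpc : m₀.pc = base) (f : Word → ℝ≥0∞) :
    Leads M I (fun m w => ∃ g, Sim β Q m₀ g m ∧ m.pc = base + 20 * G.length ∧ g.time ≤ T ∧
      w ≤ f (outWord g.out)) (m₀.time + Q * T) m₀ (genMean G x N f) := by
  refine Sim.leads S hQ (Φ := fun d => f (firstWord d)) (ψ := fun g => f (outWord g.out))
    (fun g _ hg => ?_) (fun _ g g' n _ hg hex => ?_) N h (by rw [hpc]; simp [simLabel, init]) hN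
    (fun _ => rfl)
  · simp only [firstWord, hg rfl]; exact le_rfl
  · simp only [exec] at hex
    have hg' := congrArg PMF.support hex
    rw [PMF.support_pure, PMF.support_pure, Set.singleton_eq_singleton_iff] at hg'
    subst hg'
    refine (tsum_mul_congr_of_support fun d hd => ?_).le
    obtain ⟨l, hl⟩ := outputs_prefix_of_mem_support_runFrom hd
    simp only [firstWord, ← hl, hg, List.nil_append, List.map_append, List.map_cons]
    simp

/-! ### Rounds of the main loop -/

/-- A configuration at the head of the main loop, with reference word `y` and counter `K`. -/
structure Checkpoint (b : ℕ) (x y : Word) (T : ℕ) (K : ℤ) (c : Config) : Prop where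
  pc : c.pc = b
  reg : ⇑c.reg = baseReg x (encPair x y) K
  -- No stage erases the output registers, so their size is part of the invariant needed for the
  -- space bound.
  out_bits : ∀ i, bits (c.out i) ≤ 2
  out_zero : ∀ i, T < i → c.out i = 0

section
variable {M G D : Program} {C d b₁ b₂ b₃ b₄ b₅ b₆ b₇ : ℕ} {I : List ℤ} {x y : Word} {K : ℤ}
  {β T u N : ℕ} {c : Config}

/-- Besides the path to `m₀`, the first step is exposed, because the space argument needs a definite
step out of each checkpoint. Register `16` receives `0` and then `-K`, no longer than the counter.
-/
theorem Layout.step_head (L : Layout M C d G D b₁ b₂ b₃ b₄ b₅ b₆ b₇)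
    (hc : Checkpoint b₅ x y T K c) :
    ∃ c₁ m₀ : Config, step M I c = PMF.pure c₁ ∧ Reach M I c m₀ ∧
      m₀.pc = (if 0 < K then b₅ + 4 else b₇ + 1) ∧ HasBase x (encPair x y) K m₀ ∧
      (∀ b, MaxBits b c.reg → MaxBits b m₀.reg) ∧ m₀.out = c.out ∧ m₀.outputs = c.outputs ∧
      m₀.time ≤ c.time + bits K + 4 := by
  have hcode := L.head
  have h0 := hcode.head
  have h1 := hcode.tail.head
  have h2 := hcode.tail.tail.head
  have h3 := hcode.tail.tail.tail.head
  have h40 : c.reg 40 = K := by rw [hc.reg]; rfl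
  set c₁ := setReg c (c.time + 1) 16 0 with hc₁
  set c₂ := setReg c₁ (c.time + 1 + (1 + bits K)) 16 (-K) with hc₂
  have s0 : step M I c = PMF.pure c₁ := by
    rw [step_eq_exec (by rw [hc.pc]; exact h0)]; rfl
  have s1 : step M I c₁ = PMF.pure c₂ := by
    rw [step_eq_exec (by rw [hc₁, setReg, hc.pc]; exact h1)]
    simp [exec, cost, hc₂, hc₁, setReg, h40]
  have hreg₂ : ⇑c₂.reg = Function.update c.reg 16 (-K) := by
    rw [hc₂, hc₁]; simp [setReg]
  have h16 : c₂.reg 16 = -K := by rw [hreg₂, Function.update_self]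
  have hpc₂ : c₂.pc = b₅ + 1 + 1 := by rw [hc₂, hc₁, setReg, setReg, hc.pc]
  have s2 : step M I c₂ = PMF.pure { c₂ with
      pc := if 0 < K then b₅ + 4 else b₅ + 1 + 1 + 1, time := c₂.time + 1 } := by
    rw [step_eq_exec (by rw [hpc₂]; exact h2)]
    simp [exec, cost, h16, hpc₂]
  have hbase : ∀ a, a ∉ scratch → c₂.reg a = baseReg x (encPair x y) K a := by
    intro a ha
    rw [hreg₂, Function.update_of_ne (by rintro rfl; exact ha (by decide)), hc.reg]
  have hbits : ∀ b, MaxBits b c.reg → MaxBits b c₂.reg := by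
    intro b hb
    rw [hreg₂]
    refine hb.update ?_
    rw [bits_neg, ← h40]
    exact hb 40
  have r0 : Reach M I c c₁ := .single s0
  have r1 : Reach M I c c₂ := r0.trans (.single s1)
  have r2 := r1.trans (.single s2)
  have htime : c₂.time = c.time + 1 + (1 + bits K) := rfl
  by_cases hK : 0 < K
  · refine ⟨c₁, _, s0, r2, by simp [hK], hbase, hbits, rfl, rfl, ?_⟩
    simp only [htime]; omega
  · refine ⟨c₁, { c₂ with pc := b₇ + 1, time := c₂.time + 2 }, s0, r2.trans (.single ?_), by simp [hK], hbase,
      hbits, rfl, rfl, ?_⟩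
    · rw [step_eq_exec (ins := .jump (b₇ + 1)) (by simp only [hK, if_false]; exact h3)]
      rfl
    · simp only [htime]; omega

/-- A round starts from memory determined by `x`, `y` and `K` outside the output registers, so its
time bound does not depend on the number of rounds made before. The word `z` follows the law of the
generator, whence the weight `genMean G x N f`. -/
theorem Layout.leads_round (L : Layout M C d G D b₁ b₂ b₃ b₄ b₅ b₆ b₇)
    (hc : Checkpoint b₅ x y T K c) (hK : 0 < K) (hKb : bits K ≤ β)
    (hu : StageBound x β T u) (hx : 8 * x.length + 13 ≤ β)
    (himm : ∀ ins ∈ G, immBits ins ≤ β ∧ ∀ l ∈ calcLines 3 ins, l.imm 0 ≤ β)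
    (hN : ∀ d ∈ (runFrom G (encWord x) N init).support, Halted G d ∧ d.time ≤ T)
    (f : Word → ℝ≥0∞) :
    Leads M I (fun c' w => ∃ z t, Checkpoint b₅ x y T (K - if z = y then 1 else 0) c' ∧
      c'.outputs = c.outputs ++ [(t, z)] ∧ t ≤ c'.time ∧ c'.time ≤ c.time + 8 ^ 41 * (u * u) ∧
      w ≤ f z) (c.time + 8 ^ 41 * (u * u)) c (genMean G x N f) := by
  obtain ⟨-, m₀, -, hr, hpc, hbase, hbits, ho, hos, ht⟩ := L.step_head (I := I) hc
  rw [if_pos hK] at hpc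
  have hb : MaxBits β m₀.reg := hbits _ (by
    rw [hc.reg]; exact maxBits_baseReg bits_encPair_le hKb hx)
  have hu' := hu
  obtain ⟨u1, u2, u3⟩ := hu'
  obtain ⟨Q, hQ⟩ : ∃ Q, Q = 8 ^ 13 * (β + 4 + T) := ⟨_, rfl⟩
  have hQT : Q * T ≤ 8 ^ 15 * (u * u) := by
    have : Q * T ≤ (8 ^ 15 * u) * u := Nat.mul_le_mul (by omega) u2
    rwa [mul_assoc] at this
  have huu : u ≤ u * u := Nat.le_mul_self u
  have S : SimSetup M I (b₅ + 4) 3 true G (encWord x) m₀ β T := by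
    refine ⟨L.regen, .inl rfl, fun i => ?_, himm, fun v hv => (bits_encWord_le v hv).trans (by omega)⟩
    rw [hbase _ fun h => by have := mod_of_mem_scratch _ h; omega, baseReg, if_neg (by omega),
      if_neg (by omega), if_neg (by omega), if_pos (by omega)]
    congr 1; omega
  refine hr.leads (by omega) ((leads_generate S hQ.ge hN (hbase.sim Q hb) hpc f).trans (by omega) ?_)
  rintro m w ⟨g, hS, hmpc, hgt, hw⟩
  obtain ⟨c', t, hruns, hreg, hout, houts, htt, ht'⟩ := hS.runs_emit I hbase hgt hu
  have hlen := hS.length_outWord_le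
  have hreach := hruns M b₆ L.emit
  rw [← L.eq₆] at hmpc
  rw [← L.eq₇, ← hmpc, Config.goto_self] at hreach
  have hmt := hS.time
  have hQg : Q * g.time ≤ Q * T := Nat.mul_le_mul_left _ hgt
  have hlast : step M I (c'.goto b₇) = PMF.pure { c' with pc := b₅, time := c'.time + 1 } := by
    rw [step_eq_exec (by exact L.back.head)]; rfl
  have hfin : c'.time + 1 ≤ c.time + 8 ^ 41 * (u * u) := by omega
  refine Reach.leads (hreach.tail hlast) hfin (.done ⟨outWord g.out, t, ⟨rfl, hreg, fun i => ?_,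
    fun i hi => ?_⟩, by rw [houts, hos], by simp only; omega, hfin, hw⟩)
  · simp only [hout i]
    split_ifs
    · exact bits_getD_le bits_encWord_le _
    · simp
    · rw [ho]; exact hc.out_bits i
  · simp only [hout i]
    rw [if_neg (by omega), if_neg (by omega), ho]
    exact hc.out_zero i hi

end

theorem Leads.weaken {P : Program} {I : List ℤ} {Q : Config → ℝ≥0∞ → Prop} {B : ℕ} {c : Config}
    {w w' : ℝ≥0∞} (h : Leads P I Q B c w) (hw : w' ≤ w)
    (hQ : ∀ c w w', w' ≤ w → Q c w → Q c w') : Leads P I Q B c w' := by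
  cases h with
  | done h => exact .done (hQ _ _ _ hw h)
  | step f ht hf hle => exact .step f ht hf (hw.trans hle)

section
variable {M G D : Program} {C d b₁ b₂ b₃ b₄ b₅ b₆ b₇ : ℕ} {x : Word}
  {β T T' u N k : ℕ} {ε : ℚ} {S : Set Word}

/-- `Leads` records weights rather than facts about runs. The correctness of the decision is
therefore encoded in the weight, which is set to `0` when the answer is wrong; as the decision
program is deterministic and correct, nothing is lost. This is the origin of the clause with `w ≠
0`. -/
theorem Layout.leads_prep (L : Layout M C d G D b₁ b₂ b₃ b₄ b₅ b₆ b₇) (hε : 0 < ε)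
    (hk : k = C * (x.length + 1) ^ d * (2 ^ precision ε) ^ 2) (hk0 : 0 < k)
    (hkb : bits (k : ℤ) ≤ β) (hx : 8 * x.length + 13 ≤ β)
    (hu : StageBound x β T u) (hu' : StageBound x β T' u)
    (hG : ∀ ins ∈ G, immBits ins ≤ β ∧ ∀ l ∈ calcLines 3 ins, l.imm 0 ≤ β)
    (hD : ∀ ins ∈ D, immBits ins ≤ β ∧ ∀ l ∈ calcLines 5 ins, l.imm 0 ≤ β)
    (hN : ∀ g ∈ (runFrom G (encWord x) N init).support, Halted G g ∧ g.time ≤ T)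
    (hdec : ∀ y : Word, y.length ≤ T → ∃ n g, runFrom D (encPair x y) n init = PMF.pure g ∧
      Halted D g ∧ g.time ≤ T' ∧ (g.reg 0 ≠ 0 ↔ y ∈ S))
    {b B : ℕ} (hb : b = 8 * x.length + ratSize ε + C + 40)
    (hB : B = 8 ^ (d + 50) * (b * b) + 8 ^ 42 * (u * u)) (f : Word → ℝ≥0∞) :
    Leads M (encWordRat x ε) (fun c w => ∃ y K, y.length ≤ T ∧ (K = 0 ∨ K = (k : ℤ)) ∧
      Checkpoint b₅ x y T K c ∧ c.outputs = [] ∧ c.time ≤ B ∧ (w ≠ 0 → (K ≠ 0 ↔ y ∈ S)) ∧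
      w ≤ f y) B init (genMean G x N f) := by
  classical
  obtain ⟨u1, u2, u3⟩ := id hu
  have u4 := hu'.time
  obtain ⟨c₀, hr₀, hreg₀, ho₀, hos₀, ht₀⟩ := runs_setup (x := x) hε C d hb.ge
  rw [← hk] at hreg₀
  have hr₀ := hr₀ M 0 L.setup
  rw [zero_add, ← L.eq₁] at hr₀
  set m₀ := c₀.goto b₁ with hm₀
  have hbase₀ : HasBase x (encWord x) k m₀ := .of_eq hreg₀
  have huu : u ≤ u * u := Nat.le_mul_self u
  obtain ⟨Q, hQ⟩ : ∃ Q, Q = 8 ^ 13 * (β + 4 + T) := ⟨_, rfl⟩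
  have hQT : Q * T ≤ 8 ^ 15 * (u * u) := by
    have : Q * T ≤ (8 ^ 15 * u) * u := Nat.mul_le_mul (by omega) u2
    rwa [mul_assoc] at this
  obtain ⟨Q', hQ'⟩ : ∃ Q, Q = 8 ^ 13 * (β + 4 + T') := ⟨_, rfl⟩
  have hQT' : Q' * T' ≤ 8 ^ 15 * (u * u) := by
    have : Q' * T' ≤ (8 ^ 15 * u) * u := Nat.mul_le_mul (by omega) u4
    rwa [mul_assoc] at this
  have hb₀ : MaxBits β m₀.reg := by
    rw [hm₀, Config.goto_reg, hreg₀]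
    exact maxBits_baseReg bits_encWord_le hkb hx
  have hns : ∀ k, k % 8 ≠ 0 → k ∉ scratch := fun k h1 h2 => h1 (mod_of_mem_scratch k h2)
  have S₀ : SimSetup M (encWordRat x ε) b₁ 3 true G (encWord x) m₀ β T := by
    refine ⟨L.gen, .inl rfl, fun i => ?_, hG, fun v hv => (bits_encWord_le v hv).trans (by omega)⟩
    rw [hbase₀ _ (hns _ (by omega)), baseReg, if_neg (by omega),
      if_neg (by omega), if_neg (by omega), if_pos (by omega)]
    congr 1; omega
  have hmt₀ : m₀.time = c₀.time := rfl
  refine Reach.leads hr₀ (by omega)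
    ((leads_generate S₀ hQ.ge hN (hbase₀.sim Q hb₀) rfl f).trans (by omega) ?_)
  rintro m w ⟨g, hS, hmpc, hgt, hw⟩
  obtain ⟨c', hruns, hreg, hout, houts, ht'⟩ := hS.runs_copy (encWordRat x ε) hbase₀ hgt hu
  have hlen := hS.length_outWord_le
  set y := outWord g.out with hy
  have hreach := hruns M b₂ L.copy
  rw [← L.eq₂] at hmpc
  rw [← L.eq₃, ← hmpc, Config.goto_self] at hreach
  have hmt := hS.time
  have hQg : Q * g.time ≤ Q * T := Nat.mul_le_mul_left _ hgt
  obtain ⟨n, g₁, hpure, hhalt, htime, hacc⟩ := hdec y (by omega)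
  set m₁ := c'.goto b₃ with hm₁
  have hbase₁ : HasBase x (encPair x y) k m₁ := .of_eq hreg
  have hb₁ : MaxBits β m₁.reg := by
    rw [hm₁, Config.goto_reg, hreg]
    exact maxBits_baseReg bits_encPair_le hkb hx
  have S₁ : SimSetup M (encWordRat x ε) b₃ 5 false D (encPair x y) m₁ β T' := by
    refine ⟨L.dec, .inr rfl, fun i => ?_, hD, fun v hv => (bits_encPair_le v hv).trans (by omega)⟩
    rw [hbase₁ _ (hns _ (by omega)), baseReg, if_neg (by omega),
      if_neg (by omega), if_neg (by omega), if_neg (by omega), if_pos (by omega)]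
    congr 1; omega
  have hmt₁ : m₁.time = c'.time := rfl
  -- The mean over the single possible final configuration, where the answer is right.
  have hle : w ≤ ∑' e, runFrom D (encPair x y) n init e *
      (if (e.reg 0 ≠ 0 ↔ y ∈ S) then f y else 0) := by
    rw [hpure, tsum_pure_mul, if_pos hacc]; exact hw
  have hlead := Sim.leads S₁ hQ'.ge (Φ := fun e => if (e.reg 0 ≠ 0 ↔ y ∈ S) then f y else 0)
    (ψ := fun e => if (e.reg 0 ≠ 0 ↔ y ∈ S) then f y else 0) (fun _ _ _ => le_rfl)
    (fun h => absurd h (by decide)) n (hbase₁.sim Q' hb₁) (by simp [simLabel, init, hm₁])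
    (by
      rw [hpure, PMF.support_pure]
      rintro _ rfl
      exact ⟨hhalt, htime⟩)
    (fun h => absurd h (by decide))
  refine hreach.leads (by omega) ((hlead.weaken hle ?_).trans (by omega) ?_)
  · rintro c w w' hw ⟨g, h1, h2, h3, h4⟩
    exact ⟨g, h1, h2, h3, hw.trans h4⟩
  rintro m₂ w₂ ⟨g₂, hS₂, hmpc₂, hgt₂, hw₂⟩
  obtain ⟨c₃, hruns₃, hreg₃, hout₃, houts₃, ht₃⟩ :=
    hS₂.runs_accept (encWordRat x ε) hbase₁ hgt₂ hu'
  have hreach₃ := hruns₃ M b₄ L.accept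
  rw [← L.eq₄] at hmpc₂
  rw [← L.eq₅, ← hmpc₂, Config.goto_self] at hreach₃
  have hmt₂ := hS₂.time
  have hQg₂ : Q' * g₂.time ≤ Q' * T' := Nat.mul_le_mul_left _ hgt₂
  have hfin : c₃.time ≤ B := by omega
  have hout : (c₃.goto b₅).out = 0 := by
    rw [Config.goto_out, hout₃, hm₁, Config.goto_out, hout, hm₀, Config.goto_out, ho₀]
  refine hreach₃.leads hfin (.done ⟨y, if g₂.reg 0 = 0 then 0 else k, by omega, ?_,
    ⟨rfl, hreg₃, fun i => by rw [hout]; simp, fun i _ => by rw [hout]; rfl⟩, ?_, hfin, ?_, ?_⟩)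
  · split_ifs <;> simp
  · rw [Config.goto_outputs, houts₃, hm₁, Config.goto_outputs, houts, hm₀, Config.goto_outputs,
      hos₀]
  · intro hw0
    by_cases hc : (g₂.reg 0 ≠ 0 ↔ y ∈ S)
    · rw [← hc]
      by_cases h0 : g₂.reg 0 = 0 <;> simp [h0, hk0.ne']
    · rw [if_neg hc] at hw₂
      exact absurd (le_antisymm hw₂ zero_le) hw0
  · refine hw₂.trans ?_
    split_ifs
    · exact le_rfl
    · exact zero_le

theorem Layout.halted (L : Layout M C d G D b₁ b₂ b₃ b₄ b₅ b₆ b₇) {c : Config}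
    (hc : c.pc = b₇ + 1) : Halted M c := by
  rw [Halted, L.length, hc]

end

/-! ### Uniform draws with replacement -/

section
variable {α : Type*}

/-- The mean of `φ` at the list `h` completed by `r` uniform draws in `A`. -/
noncomputable def drawMean (A : Finset α) : ℕ → (List α → ℝ) → List α → ℝ
  | 0, φ, h => φ h
  | r + 1, φ, h => (A.card : ℝ)⁻¹ * ∑ y ∈ A, drawMean A r φ (h ++ [y])

variable {A : Finset α}

theorem drawMean_mono {r : ℕ} {φ ψ : List α → ℝ} {h : List α}
    (H : ∀ t : List α, t.length = r → (∀ z ∈ t, z ∈ A) → φ (h ++ t) ≤ ψ (h ++ t)) :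
    drawMean A r φ h ≤ drawMean A r ψ h := by
  induction r generalizing h with
  | zero => simpa [drawMean] using H [] rfl (by simp)
  | succ r ih =>
    refine mul_le_mul_of_nonneg_left (Finset.sum_le_sum fun y hy => ih fun t ht htA => ?_)
      (by positivity)
    rw [List.append_assoc]
    refine H ([y] ++ t) (by simp [ht]) fun z hz => ?_
    rcases List.mem_cons.1 hz with rfl | hz
    · exact hy
    · exact htA z hz

theorem drawMean_congr {r : ℕ} {φ ψ : List α → ℝ} {h : List α}
    (H : ∀ t : List α, t.length = r → (∀ z ∈ t, z ∈ A) → φ (h ++ t) = ψ (h ++ t)) :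
    drawMean A r φ h = drawMean A r ψ h :=
  le_antisymm (drawMean_mono fun t h1 h2 => (H t h1 h2).le)
    (drawMean_mono fun t h1 h2 => (H t h1 h2).ge)

theorem drawMean_const (hA : A.Nonempty) (r : ℕ) (a : ℝ) (h : List α) :
    drawMean A r (fun _ => a) h = a := by
  induction r generalizing h with
  | zero => rfl
  | succ r ih =>
    have : (A.card : ℝ) ≠ 0 := by exact_mod_cast hA.card_pos.ne'
    simp only [drawMean, ih, Finset.sum_const, nsmul_eq_mul]
    field_simp

theorem drawMean_add (r : ℕ) (φ ψ : List α → ℝ) (h : List α) :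
    drawMean A r (fun s => φ s + ψ s) h = drawMean A r φ h + drawMean A r ψ h := by
  induction r generalizing h with
  | zero => rfl
  | succ r ih => simp only [drawMean, ih, Finset.sum_add_distrib, mul_add]

theorem drawMean_mul (r : ℕ) (a : ℝ) (φ : List α → ℝ) (h : List α) :
    drawMean A r (fun s => a * φ s) h = a * drawMean A r φ h := by
  induction r generalizing h with
  | zero => rfl
  | succ r ih => simp only [drawMean, ih, ← Finset.mul_sum, mul_left_comm]

theorem drawMean_sum {ι : Type*} (s : Finset ι) (r : ℕ) (φ : ι → List α → ℝ) (h : List α) :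
    drawMean A r (fun l => ∑ i ∈ s, φ i l) h = ∑ i ∈ s, drawMean A r (φ i) h := by
  induction r generalizing h with
  | zero => rfl
  | succ r ih =>
    simp only [drawMean, ih]
    rw [Finset.sum_comm, Finset.mul_sum]

theorem drawMean_add_left (p q : ℕ) (φ : List α → ℝ) (h : List α) :
    drawMean A (p + q) φ h = drawMean A p (drawMean A q φ) h := by
  induction p generalizing h with
  | zero => rw [Nat.zero_add]; rfl
  | succ p ih => rw [Nat.succ_add]; simp only [drawMean, ih]

/-- The draws after the first `p` average out. -/
theorem drawMean_take (hA : A.Nonempty) {p r : ℕ} (hp : p ≤ r) (ψ : List α → ℝ) :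
    drawMean A r (fun s => ψ (s.take p)) [] = drawMean A p ψ [] := by
  obtain ⟨q, rfl⟩ := Nat.exists_eq_add_of_le hp
  rw [drawMean_add_left]
  refine drawMean_congr fun t ht _ => ?_
  rw [List.nil_append, ← drawMean_const hA q (ψ t) t]
  refine drawMean_congr fun t' _ _ => ?_
  rw [← ht, List.take_left]

/-- Independence of the draws: the mean of a product is the product of the means. -/
theorem drawMean_prod (g : α → ℝ) (r : ℕ) (h : List α) :
    drawMean A r (fun s => (s.map g).prod) h =
      (h.map g).prod * ((A.card : ℝ)⁻¹ * ∑ y ∈ A, g y) ^ r := by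
  induction r generalizing h with
  | zero => simp [drawMean]
  | succ r ih =>
    simp only [drawMean, ih, List.map_append, List.map_cons, List.map_nil, List.prod_append,
      List.prod_cons, List.prod_nil, mul_one]
    rw [← Finset.sum_mul, ← Finset.mul_sum, pow_succ]
    ring

variable [DecidableEq α]

theorem drawMean_count {y : α} (hy : y ∈ A) (r : ℕ) (h : List α) :
    drawMean A r (fun s => (s.count y : ℝ)) h = h.count y + r * (A.card : ℝ)⁻¹ := by
  have hA : (A.card : ℝ) ≠ 0 := by exact_mod_cast (Finset.card_pos.2 ⟨y, hy⟩).ne'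
  induction r generalizing h with
  | zero => simp [drawMean]
  | succ r ih =>
    have : ∀ z, (((h ++ [z]).count y : ℕ) : ℝ) = h.count y + if z = y then 1 else 0 := by
      intro z
      rw [List.count_append, List.count_singleton]
      by_cases hz : z = y <;> simp [hz]
    simp only [drawMean, ih, this, Finset.sum_add_distrib, Finset.sum_const, nsmul_eq_mul,
      Finset.sum_ite_eq', hy, if_true]
    field_simp
    push_cast
    ring

theorem drawMean_mem (hA : A.Nonempty) {S : Finset α} (hS : S ⊆ A) {p r : ℕ} (hp : p ≤ r) :
    drawMean A r (fun s => ((s.take p).map fun z => if z ∈ S then (1 : ℝ) else 0).prod) [] =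
      ((S.card : ℝ) / A.card) ^ p := by
  rw [drawMean_take hA hp fun s => (s.map fun z => if z ∈ S then (1 : ℝ) else 0).prod,
    drawMean_prod, Finset.sum_ite_mem, Finset.inter_eq_right.2 hS]
  simp [div_eq_inv_mul]

/-- The number of occurrences of `y` in `s`. -/
abbrev hits (y : α) (s : List α) : ℕ := s.count y

theorem hits_append (y : α) (s t : List α) : hits y (s ++ t) = hits y s + hits y t :=
  List.count_append

theorem hits_singleton (y z : α) : hits y [z] = if z = y then 1 else 0 := by
  rw [hits, List.count_singleton]
  by_cases hzy : z = y <;> simp [hzy]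

/-- The sequence of draws `s` has at least `m` distinct elements of `A` among the first `D * m`
ones, for all `m`, and it has `k` occurrences of `y`, but not among the first `D * |A|` draws. -/
def GoodDraws (A : Finset α) (y : α) (D k : ℕ) (s : List α) : Prop :=
  (∀ m ≤ A.card, m ≤ (s.take (D * m)).toFinset.card) ∧ hits y (s.take (D * A.card)) < k ∧
    k ≤ hits y s

instance (A : Finset α) (y : α) (D k : ℕ) (s : List α) : Decidable (GoodDraws A y D k s) := by
  unfold GoodDraws; infer_instance

/-- A pointwise union bound. If `s` is not good, one of the three last terms is at least `1`: draws
with too few distinct values all lie in some set `S` of `j` words; `k` early hits make the ratio to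
`k` at least `1` (Markov); and with fewer than `k` hits in total, `2 ^ k` times `(1 / 2) ^ hits` is
at least `1` (exponential Markov). Taking means yields the probability bound. -/
theorem one_le_goodDraws_add {y : α} {D k : ℕ} (hk : 0 < k) {s : List α} (hs : ∀ z ∈ s, z ∈ A) :
    (1 : ℝ) ≤ (if GoodDraws A y D k s then 1 else 0) +
      (∑ j ∈ Finset.range A.card, ∑ S ∈ A.powersetCard j,
        ((s.take (D * (j + 1))).map fun z => if z ∈ S then (1 : ℝ) else 0).prod) +
      (k : ℝ)⁻¹ * ((s.take (D * A.card)).count y : ℝ) +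
      2 ^ k * (s.map fun z => if z = y then (1 / 2 : ℝ) else 1).prod := by
  have h1 : (0 : ℝ) ≤ if GoodDraws A y D k s then 1 else 0 := by split_ifs <;> norm_num
  have hnn : ∀ (S : Finset α) (j : ℕ), (0 : ℝ) ≤
      ((s.take (D * (j + 1))).map fun z => if z ∈ S then (1 : ℝ) else 0).prod := by
    intro S j
    refine List.prod_nonneg fun a ha => ?_
    obtain ⟨z, -, rfl⟩ := List.mem_map.1 ha
    split_ifs <;> norm_num
  have h2 : (0 : ℝ) ≤ ∑ j ∈ Finset.range A.card, ∑ S ∈ A.powersetCard j,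
      ((s.take (D * (j + 1))).map fun z => if z ∈ S then (1 : ℝ) else 0).prod :=
    Finset.sum_nonneg fun j _ => Finset.sum_nonneg fun S _ => hnn S j
  have h3 : (0 : ℝ) ≤ (k : ℝ)⁻¹ * ((s.take (D * A.card)).count y : ℝ) := by positivity
  have hprod : ∀ s : List α, (s.map fun z => if z = y then (1 / 2 : ℝ) else 1).prod =
      (1 / 2) ^ s.count y := by
    intro s
    induction s with
    | nil => simp
    | cons a s ih =>
      rw [List.map_cons, List.prod_cons, ih]
      by_cases ha : a = y
      · simp [ha, pow_succ']
      · simp [ha, List.count_cons_of_ne (Ne.symm (Ne.symm ha))]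
  have h4 : (0 : ℝ) ≤ 2 ^ k * (s.map fun z => if z = y then (1 / 2 : ℝ) else 1).prod := by
    rw [hprod]; positivity
  by_cases hg : GoodDraws A y D k s
  · rw [if_pos hg]; linarith
  rw [GoodDraws, not_and_or, not_and_or] at hg
  rcases hg with hg | hg | hg
  · push Not at hg
    obtain ⟨m, hm, hlt⟩ := hg
    obtain ⟨j, rfl⟩ : ∃ j, m = j + 1 := ⟨m - 1, by omega⟩
    -- There are at most `j` distinct values, and `j ≤ A.card`, so they can be enlarged to a subset
    -- of exactly `j` elements.
    obtain ⟨S, hS1, hS2, hS3⟩ := Finset.exists_subsuperset_card_eq (n := j)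
      (s := (s.take (D * (j + 1))).toFinset) (t := A)
      (fun z hz => hs z (List.mem_of_mem_take (List.mem_toFinset.1 hz))) (by omega) (by omega)
    have hall : ∀ z ∈ s.take (D * (j + 1)), z ∈ S := fun z hz => hS1 (List.mem_toFinset.2 hz)
    have e1 := Finset.single_le_sum (s := A.powersetCard j) (a := S)
      (f := fun S => ((s.take (D * (j + 1))).map fun z => if z ∈ S then (1 : ℝ) else 0).prod)
      (fun S _ => hnn S j) (Finset.mem_powersetCard.2 ⟨hS2, hS3⟩)
    have e2 := Finset.single_le_sum (s := Finset.range A.card) (a := j)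
      (f := fun j => ∑ S ∈ A.powersetCard j,
        ((s.take (D * (j + 1))).map fun z => if z ∈ S then (1 : ℝ) else 0).prod)
      (fun j _ => Finset.sum_nonneg fun S _ => hnn S j) (Finset.mem_range.2 (by omega))
    have e0 : ((s.take (D * (j + 1))).map fun z => if z ∈ S then (1 : ℝ) else 0).prod = 1 :=
      List.prod_eq_one fun a ha => by
        obtain ⟨z, hz, rfl⟩ := List.mem_map.1 ha
        exact if_pos (hall z hz)
    simp only [e0] at e1
    linarith
  · have : (1 : ℝ) ≤ (k : ℝ)⁻¹ * ((s.take (D * A.card)).count y : ℝ) := by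
      rw [← div_eq_inv_mul, one_le_div (by exact_mod_cast hk)]
      exact_mod_cast not_lt.1 hg
    linarith
  · have : (1 : ℝ) ≤ 2 ^ k * (s.map fun z => if z = y then (1 / 2 : ℝ) else 1).prod := by
      rw [hprod, one_div, inv_pow, ← div_eq_mul_inv, one_le_div (by positivity)]
      exact pow_le_pow_right₀ (by norm_num) (not_le.1 hg).le
    linarith

end

/-! ### Numerical bounds -/

theorem exp_neg_one_le_half : Real.exp (-1) ≤ 1 / 2 := by
  rw [Real.exp_neg, ← one_div]
  refine one_div_le_one_div_of_le (by norm_num) ?_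
  have := Real.add_one_le_exp (1 : ℝ)
  linarith

/-- The coupon collector estimate, by two cases. If `N ≤ 2 * (j + 1)`, put `i = N - j`: the binomial
coefficient is at most `N ^ i`, the exponent is at least `N * E`, and `(1 - i / N) ^ N ≤ exp (-i) ≤
2 ^ (-i)`. Otherwise `j / N ≤ 1 / 2` and the binomial coefficient is at most `N ^ (j + 1)`. Both
give a positive power of `N / 2 ^ E ≤ 1`. -/
theorem choose_mul_pow_le {N j E : ℕ} (hj : j < N) (hE : N ≤ 2 ^ E) :
    (N.choose j : ℝ) * ((j : ℝ) / N) ^ (2 * E * (j + 1)) ≤ N / 2 ^ E := by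
  have hN : (0 : ℝ) < N := by exact_mod_cast (by omega : 0 < N)
  have hq0 : (0 : ℝ) ≤ (j : ℝ) / N := by positivity
  have hq1 : (j : ℝ) / N ≤ 1 := by
    rw [div_le_one hN]; exact_mod_cast hj.le
  have hE' : (N : ℝ) / 2 ^ E ≤ 1 := by
    rw [div_le_one (by positivity)]; exact_mod_cast hE
  have hE0 : (0 : ℝ) ≤ (N : ℝ) / 2 ^ E := by positivity
  have fin : ∀ i : ℕ, 1 ≤ i → (N : ℝ) ^ i * (1 / 2) ^ (E * i) ≤ N / 2 ^ E := by
    intro i hi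
    rw [pow_mul, ← mul_pow, one_div, inv_pow, ← div_eq_mul_inv]
    exact pow_le_of_le_one hE0 hE' (by omega)
  rcases le_or_gt N (2 * (j + 1)) with h | h
  · obtain ⟨i, rfl⟩ : ∃ i, N = j + i := ⟨N - j, by omega⟩
    refine le_trans (mul_le_mul (b := ((j + i : ℕ) : ℝ) ^ i) (d := (1 / 2) ^ (E * i)) ?_ ?_
      (by positivity) (by positivity)) (fin i (by omega))
    · rw [Nat.choose_symm_of_eq_add rfl]
      exact_mod_cast Nat.choose_le_pow (j + i) i
    · have h1 : ((j : ℝ) / (j + i : ℕ)) ^ (j + i) ≤ (1 / 2) ^ i := by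
        have e : (j : ℝ) / (j + i : ℕ) = 1 - i / (j + i : ℕ) := by
          field_simp; push_cast; ring
        rw [e]
        refine (Real.one_sub_div_pow_le_exp_neg (by push_cast; linarith [Nat.cast_nonneg (α := ℝ) j])).trans ?_
        rw [show -(i : ℝ) = i * (-1) by ring, Real.exp_nat_mul]
        exact pow_le_pow_left₀ (Real.exp_nonneg _) exp_neg_one_le_half _
      calc ((j : ℝ) / (j + i : ℕ)) ^ (2 * E * (j + 1))
          ≤ ((j : ℝ) / (j + i : ℕ)) ^ ((j + i) * E) :=
            pow_le_pow_of_le_one hq0 hq1 (by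
              rw [show 2 * E * (j + 1) = 2 * (j + 1) * E by ring]
              exact Nat.mul_le_mul_right _ h)
        _ ≤ ((1 / 2) ^ i) ^ E := by rw [pow_mul]; exact pow_le_pow_left₀ (by positivity) h1 _
        _ = (1 / 2) ^ (E * i) := by rw [← pow_mul, mul_comm]
  · have hq : (j : ℝ) / N ≤ 1 / 2 := by
      rw [div_le_div_iff₀ hN (by norm_num)]
      exact_mod_cast (by omega : j * 2 ≤ 1 * N)
    refine le_trans (mul_le_mul (b := (N : ℝ) ^ (j + 1)) (d := (1 / 2) ^ (E * (j + 1))) ?_ ?_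
      (by positivity) (by positivity)) (fin (j + 1) (by omega))
    · exact_mod_cast (Nat.choose_le_pow N j).trans (Nat.pow_le_pow_right (by omega) (by omega))
    · refine (pow_le_pow_left₀ hq0 hq _).trans
        (pow_le_pow_of_le_one (by norm_num) (by norm_num) ?_)
      exact Nat.mul_le_mul_right _ (by omega)

/-- As `(1 - 1 / (2 * N)) ^ (2 * N) ≤ 1 / 2`, the exponent `4 * k * N = 2 * N * (2 * k)` yields `4 ^
(-k)`, and `2 ^ (-k) ≤ 1 / k` remains. -/
theorem two_pow_mul_pow_le {N k : ℕ} (hN : 0 < N) (hk : 0 < k) :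
    (2 : ℝ) ^ k * (1 - 1 / ((2 * N : ℕ) : ℝ)) ^ (4 * k * N) ≤ 1 / k := by
  have hN' : (1 : ℝ) ≤ ((2 * N : ℕ) : ℝ) := by exact_mod_cast (by omega)
  have h0 : 0 ≤ 1 - 1 / ((2 * N : ℕ) : ℝ) := by
    rw [sub_nonneg, div_le_one (by linarith)]; exact hN'
  have h1 : (1 - 1 / ((2 * N : ℕ) : ℝ)) ^ (2 * N) ≤ 1 / 2 :=
    (Real.one_sub_div_pow_le_exp_neg hN').trans exp_neg_one_le_half
  have h2 : (1 - 1 / ((2 * N : ℕ) : ℝ)) ^ (4 * k * N) ≤ (1 / 4) ^ k := by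
    rw [show 4 * k * N = 2 * N * (2 * k) by ring, pow_mul]
    refine (pow_le_pow_left₀ (pow_nonneg h0 _) h1 _).trans ?_
    rw [pow_mul]; norm_num
  have h3 : (k : ℝ) ≤ 2 ^ k := by exact_mod_cast Nat.lt_two_pow_self.le
  calc (2 : ℝ) ^ k * (1 - 1 / ((2 * N : ℕ) : ℝ)) ^ (4 * k * N) ≤ 2 ^ k * (1 / 4) ^ k := by gcongr
    _ = (1 / 2) ^ k := by rw [← mul_pow]; norm_num
    _ = 1 / 2 ^ k := by rw [one_div_pow]
    _ ≤ 1 / k := one_div_le_one_div_of_le (by exact_mod_cast hk) h3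

/-- The three failures cost at most `1 / 8`, `1 / 4` and `1 / 48` of `1 / k₁`. In the second one the
size of `A` cancels: `D * |A|` draws contain `D` hits on average. This is why a threshold `k` that
does not involve `|A|` works. -/
theorem lt_drawMean_goodDraws {α : Type*} [DecidableEq α] {A : Finset α} {y : α} (hy : y ∈ A)
    {l k₁ k : ℕ} (hl : 1 ≤ l) (hk₁ : 1 ≤ k₁) (hA : A.card ≤ 2 ^ l) (hk : k = 48 * l * k₁ ^ 2) :
    1 - (1 : ℝ) / k₁ < drawMean A (4 * k * A.card)
      (fun s => if GoodDraws A y (12 * l * k₁) k s then 1 else 0) [] := by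
  have hne : A.Nonempty := ⟨y, hy⟩
  have hN : 0 < A.card := hne.card_pos
  set N := A.card with hNdef
  have hk0 : 0 < k := by rw [hk]; positivity
  have hDk : 12 * l * k₁ ≤ 4 * k := by
    rw [hk]
    have : k₁ ≤ k₁ ^ 2 := Nat.le_self_pow (by norm_num) _
    have := Nat.mul_le_mul_left l this
    nlinarith
  have hDN : ∀ m ≤ N, 12 * l * k₁ * m ≤ 4 * k * N := fun m hm => Nat.mul_le_mul hDk hm
  have h := drawMean_mono (A := A) (r := 4 * k * N) (h := []) (φ := fun _ => 1)
    (ψ := fun s => (if GoodDraws A y (12 * l * k₁) k s then 1 else 0) +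
      (∑ j ∈ Finset.range N, ∑ S ∈ A.powersetCard j,
        ((s.take (12 * l * k₁ * (j + 1))).map fun z => if z ∈ S then (1 : ℝ) else 0).prod) +
      (k : ℝ)⁻¹ * ((s.take (12 * l * k₁ * N)).count y : ℝ) +
      2 ^ k * (s.map fun z => if z = y then (1 / 2 : ℝ) else 1).prod)
    fun t _ ht => one_le_goodDraws_add hk0 (s := [] ++ t) (by simpa using ht)
  rw [drawMean_const hne, drawMean_add, drawMean_add, drawMean_add, drawMean_mul, drawMean_mul,
    drawMean_prod, drawMean_sum, drawMean_take hne (hDN N le_rfl) fun s => ((s.count y : ℕ) : ℝ),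
    drawMean_count hy] at h
  have hNr : (0 : ℝ) < N := by exact_mod_cast hN
  have hkr : (0 : ℝ) < k := by exact_mod_cast hk0
  have hk₁r : (0 : ℝ) < k₁ := by exact_mod_cast hk₁
  have hlr : (0 : ℝ) < l := by exact_mod_cast hl
  have b1 : ∑ j ∈ Finset.range N, drawMean A (4 * k * N) (fun s => ∑ S ∈ A.powersetCard j,
      ((s.take (12 * l * k₁ * (j + 1))).map fun z => if z ∈ S then (1 : ℝ) else 0).prod) [] ≤ 1 / (8 * k₁) := by
    have hlk : l ≤ l * k₁ := Nat.le_mul_of_pos_right _ hk₁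
    have hkl : k₁ ≤ l * k₁ := Nat.le_mul_of_pos_left _ hl
    have h1 : ∀ j ∈ Finset.range N, drawMean A (4 * k * N) (fun s => ∑ S ∈ A.powersetCard j,
        ((s.take (12 * l * k₁ * (j + 1))).map fun z => if z ∈ S then (1 : ℝ) else 0).prod) [] ≤
        N / 2 ^ (6 * (l * k₁)) := by
      intro j hj
      rw [Finset.mem_range] at hj
      rw [drawMean_sum, Finset.sum_congr rfl fun S hS =>
        drawMean_mem hne (Finset.mem_powersetCard.1 hS).1 (hDN (j + 1) hj)]
      rw [Finset.sum_congr rfl fun S hS => by rw [(Finset.mem_powersetCard.1 hS).2],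
        Finset.sum_const, Finset.card_powersetCard, nsmul_eq_mul]
      have := choose_mul_pow_le (E := 6 * (l * k₁)) hj
        (hA.trans (Nat.pow_le_pow_right (by norm_num) (by omega)))
      rwa [show 2 * (6 * (l * k₁)) * (j + 1) = 12 * l * k₁ * (j + 1) by ring] at this
    refine (Finset.sum_le_sum h1).trans ?_
    rw [Finset.sum_const, Finset.card_range, nsmul_eq_mul, ← mul_div_assoc,
      div_le_div_iff₀ (by positivity) (by positivity), one_mul]
    have h2 : k₁ ≤ 2 ^ k₁ := Nat.lt_two_pow_self.le
    -- The final comparison is `l + l + 3 + k₁ ≤ 6 * (l * k₁)`, true because `l`, `k₁` and `1` are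
    -- at most `l * k₁`. It explains the `6`, and `12 = 2 * 6` in the number of draws.
    have h3 : N * N * (8 * k₁) ≤ 2 ^ l * 2 ^ l * (2 ^ 3 * 2 ^ k₁) :=
      Nat.mul_le_mul (Nat.mul_le_mul hA hA) (Nat.mul_le_mul (by norm_num) h2)
    rw [← pow_add, ← pow_add, ← pow_add] at h3
    have h4 := h3.trans (Nat.pow_le_pow_right (n := 2) (i := l + l + (3 + k₁)) (j := 6 * (l * k₁)) (by norm_num)
      (by omega))
    exact_mod_cast h4
  have b2 : (k : ℝ)⁻¹ * ((([] : List α).count y : ℕ) + ((12 * l * k₁ * N : ℕ) : ℝ) * (N : ℝ)⁻¹) =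
      1 / (4 * k₁) := by
    rw [hk]; push_cast
    field_simp
    simp
    ring
  have b3 : (2 : ℝ) ^ k * ((([] : List α).map fun z => if z = y then (1 / 2 : ℝ) else 1).prod *
      ((N : ℝ)⁻¹ * ∑ z ∈ A, if z = y then (1 / 2 : ℝ) else 1) ^ (4 * k * N)) ≤ 1 / (48 * k₁) := by
    have e : (N : ℝ)⁻¹ * ∑ z ∈ A, (if z = y then (1 / 2 : ℝ) else 1) =
        1 - 1 / ((2 * N : ℕ) : ℝ) := by
      have : ∀ z, (if z = y then (1 / 2 : ℝ) else 1) = 1 - if z = y then (1 / 2 : ℝ) else 0 := by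
        intro z; split_ifs <;> norm_num
      simp only [this, Finset.sum_sub_distrib, Finset.sum_ite_eq', hy, if_true, Finset.sum_const,
        nsmul_eq_mul, ← hNdef]
      push_cast
      field_simp
    rw [e, List.map_nil, List.prod_nil, one_mul]
    refine (two_pow_mul_pow_le hN hk0).trans (one_div_le_one_div_of_le (by positivity) ?_)
    rw [hk]
    have : 48 * k₁ ≤ 48 * l * k₁ ^ 2 := by
      have h1 : k₁ ≤ k₁ ^ 2 := Nat.le_self_pow (by norm_num) _
      have h2 : 1 * k₁ ≤ l * k₁ ^ 2 := Nat.mul_le_mul hl h1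
      nlinarith
    exact_mod_cast this
  rw [b2] at h
  have e1 : (1 : ℝ) / (8 * k₁) = 1 / 8 * (1 / k₁) := by field_simp
  have e2 : (1 : ℝ) / (4 * k₁) = 1 / 4 * (1 / k₁) := by field_simp
  have e3 : (1 : ℝ) / (48 * k₁) = 1 / 48 * (1 / k₁) := by field_simp
  have e4 : (0 : ℝ) < 1 / k₁ := by positivity
  rw [e1] at b1
  rw [e2] at h
  rw [e3] at b3
  linarith

/-! ### Halting programs -/

theorem bind_eq_self_of_support {α : Type*} {p : PMF α} {f : α → PMF α}
    (h : ∀ a ∈ p.support, f a = PMF.pure a) : p.bind f = p := by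
  conv_rhs => rw [← PMF.bind_pure p]
  ext b
  rw [PMF.bind_apply, PMF.bind_apply]
  refine tsum_congr fun a => ?_
  by_cases ha : p a = 0
  · simp [ha]
  · rw [h a ((PMF.mem_support_iff _ _).2 ha)]

/-- Once all runs have halted the distribution is stationary, so the supremum is attained at `N`. -/
theorem haltFrom_eq {P : Program} {I : List ℤ} {c : Config} {N : ℕ}
    (hN : ∀ d ∈ (runFrom P I N c).support, Halted P d) (E : Config → Prop) :
    haltFrom P I E c = (runFrom P I N c).toOuterMeasure {c | Halted P c ∧ E c} := by
  have key : ∀ j, runFrom P I (N + j) c = runFrom P I N c := by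
    intro j
    induction j with
    | zero => rfl
    | succ j ih =>
      rw [← add_assoc, runFrom_succ', ih]
      exact bind_eq_self_of_support fun d hd => step_of_halted (hN d hd)
  refine le_antisymm (iSup_le fun n => ?_) (le_iSup (fun N => (runFrom P I N c).toOuterMeasure _) N)
  refine (toOuterMeasure_runFrom_mono P I E c (Nat.le_add_left n N)).trans ?_
  simp only [key]
  exact le_rfl

theorem haltFrom_le_one (P : Program) (I : List ℤ) (E : Config → Prop) (c : Config) :
    haltFrom P I E c ≤ 1 := by
  refine iSup_le fun N => ?_
  rw [PMF.toOuterMeasure_apply, ← (runFrom P I N c).tsum_coe]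
  exact ENNReal.tsum_le_tsum fun d => Set.indicator_le_self _ _ d

theorem Deterministic.exists_runFrom_eq {P : Program} (hP : Deterministic P) (I : List ℤ) (N : ℕ)
    (c : Config) : ∃ d, runFrom P I N c = PMF.pure d := by
  have hstep : ∀ c, ∃ d, step P I c = PMF.pure d := by
    intro c
    unfold step
    split
    · exact ⟨c, rfl⟩
    · next ins hi =>
      cases ins with
      | rand i j => exact absurd (List.mem_of_getElem? hi) (hP i j)
      | _ => exact ⟨_, rfl⟩
  induction N generalizing c with
  | zero => exact ⟨c, rfl⟩
  | succ N ih =>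
    obtain ⟨d, hd⟩ := hstep c
    obtain ⟨e, he⟩ := ih d
    exact ⟨e, by rw [runFrom, hd, PMF.pure_bind, he]⟩

theorem Deterministic.exists_final {D : Program} (hD : Deterministic D) {I : List ℤ} {t : ℕ}
    (ht : HaltsInTime D I t) (E : Config → Prop) :
    ∃ n g, runFrom D I n init = PMF.pure g ∧ Halted D g ∧ g.time ≤ t ∧
      (E g ↔ haltProb D I E = 1) := by
  obtain ⟨N, hN⟩ := ht
  rw [run_eq_runFrom] at hN
  obtain ⟨g, hg⟩ := hD.exists_runFrom_eq I N init
  have hmem : g ∈ (runFrom D I N init).support := by rw [hg]; simp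
  refine ⟨N, g, hg, (hN g hmem).1, (hN g hmem).2, ?_⟩
  rw [haltProb_eq_haltFrom, haltFrom_eq fun d hd => (hN d hd).1, hg,
    PMF.toOuterMeasure_pure_apply]
  by_cases hE : E g <;> simp [hE, (hN g hmem).1]

/-- For distinct `y` the events that exactly `[y]` is produced are disjoint, and `firstWord` is `y`
on each of them; the remaining runs only add to the mean. -/
theorem sum_le_genMean {G : Program} {x : Word} {N : ℕ} {A : Finset Word}
    (hN : ∀ d ∈ (runFrom G (encWord x) N init).support, Halted G d)
    (hG : ∀ y ∈ A, haltProb G (encWord x) (fun c => c.outputs.map Prod.snd = [y]) =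
      (A.card : ℝ≥0∞)⁻¹) (f : Word → ℝ≥0∞) :
    ∑ y ∈ A, (A.card : ℝ≥0∞)⁻¹ * f y ≤ genMean G x N f := by
  classical
  have h1 : ∀ y ∈ A, (A.card : ℝ≥0∞)⁻¹ * f y = ∑' d, Set.indicator
      {c | Halted G c ∧ c.outputs.map Prod.snd = [y]} (runFrom G (encWord x) N init) d * f y := by
    intro y hy
    rw [ENNReal.tsum_mul_right, ← PMF.toOuterMeasure_apply, ← hG y hy, haltProb_eq_haltFrom,
      haltFrom_eq hN]
  rw [Finset.sum_congr rfl h1, ← Summable.tsum_finsetSum fun _ _ => ENNReal.summable]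
  refine ENNReal.tsum_le_tsum fun d => ?_
  have h2 : ∀ y ∈ A, Set.indicator {c | Halted G c ∧ c.outputs.map Prod.snd = [y]}
      (runFrom G (encWord x) N init) d * f y ≤
      if y = firstWord d then runFrom G (encWord x) N init d * f y else 0 := by
    intro y _
    rw [Set.indicator_apply]
    split_ifs with h3 h4
    · exact le_rfl
    · exact absurd (by rw [firstWord, h3.2]; rfl) h4
    · simp
    · simp
  refine (Finset.sum_le_sum h2).trans ?_
  rw [Finset.sum_ite_eq']
  split_ifs
  · exact le_rfl
  · exact zero_le

theorem Reach.haltFrom_le {P : Program} {I : List ℤ} {c c' : Config} (h : Reach P I c c')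
    (E : Config → Prop) : haltFrom P I E c' ≤ haltFrom P I E c :=
  (h.leads (Q := fun d w => d = c' ∧ w = haltFrom P I E c') le_rfl (.done ⟨rfl, rfl⟩)).le_haltFrom
    fun _ _ ⟨h1, h2⟩ => by rw [h1, h2]

theorem Leads.of_pure_step {P : Program} {I : List ℤ} {Q : Config → ℝ≥0∞ → Prop} {B : ℕ}
    {c c₁ : Config} {w : ℝ≥0∞} (h : Leads P I Q B c w) (hc : EnumRAM.step P I c = PMF.pure c₁) :
    Q c w ∨ ∃ w', Leads P I Q B c₁ w' := by
  cases h with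
  | done h => exact .inl h
  | step f _ hf _ => exact .inr ⟨_, hf c₁ (by rw [hc]; simp)⟩

/-! ### Success of the main loop -/

section
variable {M G D : Program} {C d b₁ b₂ b₃ b₄ b₅ b₆ b₇ : ℕ} {I : List ℤ} {x y : Word}
  {β T u N k Δ B₀ : ℕ} {A : Finset Word} {B : ℕ → ℝ}

/-- In the configuration `c` at the head of the main loop, the words `h` have been produced in due
time. -/
structure History (b : ℕ) (x y : Word) (T k : ℕ) (A : Finset Word) (B₀ Δ : ℕ) (h : List Word)
    (c : Config) : Prop where
  checkpoint : Checkpoint b x y T (k - hits y h : ℤ) c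
  words : c.outputs.map Prod.snd = h
  hits_le : hits y h ≤ k
  time_output : ∀ i tw, c.outputs[i]? = some tw → tw.1 ≤ B₀ + Δ * (i + 1)
  time : c.time ≤ B₀ + Δ * h.length
  mem : ∀ z ∈ h, z ∈ A

/-- Here `t` is a fictitious continuation of the draws `h` made so far. The last hit is already in
`h`, and goodness puts it after the first `δ * A.card` draws, so all prefixes on which goodness
depends lie inside `h`. -/
theorem History.enumerates {b : ℕ} {c m₀ : Config} {h t : List Word}
    (H : History b x y T k A B₀ Δ h c) {δ : ℕ} (hδ : δ ≤ 4 * k)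
    (hB : ∀ m ≤ A.card, ((B₀ + 4 + Δ * (4 * k * m) : ℕ) : ℝ) ≤ B m)
    (hcount : k ≤ hits y h) (hgood : GoodDraws A y δ k (h ++ t))
    (hos : m₀.outputs = c.outputs) (ht : m₀.time ≤ B₀ + 4 + Δ * (4 * k * A.card)) :
    EnumeratesInIncTime ↑A B m₀ := by
  obtain ⟨g1, g2, -⟩ := hgood
  -- If `h` were shorter, the first `δ * A.card` draws would contain all of `h`, hence `k` hits.
  have hlen : δ * A.card ≤ h.length := by
    by_contra hlt
    rw [List.take_append, List.take_of_length_le (by omega), hits_append] at g2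
    omega
  have htake : ∀ m ≤ A.card, (h ++ t).take (δ * m) = h.take (δ * m) := fun m hm =>
    List.take_append_of_le_length ((Nat.mul_le_mul_left _ hm).trans hlen)
  have hmem : ∀ w, (∃ t, (t, w) ∈ m₀.outputs) ↔ w ∈ h := by
    intro w
    rw [hos, ← H.words, List.mem_map]
    exact ⟨fun ⟨t, ht⟩ => ⟨_, ht, rfl⟩, fun ⟨⟨t, w'⟩, h1, h2⟩ => ⟨t, by cases h2; exact h1⟩⟩
  have hset : {w | ∃ t, (t, w) ∈ m₀.outputs} = ↑A := by
    ext w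
    rw [Set.mem_ofPred_eq, hmem, Finset.mem_coe]
    refine ⟨H.mem w, fun hw => ?_⟩
    have h1 := g1 A.card le_rfl
    rw [htake _ le_rfl] at h1
    have h2 : (h.take (δ * A.card)).toFinset ⊆ A := fun z hz =>
      H.mem z (List.mem_of_mem_take (List.mem_toFinset.1 hz))
    have h3 := Finset.eq_of_subset_of_card_le h2 h1
    rw [← h3] at hw
    exact List.mem_of_mem_take (List.mem_toFinset.1 hw)
  refine ⟨hset, fun m hm => ?_, ?_⟩
  · rw [Set.ncard_coe_finset] at hm
    have h1 := g1 m hm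
    rw [htake m hm] at h1
    refine h1.trans ?_
    rw [← Set.ncard_coe_finset]
    refine Set.ncard_le_ncard (fun w hw => ?_)
      (A.finite_toSet.subset fun w ⟨t, h1, _⟩ => hset ▸ ⟨t, h1⟩)
    rw [Finset.mem_coe, List.mem_toFinset, List.mem_take_iff_getElem] at hw
    obtain ⟨i, hi, rfl⟩ := hw
    have hi' : i < c.outputs.length := by
      rw [← H.words, List.length_map] at hi; omega
    have hti := H.time_output i c.outputs[i] (List.getElem?_eq_getElem hi')
    refine ⟨c.outputs[i].1, ?_, ?_⟩
    · rw [hos]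
      simp only [← H.words, List.getElem_map]
      exact List.getElem_mem hi'
    · refine le_trans ?_ (hB m hm)
      have h2 : Δ * (i + 1) ≤ Δ * (4 * k * m) :=
        Nat.mul_le_mul_left _ ((by omega : i + 1 ≤ δ * m).trans (Nat.mul_le_mul_right _ hδ))
      exact_mod_cast (by omega : c.outputs[i].1 ≤ B₀ + 4 + Δ * (4 * k * m))
  · rw [Set.ncard_coe_finset]
    exact le_trans (by exact_mod_cast ht) (hB _ le_rfl)

/-- The loop, of random length, is compared with exactly `4 * k * A.card` draws, by induction on the
number `r` of draws left. When the counter reaches `0` the remaining draws are fictitious. If the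
draws run out while the counter is positive, `y` has fewer than `k` hits and the list is not good,
so there is nothing to prove. -/
theorem Layout.drawMean_le_haltFrom (L : Layout M C d G D b₁ b₂ b₃ b₄ b₅ b₆ b₇)
    (hkb : bits (k : ℤ) ≤ β) (hu : StageBound x β T u) (hx : 8 * x.length + 13 ≤ β)
    (himm : ∀ ins ∈ G, immBits ins ≤ β ∧ ∀ l ∈ calcLines 3 ins, l.imm 0 ≤ β)
    (hN : ∀ d ∈ (runFrom G (encWord x) N init).support, Halted G d ∧ d.time ≤ T)
    (hG : ∀ y ∈ A, haltProb G (encWord x) (fun c => c.outputs.map Prod.snd = [y]) =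
      (A.card : ℝ≥0∞)⁻¹) (hy : y ∈ A) {δ : ℕ} (hδ : δ ≤ 4 * k) (hΔ : Δ = 8 ^ 41 * (u * u))
    (hB : ∀ m ≤ A.card, ((B₀ + 4 + Δ * (4 * k * m) : ℕ) : ℝ) ≤ B m)
    (r : ℕ) {c : Config} {h : List Word} (H : History b₅ x y T k A B₀ Δ h c)
    (hr : h.length + r = 4 * k * A.card) :
    ENNReal.ofReal (drawMean A r (fun s => if GoodDraws A y δ k s then 1 else 0) h) ≤
      haltFrom M I (EnumeratesInIncTime ↑A B) c := by
  have hne : A.Nonempty := ⟨y, hy⟩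
  have hcard : (0 : ℝ) < A.card := by exact_mod_cast hne.card_pos
  obtain ⟨φ, hφ⟩ : ∃ φ : List Word → ℝ, φ = fun s => if GoodDraws A y δ k s then 1 else 0 :=
    ⟨_, rfl⟩
  rw [← hφ]
  have hφ1 : ∀ s, φ s ≤ 1 := fun s => by rw [hφ]; dsimp only; split_ifs <;> norm_num
  have hφ0 : ∀ s, 0 ≤ φ s := fun s => by rw [hφ]; dsimp only; split_ifs <;> norm_num
  have hnn : ∀ r h, 0 ≤ drawMean A r φ h := fun r h =>
    (drawMean_const hne r 0 h).symm.le.trans (drawMean_mono fun t _ _ => hφ0 _)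
  have hcase : ∀ (r : ℕ) (c : Config) (h : List Word), History b₅ x y T k A B₀ Δ h c →
      h.length + r = 4 * k * A.card → hits y h = k →
      ENNReal.ofReal (drawMean A r φ h) ≤ haltFrom M I (EnumeratesInIncTime ↑A B) c := by
    intro r c h H hr hK
    obtain ⟨-, m₀, -, hreach, hpc, -, -, -, hos, htm⟩ := L.step_head (I := I) H.checkpoint
    rw [hK, sub_self] at hpc htm
    rw [if_neg (by omega)] at hpc
    rw [bits_zero] at htm
    -- The success of the stopped run does not depend on the draws left: one good continuation
    -- forces it, and without any the mean is `0`.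
    by_cases hgood : ∃ t : List Word, GoodDraws A y δ k (h ++ t)
    · obtain ⟨t, hgood⟩ := hgood
      have hE : EnumeratesInIncTime ↑A B m₀ := by
        refine H.enumerates hδ hB hK.ge hgood hos ?_
        have h1 : Δ * h.length ≤ Δ * (4 * k * A.card) := Nat.mul_le_mul_left _ (by omega)
        have h2 := H.time
        omega
      refine le_trans ?_ (hreach.haltFrom_le _)
      rw [haltFrom_of_halted (L.halted hpc) hE, ENNReal.ofReal_le_one]
      exact (drawMean_mono fun t _ _ => hφ1 _).trans_eq (drawMean_const hne r 1 h)
    · push Not at hgood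
      have : drawMean A r φ h = 0 := (drawMean_congr fun t _ _ => by
        rw [hφ]; exact if_neg (hgood t)).trans (drawMean_const hne r 0 h)
      rw [this, ENNReal.ofReal_zero]
      exact zero_le
  induction r generalizing c h with
  | zero =>
    by_cases hK : hits y h = k
    · exact hcase 0 c h H hr hK
    have h1 : ¬GoodDraws A y δ k h := fun hg => hK (le_antisymm H.hits_le hg.2.2)
    have h2 : drawMean A 0 φ h = 0 := by rw [hφ]; exact if_neg h1
    rw [h2, ENNReal.ofReal_zero]
    exact zero_le
  | succ r ih =>
    by_cases hK : hits y h = k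
    · exact hcase _ c h H hr hK
    have hlt := lt_of_le_of_ne H.hits_le hK
    -- Draws outside `A` are given up by the weight `0`.
    set f : Word → ℝ≥0∞ := fun z =>
      if z ∈ A then ENNReal.ofReal (drawMean A r φ (h ++ [z])) else 0 with hf
    have hl := L.leads_round (I := I) H.checkpoint (by omega)
      ((bits_mono (by omega)).trans hkb) hu hx himm hN f
    rw [← hΔ] at hl
    refine le_trans (b := genMean G x N f) ?_ (hl.le_haltFrom ?_)
    · refine le_trans ?_ (sum_le_genMean (fun d hd => (hN d hd).1) hG f)
      rw [drawMean, ENNReal.ofReal_mul (by positivity),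
        ENNReal.ofReal_sum_of_nonneg fun z _ => hnn _ _, Finset.mul_sum,
        ENNReal.ofReal_inv_of_pos hcard, ENNReal.ofReal_natCast]
      exact (Finset.sum_congr rfl fun z hz => by rw [hf]; simp only [hz, if_true]).le
    · rintro c' w ⟨z, t, hc', hos, htt, htm, hw⟩
      refine hw.trans ?_
      simp only [hf]
      split_ifs with hz
      · have hhits : hits y (h ++ [z]) = hits y h + if z = y then 1 else 0 := by
          rw [hits_append, hits_singleton]
        have hlen : c.outputs.length = h.length := by rw [← H.words, List.length_map]
        have htime := H.time
        have htm' : c'.time ≤ B₀ + Δ * (h.length + 1) := by rw [mul_add]; omega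
        refine ih ⟨?_, ?_, ?_, fun i tw hi => ?_, ?_, ?_⟩ (by simp; omega)
        · rw [hhits]
          convert hc' using 1
          split_ifs <;> push_cast <;> ring
        · rw [hos, List.map_append, H.words]; rfl
        · rw [hhits]; split_ifs <;> omega
        · rw [hos] at hi
          rcases lt_or_ge i c.outputs.length with h1 | h1
          · rw [List.getElem?_append_left h1] at hi
            exact H.time_output i tw hi
          · rw [List.getElem?_append_right h1, List.getElem?_singleton] at hi
            split_ifs at hi with h2
            cases hi
            have : i = h.length := by omega
            rw [this]
            exact htt.trans htm'
        · rw [List.length_append]; exact htm'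
        · intro z' hz'
          rcases List.mem_append.1 hz' with h1 | h1
          · exact H.mem z' h1
          · rw [List.mem_singleton.1 h1]; exact hz
      · exact zero_le

end

/-! ### The space bound -/

/-- With `t₀ = m.time` the bounds in `Grow` become absolute. All nonzero registers lie in an initial
range whose length is linear in `x.length + T`: scratch and control registers have small addresses,
and the arrays `3` and `5` hold at most `2 * x.length + 1` and `T` further entries between them. -/
theorem HasBase.grow {x y : Word} {K : ℤ} {m : Config} {b T : ℕ}
    (h : HasBase x (encPair x y) K m) (hb : MaxBits b m.reg) (hy : y.length ≤ T)
    (ho : ∀ i, bits (m.out i) ≤ 2) (hz : ∀ i, T < i → m.out i = 0) (h2 : 2 ≤ b) :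
    Grow b (8 * (2 * x.length + T + 20)) m.time m where
  time := le_rfl
  reg a := Nat.add_le_add_right (hb a) _
  out a := Nat.add_le_add_right ((ho a).trans h2) _
  cardReg := by
    refine Nat.add_le_add_right ?_ _
    rw [← Finset.card_range (8 * (2 * x.length + T + 20))]
    refine Finset.card_le_card fun a ha => ?_
    rw [Finsupp.mem_support_iff] at ha
    rw [Finset.mem_range]
    by_contra hlt
    refine ha ?_
    have h88 : ∀ k ∈ scratch, k ≤ 88 := by decide
    rw [h a fun hs => by have := h88 a hs; omega, baseReg, if_neg (by omega), if_neg (by omega),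
      if_neg (by omega)]
    split_ifs
    · exact List.getD_eq_default _ _ (by rw [length_encWord]; omega)
    · exact List.getD_eq_default _ _ (by simp [encPair]; omega)
    · rfl
  cardOut := by
    refine Nat.add_le_add_right ?_ _
    rw [← Finset.card_range (8 * (2 * x.length + T + 20))]
    refine Finset.card_le_card fun a ha => ?_
    rw [Finsupp.mem_support_iff] at ha
    rw [Finset.mem_range]
    by_contra hlt
    exact ha (hz a (by omega))

section
variable {M G D : Program} {C d b₁ b₂ b₃ b₄ b₅ b₆ b₇ : ℕ} {x : Word}
  {β T T' u N k : ℕ} {ε : ℚ}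

/-- The checkpoints are the start, the head of the main loop and the halted configurations. From one
to the next the time is at most `B₀`, so memory grows by a bounded amount before it is erased. The
number of rounds does not matter, and this is essential: an unlucky run may never see the reference
word again. -/
theorem Layout.usesSpace {S : Set Word} (L : Layout M C d G D b₁ b₂ b₃ b₄ b₅ b₆ b₇) (hε : 0 < ε)
    (hk : k = C * (x.length + 1) ^ d * (2 ^ precision ε) ^ 2) (hk0 : 0 < k)
    (hkb : bits (k : ℤ) ≤ β) (hx : 8 * x.length + 13 ≤ β)
    (hu : StageBound x β T u) (hu' : StageBound x β T' u)
    (hG : ∀ ins ∈ G, immBits ins ≤ β ∧ ∀ l ∈ calcLines 3 ins, l.imm 0 ≤ β)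
    (hD : ∀ ins ∈ D, immBits ins ≤ β ∧ ∀ l ∈ calcLines 5 ins, l.imm 0 ≤ β)
    (hN : ∀ g ∈ (runFrom G (encWord x) N init).support, Halted G g ∧ g.time ≤ T)
    (hdec : ∀ y : Word, y.length ≤ T → ∃ n g, runFrom D (encPair x y) n init = PMF.pure g ∧
      Halted D g ∧ g.time ≤ T' ∧ (g.reg 0 ≠ 0 ↔ y ∈ S))
    {b B₀ : ℕ} (hb : b = 8 * x.length + ratSize ε + C + 40)
    (hB : B₀ = 8 ^ (d + 50) * (b * b) + 8 ^ 42 * (u * u)) {s b' : ℕ}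
    (hM : ∀ ins ∈ M, immBits ins ≤ b') (hs : s = 8 * (2 * x.length + T + 20))
    (hβ : β ≤ b') (hεb : ratSize ε + 2 ≤ b') :
    UsesSpace M (encWordRat x ε) (2 * ((s + B₀) * (b' + B₀))) := by
  intro n c' hc'
  rw [run_eq_runFrom] at hc'
  have hΔ : 8 ^ 41 * (u * u) ≤ B₀ := by
    rw [hB]
    have : 8 ^ 41 * (u * u) ≤ 8 ^ 42 * (u * u) := Nat.mul_le_mul_right _ (by norm_num)
    omega
  set Q : Config → Prop := fun c => c = init ∨
    (∃ y K, y.length ≤ T ∧ 0 ≤ K ∧ K ≤ (k : ℤ) ∧ Checkpoint b₅ x y T K c) ∨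
    (Halted M c ∧ Grow b' s c.time c) with hQ
  have hmax : ∀ {y : Word} {K : ℤ} {c : Config}, 0 ≤ K → K ≤ (k : ℤ) → Checkpoint b₅ x y T K c →
      MaxBits β c.reg := fun h0 h1 hc => by
    rw [hc.reg]
    exact maxBits_baseReg bits_encPair_le ((bits_mono (by omega)).trans hkb) hx
  refine space_le_of_checkpoints (Q := Q) hM (fun v hv => (bits_encWordRat_le v hv).trans hεb)
    (fun c hc => ?_) (fun c hc => ?_) (.inl rfl) n hc'
  · rcases hc with rfl | ⟨y, K, hy, h0, h1, hc⟩ | ⟨-, hc⟩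
    · exact ⟨le_rfl, fun a => by simp [init], fun a => by simp [init], by simp [init],
        by simp [init]⟩
    · rw [hs]
      exact (HasBase.of_eq hc.reg).grow ((hmax h0 h1 hc).mono hβ) hy hc.out_bits hc.out_zero
        (by omega)
    · exact hc
  · rcases hc with rfl | ⟨y, K, hy, h0, h1, hc⟩ | ⟨hc, -⟩
    · right
      have h0 : M[0]? = some (.const 24 4) := L.setup.head
      have hstep : step M (encWordRat x ε) init = PMF.pure (setReg init 1 24 4) := by
        rw [step_eq_exec (ins := .const 24 4) (by exact h0)]; rfl
      rcases (L.leads_prep hε hk hk0 hkb hx hu hu' hG hD hN hdec hb hB fun _ => 1).of_pure_step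
        hstep with ⟨y, K, -, -, hc, -⟩ | ⟨w, hl⟩
      · have h5 := hc.pc
        have h6 := L.eq₅
        have h7 : 0 < sizeCmds (.lines acceptLines :: cleanCmds) := by decide
        have h8 : init.pc = 0 := rfl
        omega
      · refine ⟨_, w, hstep, hl.trans (by simp [init]) ?_⟩
        rintro c w ⟨y, K, hy, hK, hc, -⟩
        exact .done (.inr (.inl ⟨y, K, hy, by omega, by omega, hc⟩))
    · right
      obtain ⟨c₁, m₀, hstep, hreach, hpc, hbase, hbits, ho, hos, htm⟩ :=
        L.step_head (I := encWordRat x ε) hc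
      by_cases hK : 0 < K
      · rcases (L.leads_round (I := encWordRat x ε) hc hK ((bits_mono (by omega)).trans hkb) hu hx
          hG hN fun _ => 1).of_pure_step hstep with ⟨z, t, -, h2, -⟩ | ⟨w, hl⟩
        -- The round cannot be over at its start, since it adds an output.
        · have := congrArg List.length h2
          simp at this
        · refine ⟨_, w, hstep, hl.trans (by omega) ?_⟩
          rintro c w ⟨z, t, hc, -⟩
          exact .done (.inr (.inl ⟨y, _, hy, by split_ifs <;> omega, by split_ifs <;> omega, hc⟩))
      · have hK0 : K = 0 := by omega
        have huu : u ≤ u * u := Nat.le_mul_self u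
        have h5 := hu.length
        rw [if_neg hK] at hpc
        rw [hK0, bits_zero] at htm
        have h6 : Reach M (encWordRat x ε) c₁ m₀ := by
          rcases Relation.ReflTransGen.cases_head hreach with h | ⟨c₂, h2, h3⟩
          · have e1 := L.eq₇
            have e2 := L.eq₆
            have e3 := hc.pc
            rw [h] at e3
            omega
          · rw [hstep] at h2
            have h4 := congrArg PMF.support h2
            rw [PMF.support_pure, PMF.support_pure, Set.singleton_eq_singleton_iff] at h4
            rwa [h4]
        refine ⟨c₁, 0, hstep, h6.leads (by omega) (.done (.inr (.inr ⟨L.halted hpc, ?_⟩)))⟩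
        rw [hs]
        exact hbase.grow ((hbits _ (hmax h0 h1 hc)).mono hβ) hy (by rw [ho]; exact hc.out_bits)
          (by rw [ho]; exact hc.out_zero) (by omega)
    · exact .inl hc

/-! ### The success probability of the whole machine -/

theorem one_le_mul_two_pow_precision (hε : 0 < ε) : (1 : ℝ) ≤ ε * 2 ^ precision ε := by
  have h := den_le_precision hε
  have hd : (0 : ℝ) < ε.den := by exact_mod_cast ε.den_pos
  have h2 : (ε : ℝ) = ε.num / ε.den := by exact_mod_cast ε.num_div_den.symm
  rw [h2, div_mul_eq_mul_div, le_div_iff₀ hd, one_mul]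
  exact_mod_cast h

/-- By minimality of `precision ε`, half of the power is still too small; if the precision is `0`,
the hypothesis `ε ≤ 1` takes over. This keeps the counter polynomial in `1 / ε`. -/
theorem mul_two_pow_precision_le (h1 : ε ≤ 1) : (ε : ℝ) * 2 ^ precision ε ≤ 2 := by
  have h1' : (ε : ℝ) ≤ 1 := by exact_mod_cast h1
  rcases Nat.eq_zero_or_pos (precision ε) with h0 | h0
  · rw [h0]; linarith
  · obtain ⟨i, hi⟩ : ∃ i, precision ε = i + 1 := ⟨precision ε - 1, by omega⟩
    have h := lt_den_of_lt_precision (ε := ε) (i := i) (by omega)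
    have hd : (0 : ℝ) < ε.den := by exact_mod_cast ε.den_pos
    have h2 : (ε : ℝ) = ε.num / ε.den := by exact_mod_cast ε.num_div_den.symm
    have h3 : (ε : ℝ) * 2 ^ i ≤ 1 := by
      rw [h2, div_mul_eq_mul_div, div_le_one hd]
      exact_mod_cast h.le
    rw [hi, pow_succ]
    linarith

/-- For every reference word in `A` the success probability exceeds `1 - ε`, hence so does the mean
over the reference word. If `A` is empty, every reference word is rejected and the machine stops
with no output, which is a success. -/
theorem Layout.lt_toReal_haltProb {A : Finset Word} {B : ℕ → ℝ} {C₀ l : ℕ}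
    (L : Layout M C d G D b₁ b₂ b₃ b₄ b₅ b₆ b₇) (hε : 0 < ε)
    (hk : k = C * (x.length + 1) ^ d * (2 ^ precision ε) ^ 2) (hC : C = 48 * C₀)
    (hl : l = C₀ * (x.length + 1) ^ d) (hl1 : 1 ≤ l) (hA : A.card ≤ 2 ^ l)
    (hkb : bits (k : ℤ) ≤ β) (hx : 8 * x.length + 13 ≤ β)
    (hu : StageBound x β T u) (hu' : StageBound x β T' u)
    (hG : ∀ ins ∈ G, immBits ins ≤ β ∧ ∀ l ∈ calcLines 3 ins, l.imm 0 ≤ β)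
    (hD : ∀ ins ∈ D, immBits ins ≤ β ∧ ∀ l ∈ calcLines 5 ins, l.imm 0 ≤ β)
    (hN : ∀ g ∈ (runFrom G (encWord x) N init).support, Halted G g ∧ g.time ≤ T)
    (hdec : ∀ y : Word, y.length ≤ T → ∃ n g, runFrom D (encPair x y) n init = PMF.pure g ∧
      Halted D g ∧ g.time ≤ T' ∧ (g.reg 0 ≠ 0 ↔ y ∈ A))
    (hgen : ∀ y ∈ A, haltProb G (encWord x) (fun c => c.outputs.map Prod.snd = [y]) =
      (A.card : ℝ≥0∞)⁻¹)
    {b B₀ : ℕ} (hb : b = 8 * x.length + ratSize ε + C + 40)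
    (hB₀ : B₀ = 8 ^ (d + 50) * (b * b) + 8 ^ 42 * (u * u))
    (hB : ∀ m ≤ A.card, ((B₀ + 4 + 8 ^ 41 * (u * u) * (4 * k * m) : ℕ) : ℝ) ≤ B m) :
    1 - (ε : ℝ) < (haltProb M (encWordRat x ε) (EnumeratesInIncTime ↑A B)).toReal := by
  have hεr : (0 : ℝ) < ε := by exact_mod_cast hε
  -- The form required by `lt_drawMean_goodDraws`, with `k₁ = 2 ^ precision ε`.
  have hk' : k = 48 * l * (2 ^ precision ε) ^ 2 := by rw [hk, hC, hl]; ring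
  have hk0 : 0 < k := by rw [hk']; positivity
  set I := encWordRat x ε with hI
  set E := EnumeratesInIncTime ↑A B with hE
  rw [haltProb_eq_haltFrom]
  have hfin : haltFrom M I E init ≠ ⊤ := ne_top_of_le_ne_top ENNReal.one_ne_top (haltFrom_le_one _ _ _ _)
  suffices H : ∃ v : ℝ, 1 - (ε : ℝ) < v ∧ ENNReal.ofReal v ≤ haltFrom M I E init by
    obtain ⟨v, h1, h2⟩ := H
    exact h1.trans_le ((ENNReal.ofReal_le_iff_le_toReal hfin).1 h2)
  have hprep := L.leads_prep (S := ↑A) hε hk hk0 hkb hx hu hu' hG hD hN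
    (by simpa only [Finset.mem_coe] using hdec) hb hB₀
  rcases A.eq_empty_or_nonempty with hA0 | hne
  · refine ⟨1, by linarith, ?_⟩
    have h := hprep fun _ => 1
    rw [genMean_const] at h
    rw [ENNReal.ofReal_one]
    refine h.le_haltFrom ?_
    rintro c w ⟨y, K, -, -, hc, hos, ht, hw, hw1⟩
    by_cases hw0 : w = 0
    · rw [hw0]; exact zero_le
    have hK : ¬K ≠ 0 := by rw [hw hw0, hA0]; simp
    rw [not_not] at hK
    obtain ⟨-, m₀, -, hreach, hpc, -, -, -, hos', htm⟩ := L.step_head (I := I) hc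
    rw [hK, bits_zero] at htm
    rw [if_neg (by omega)] at hpc
    refine hw1.trans ((haltFrom_of_halted (L.halted hpc) ?_).symm.le.trans
      (hreach.haltFrom_le E))
    have hout : m₀.outputs = [] := by rw [hos', hos]
    refine ⟨?_, fun m hm => ?_, ?_⟩
    · rw [hout, hA0]; simp
    · rw [Set.ncard_coe_finset, hA0, Finset.card_empty] at hm
      omega
    · rw [Set.ncard_coe_finset, hA0, Finset.card_empty]
      refine le_trans ?_ (hB 0 (by omega))
      exact_mod_cast (by omega : m₀.time ≤ B₀ + 4 + 8 ^ 41 * (u * u) * (4 * k * 0))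
  · set δ := 12 * l * 2 ^ precision ε with hδ
    have hδk : δ ≤ 4 * k := by
      rw [hδ, hk']
      have h1 : 2 ^ precision ε ≤ (2 ^ precision ε) ^ 2 := Nat.le_self_pow (by norm_num) _
      have := Nat.mul_le_mul_left l h1
      nlinarith
    have hcard : (0 : ℝ) < A.card := by exact_mod_cast hne.card_pos
    set p : Word → ℝ := fun y =>
      drawMean A (4 * k * A.card) (fun s => if GoodDraws A y δ k s then 1 else 0) [] with hp
    have hp1 : ∀ y ∈ A, 1 - (ε : ℝ) < p y := by
      intro y hy
      refine lt_of_le_of_lt ?_ (lt_drawMean_goodDraws hy hl1 Nat.one_le_two_pow hA hk')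
      have h1 := one_le_mul_two_pow_precision hε
      have : (1 : ℝ) / ((2 ^ precision ε : ℕ) : ℝ) ≤ ε := by
        rw [div_le_iff₀ (by positivity)]
        exact_mod_cast h1
      linarith
    have hp0 : ∀ y, 0 ≤ p y := fun y =>
      (drawMean_const hne _ 0 []).symm.le.trans (drawMean_mono fun t _ _ => by
        split_ifs <;> norm_num)
    refine ⟨(A.card : ℝ)⁻¹ * ∑ y ∈ A, p y, ?_, ?_⟩
    · rw [← div_eq_inv_mul, lt_div_iff₀ hcard, mul_comm, ← nsmul_eq_mul, ← Finset.sum_const]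
      exact Finset.sum_lt_sum_of_nonempty hne hp1
    · set f : Word → ℝ≥0∞ := fun y => if y ∈ A then ENNReal.ofReal (p y) else 0 with hf
      refine le_trans (b := genMean G x N f) ?_ ((hprep f).le_haltFrom ?_)
      · refine le_trans ?_ (sum_le_genMean (fun d hd => (hN d hd).1) hgen f)
        rw [ENNReal.ofReal_mul (by positivity), ENNReal.ofReal_sum_of_nonneg fun y _ => hp0 y,
          Finset.mul_sum, ENNReal.ofReal_inv_of_pos hcard, ENNReal.ofReal_natCast]
        exact (Finset.sum_congr rfl fun z hz => by rw [hf]; simp only [hz, if_true]).le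
      · rintro c w ⟨y, K, hyT, hK, hc, hos, ht, hw, hw1⟩
        by_cases hw0 : w = 0
        · rw [hw0]; exact zero_le
        have hy : y ∈ A := by
          by_contra hy
          simp only [hf, hy, if_false] at hw1
          exact hw0 (le_antisymm hw1 zero_le)
        have hKk : K = k := hK.resolve_left ((hw hw0).2 hy)
        simp only [hf, hy, if_true] at hw1
        refine hw1.trans (L.drawMean_le_haltFrom hkb hu hx hG hN hgen hy hδk rfl hB _ ⟨?_, ?_, ?_,
          ?_, ?_, by simp⟩ (by simp))
        · rw [hKk] at hc
          simpa [hits] using hc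
        · rw [hos]; rfl
        · simp [hits]
        · intro i tw hi; rw [hos] at hi; simp at hi
        · simpa using ht

end

/-! ### Polynomial bounds -/

theorem eval_le_eval (p : Polynomial ℕ) {m n : ℕ} (h : m ≤ n) : p.eval m ≤ p.eval n := by
  rw [Polynomial.eval_eq_sum_range, Polynomial.eval_eq_sum_range]
  gcongr

theorem exists_eval_le (p : Polynomial ℕ) : ∃ C d, ∀ n, p.eval n ≤ C * (n + 1) ^ d := by
  refine ⟨∑ i ∈ Finset.range (p.natDegree + 1), p.coeff i, p.natDegree, fun n => ?_⟩
  rw [Polynomial.eval_eq_sum_range, Finset.sum_mul]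
  refine Finset.sum_le_sum fun i hi => Nat.mul_le_mul_left _ ?_
  rw [Finset.mem_range] at hi
  exact (Nat.pow_le_pow_left (Nat.le_succ n) i).trans (Nat.pow_le_pow_right (by omega) (by omega))

/-- A word of length at most `m`, padded by `none`, is a function on `Fin m` with values in the four
elements of `Option Symbol`. -/
theorem card_le_of_length_le {A : Finset Word} {m : ℕ} (h : ∀ y ∈ A, y.length ≤ m) :
    A.card ≤ 2 ^ (2 * m) := by
  have h1 : A.card ≤ (Finset.univ : Finset (Fin m → Option Symbol)).card := by
    refine Finset.card_le_card_of_injOn (fun y i => y[(i : ℕ)]?) (fun _ _ => by simp) ?_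
    intro y hy z hz hyz
    refine List.ext_getElem? fun i => ?_
    by_cases hi : i < m
    · exact congrFun hyz ⟨i, hi⟩
    · rw [List.getElem?_eq_none ((h y hy).trans (by omega)),
        List.getElem?_eq_none ((h z hz).trans (by omega))]
  refine h1.trans_eq ?_
  rw [Finset.card_univ, pow_mul]
  simp

theorem exists_forall_le {α : Type*} (l : List α) (f : α → ℕ) : ∃ b, ∀ a ∈ l, f a ≤ b :=
  ⟨(l.map f).sum, fun _ ha => List.single_le_sum (by simp) _ (List.mem_map_of_mem ha)⟩

theorem exists_immBits_le (q : ℕ) (P : Program) :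
    ∃ b, ∀ ins ∈ P, immBits ins ≤ b ∧ ∀ l ∈ calcLines q ins, l.imm 0 ≤ b := by
  obtain ⟨b₁, h₁⟩ := exists_forall_le P immBits
  obtain ⟨b₂, h₂⟩ := exists_forall_le (P.flatMap (calcLines q)) (Line.imm 0)
  exact ⟨b₁ + b₂, fun ins hi => ⟨(h₁ ins hi).trans (by omega), fun l hl =>
    (h₂ l (List.mem_flatMap.2 ⟨ins, hi, hl⟩)).trans (by omega)⟩⟩

/-- The counter can be exponential in the size of `ε`, but its number of bits, which governs the
space, is polynomial. -/
theorem bits_counter_le {C n d j : ℕ} :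
    bits ((C * (n + 1) ^ d * (2 ^ j) ^ 2 : ℕ) : ℤ) ≤ C * (n + 1) ^ d + (2 * j + 1) := by
  rw [Nat.cast_mul]
  refine (bits_mul_le _ _).trans (add_le_add (bits_natCast_le_self _) ?_)
  rw [bits_le_iff, Int.natAbs_natCast, ← pow_mul]
  exact Nat.pow_lt_pow_right (by norm_num) (by omega)

/-- The time per draw may involve only `x.length` and `1 / ε`, not the size of `ε`. The bits of the
counter are therefore bounded by the counter `k` itself, and `u * u * k ≤ (v + 1) ^ 2 * k ^ 3`. As
`k` is quadratic in `2 ^ j ≤ 2 / ε`, the exponent of `1 / ε` is `6`, and `k ^ 3` contributes `3 * d`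
to that of `n + 1`. -/
theorem round_time_le {C n d a j u v W m : ℕ} {ε : ℝ} (hε : 0 < ε) (hj : ε * 2 ^ j ≤ 2)
    (hk : 0 < C * (n + 1) ^ d * (2 ^ j) ^ 2)
    (hu : u ≤ v + C * (n + 1) ^ d * (2 ^ j) ^ 2) (hv : (v + 1) ^ 2 ≤ W * (n + 1) ^ a) :
    ((8 ^ 41 * (u * u) * (4 * (C * (n + 1) ^ d * (2 ^ j) ^ 2) * m) : ℕ) : ℝ) ≤
      ((8 ^ 41 * 4 * W * C ^ 3 * 64 : ℕ) : ℝ) * (m : ℝ) ^ 1 * ((n : ℝ) + 1) ^ (a + 3 * d) *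
        ε⁻¹ ^ 6 := by
  set k := C * (n + 1) ^ d * (2 ^ j) ^ 2 with hkdef
  have h1 : u ≤ (v + 1) * k := by nlinarith
  have h2 : u * u * k ≤ W * (n + 1) ^ a * k ^ 3 := by
    calc u * u * k ≤ (v + 1) * k * ((v + 1) * k) * k := by gcongr
      _ = (v + 1) ^ 2 * k ^ 3 := by ring
      _ ≤ _ := Nat.mul_le_mul_right _ hv
  have h3 : k ^ 3 = C ^ 3 * (n + 1) ^ (3 * d) * (2 ^ j) ^ 6 := by rw [hkdef]; ring
  have h4 : ((2 : ℝ) ^ j) ^ 6 ≤ 64 * ε⁻¹ ^ 6 := by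
    have : (2 : ℝ) ^ j ≤ 2 * ε⁻¹ := by
      rw [← div_eq_mul_inv, le_div_iff₀ hε]; linarith
    calc ((2 : ℝ) ^ j) ^ 6 ≤ (2 * ε⁻¹) ^ 6 := pow_le_pow_left₀ (by positivity) this 6
      _ = _ := by rw [mul_pow]; norm_num
  have h5 : 8 ^ 41 * (u * u) * (4 * k * m) ≤
      8 ^ 41 * 4 * m * (W * (n + 1) ^ a * (C ^ 3 * (n + 1) ^ (3 * d) * (2 ^ j) ^ 6)) := by
    rw [← h3]
    calc 8 ^ 41 * (u * u) * (4 * k * m) = 8 ^ 41 * 4 * m * (u * u * k) := by ring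
      _ ≤ _ := Nat.mul_le_mul_left _ h2
  calc ((8 ^ 41 * (u * u) * (4 * k * m) : ℕ) : ℝ)
      ≤ ((8 ^ 41 * 4 * m * (W * (n + 1) ^ a * (C ^ 3 * (n + 1) ^ (3 * d) * (2 ^ j) ^ 6)) : ℕ) : ℝ) :=
        by exact_mod_cast h5
    _ = 8 ^ 41 * 4 * m * (W * ((n : ℝ) + 1) ^ a * (C ^ 3 * ((n : ℝ) + 1) ^ (3 * d))) *
          ((2 : ℝ) ^ j) ^ 6 := by push_cast; ring
    _ ≤ 8 ^ 41 * 4 * m * (W * ((n : ℝ) + 1) ^ a * (C ^ 3 * ((n : ℝ) + 1) ^ (3 * d))) *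
          (64 * ε⁻¹ ^ 6) := mul_le_mul_of_nonneg_left h4 (by positivity)
    _ = _ := by push_cast; ring

set_option maxHeartbeats 1000000 in
/-- The enumeration problem of a set with a polytime uniform generator is in randomized
`IncP₁` with repetitions and polynomial space. -/
theorem EnumP.randIncPRepetitionsPolySpace {A : Word → Set Word} (hA : EnumP A)
    (hG : ∃ G : Program, IsPolytimeUniformGenerator A G) : RandIncPRepetitionsPolySpace 1 A := by
  refine ⟨hA, ?_⟩
  obtain ⟨⟨D, pD, hDdet, hD⟩, pL, hL⟩ := hA
  obtain ⟨G, ⟨pG, hGt⟩, hGu⟩ := hG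
  obtain ⟨C₁, d, hC₁⟩ := exists_eval_le pL
  -- Words have length at most `C₁ * (n + 1) ^ d`, so `|A x| ≤ 4 ^ (C₁ * (n + 1) ^ d) ≤ 2 ^ l` with
  -- `l = C₀ * (n + 1) ^ d`; the `+ 1` makes `l` positive.
  obtain ⟨C₀, hC₀⟩ : ∃ C₀, C₀ = 2 * C₁ + 1 := ⟨_, rfl⟩
  obtain ⟨C, hC⟩ : ∃ C, C = 48 * C₀ := ⟨_, rfl⟩
  obtain ⟨M, b₁, b₂, b₃, b₄, b₅, b₆, b₇, L⟩ := exists_layout C d G D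
  obtain ⟨βG, hβG⟩ := exists_immBits_le 3 G
  obtain ⟨βD, hβD⟩ := exists_immBits_le 5 D
  obtain ⟨βM, hβM⟩ := exists_forall_le M immBits
  -- `V` gathers all that depends on the length of `x` alone: the times of the generator and of the
  -- decision program, and the constants in the code. Below, `U` adds the bits of the counter, `Z`
  -- bounds the preparation and `s` the space.
  obtain ⟨V, hV⟩ : ∃ V : Polynomial ℕ, ∀ n, V.eval n = pG.eval n + pD.eval (n + pG.eval n) +
      8 * n + (βG + βD + βM + 40) :=
    ⟨pG + pD.comp (.X + pG) + 8 * .X + .C (βG + βD + βM + 40), fun n => by simp⟩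
  obtain ⟨W, a, hW⟩ := exists_eval_le ((V + 1) ^ 2)
  obtain ⟨U, hU⟩ : ∃ U : Polynomial ℕ, ∀ n, U.eval n = V.eval n + (C * (n + 1) ^ d + (2 * n + 1)) :=
    ⟨V + (.C C * (.X + 1) ^ d + (2 * .X + 1)), fun n => by simp⟩
  obtain ⟨κ₁, hκ₁⟩ : ∃ κ, κ = 8 ^ (d + 50) := ⟨_, rfl⟩
  obtain ⟨κ₂, hκ₂⟩ : ∃ κ, κ = 8 ^ 42 := ⟨_, rfl⟩
  obtain ⟨Z, hZ⟩ : ∃ Z : Polynomial ℕ, ∀ n, Z.eval n = κ₁ *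
      ((8 * n + C + 40) * (8 * n + C + 40)) + κ₂ * (U.eval n * U.eval n) :=
    ⟨.C κ₁ * ((8 * .X + .C C + 40) * (8 * .X + .C C + 40)) + .C κ₂ * (U * U), fun n => by simp⟩
  obtain ⟨s, hs⟩ : ∃ s : Polynomial ℕ, ∀ n, s.eval n = 2 * ((8 * (2 * n + pG.eval n + 20) +
      Z.eval n) * (U.eval n + n + 2 + Z.eval n)) :=
    ⟨2 * ((8 * (2 * .X + pG + 20) + Z) * (U + .X + 2 + Z)), fun n => by simp⟩
  -- The exponents and the constant are those of `round_time_le`; `4` is for leaving the main loop.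
  refine ⟨M, a + 3 * d, 6, 8 ^ 41 * 4 * W * C ^ 3 * 64, Z + 4, s, fun x ε hε => ?_⟩
  obtain ⟨n, hn⟩ : ∃ n, n = x.length := ⟨_, rfl⟩
  obtain ⟨k, hk⟩ : ∃ k, k = C * (x.length + 1) ^ d * (2 ^ precision ε) ^ 2 := ⟨_, rfl⟩
  have hk0 : 0 < k := by
    rw [hk]
    exact Nat.mul_pos (Nat.mul_pos (by omega) (pow_pos (Nat.succ_pos _) _))
      (pow_pos (pow_pos two_pos _) _)
  have hkb : bits (k : ℤ) ≤ C * (n + 1) ^ d + (2 * precision ε + 1) := by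
    rw [hk, hn]; exact bits_counter_le
  have hVn := hV n
  obtain ⟨T, hT⟩ : ∃ T, T = pG.eval n := ⟨_, rfl⟩
  obtain ⟨T', hT'⟩ : ∃ T', T' = pD.eval (n + T) := ⟨_, rfl⟩
  obtain ⟨β, hβ⟩ : ∃ β, β = βG + βD + βM + 8 * n + 13 + bits (k : ℤ) := ⟨_, rfl⟩
  obtain ⟨u, hu⟩ : ∃ u, u = V.eval n + bits (k : ℤ) := ⟨_, rfl⟩
  obtain ⟨b, hb⟩ : ∃ b, b = 8 * x.length + ratSize ε + C + 40 := ⟨_, rfl⟩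
  obtain ⟨B₀, hB₀⟩ : ∃ B₀, B₀ = 8 ^ (d + 50) * (b * b) + 8 ^ 42 * (u * u) := ⟨_, rfl⟩
  rw [← hT, ← hT'] at hVn
  have hus : StageBound x β T u := ⟨by omega, by omega, by omega⟩
  have hus' : StageBound x β T' u := ⟨by omega, by omega, by omega⟩
  have hgenG : ∀ ins ∈ G, immBits ins ≤ β ∧ ∀ l ∈ calcLines 3 ins, l.imm 0 ≤ β := fun ins hi =>
    ⟨(hβG ins hi).1.trans (by omega), fun l hl => ((hβG ins hi).2 l hl).trans (by omega)⟩
  have hdecD : ∀ ins ∈ D, immBits ins ≤ β ∧ ∀ l ∈ calcLines 5 ins, l.imm 0 ≤ β := fun ins hi =>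
    ⟨(hβD ins hi).1.trans (by omega), fun l hl => ((hβD ins hi).2 l hl).trans (by omega)⟩
  obtain ⟨N, hN⟩ := hGt x
  rw [run_eq_runFrom, ← hn, ← hT] at hN
  have hdec : ∀ y : Word, y.length ≤ T → ∃ n g, runFrom D (encPair x y) n init = PMF.pure g ∧
      Halted D g ∧ g.time ≤ T' ∧ (g.reg 0 ≠ 0 ↔ y ∈ A x) := by
    intro y hy
    obtain ⟨m, g, h1, h2, h3, h4⟩ := hDdet.exists_final (hD x y).1 fun c => c.reg 0 ≠ 0
    refine ⟨m, g, h1, h2, h3.trans ?_, h4.trans (hD x y).2.symm⟩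
    rw [hT', hn]
    exact eval_le_eval pD (by omega)
  obtain ⟨e, he⟩ : ∃ e, e = x.length + ratSize ε := ⟨_, rfl⟩
  have hne : n ≤ e := by omega
  have huU : u ≤ U.eval e := by
    have h1 := eval_le_eval V hne
    have h2 : C * (n + 1) ^ d ≤ C * (e + 1) ^ d := by gcongr
    have h3 := precision_le hε
    rw [hU]
    omega
  have hB₀Z : B₀ ≤ Z.eval e := by
    have h1 : b ≤ 8 * e + C + 40 := by omega
    rw [hB₀, hZ, ← hκ₁, ← hκ₂]
    gcongr
  constructor
  -- For `ε > 1` the required probability is negative.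
  · rcases lt_or_ge 1 ε with h1 | h1
    · have : (1 : ℝ) < ε := by exact_mod_cast h1
      exact lt_of_lt_of_le (by linarith) ENNReal.toReal_nonneg
    have hfin : (A x).Finite := (List.finite_length_le Symbol (pL.eval x.length)).subset (hL x)
    obtain ⟨S, hS⟩ := hfin.exists_finset_coe
    obtain ⟨l, hl⟩ : ∃ l, l = C₀ * (x.length + 1) ^ d := ⟨_, rfl⟩
    have hl1 : 1 ≤ l := by rw [hl, hC₀]; exact Nat.mul_pos (by omega) (pow_pos (Nat.succ_pos _) _)
    have hSl : S.card ≤ 2 ^ l := by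
      refine (card_le_of_length_le fun y hy => hL x y ?_).trans
        (Nat.pow_le_pow_right (by norm_num) ?_)
      · rw [← hS]; exact hy
      · rw [hl, hC₀]
        have := hC₁ x.length
        nlinarith
    have hgen : ∀ y ∈ S, haltProb G (encWord x) (fun c => c.outputs.map Prod.snd = [y]) =
        (S.card : ℝ≥0∞)⁻¹ := by
      intro y hy
      rw [← Set.ncard_coe_finset, hS]
      exact hGu x y (by rw [← hS]; exact hy)
    rw [← hS] at hdec ⊢
    refine L.lt_toReal_haltProb hε hk hC hl hl1 hSl (by omega) (by omega) hus hus' hgenG hdecD hN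
      (by simpa only [Finset.mem_coe] using hdec) hgen hb hB₀ fun m _ => ?_
    have hround := round_time_le (C := C) (n := x.length) (d := d) (a := a) (j := precision ε)
      (u := u) (v := V.eval n) (W := W) (m := m) (ε := (ε : ℝ)) (by exact_mod_cast hε)
      (mul_two_pow_precision_le h1) (by rw [← hk]; exact hk0)
      (by rw [← hk, hu]; have := bits_natCast_le_self k; omega)
      (by rw [← hn]; simpa using hW n)
    rw [← hk] at hround
    rw [Nat.cast_add]
    refine add_le_add ?_ hround
    rw [← he, Polynomial.eval_add]
    have : B₀ + 4 ≤ Z.eval e + (4 : Polynomial ℕ).eval e := by simpa using hB₀Z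
    exact_mod_cast this
  · intro m c hc
    refine (L.usesSpace hε hk hk0 (by omega) (by omega) hus hus' hgenG hdecD hN hdec hb hB₀
      (b' := u + ratSize ε + 2) (s := 8 * (2 * x.length + T + 20)) (fun ins hi =>
        (hβM ins hi).trans (by omega)) rfl (by have := hus.beta; omega) (by omega) m c hc).trans ?_
    rw [← he, hs]
    have h1 : T ≤ pG.eval e := hT ▸ eval_le_eval pG hne
    have h2 : u + ratSize ε + 2 ≤ U.eval e + e + 2 := by omega
    have h3 : x.length ≤ e := by omega
    gcongr

end EnumRAM

theorem mainTheorem8 (A : EnumRAM.Word → Set EnumRAM.Word) (hA : EnumRAM.EnumP A)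
    (hG : ∃ G : EnumRAM.Program, EnumRAM.IsPolytimeUniformGenerator A G) :
    EnumRAM.RandIncPRepetitionsPolySpace 1 A :=
  hA.randIncPRepetitionsPolySpace hG
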